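/- A level graph is a finite directed graph $G=(V,E)$ with a level assignment $\ell\colon V\to\{1,\dots,k\}$ such that $\ell(u)<\ell(v)$ for all $(u,v)\in E$; it is proper if $\ell(v)=\ell(u)+1$ for all $(u,v)\in E$. Two edges are independent if they share no endpoint. A level drawing of $G$ places each vertex $v$ on the line $y=\ell(v)$ and draws each edge as a $y$-monotone curve between its endpoints, so that distinct vertices are distinct points, no edge passes through a vertex, any two distinct edges have finitely many common points, and no three edges have a common interior point. Two edges cross at a common interior point if they change sides there. A level drawing is Hanani–Tutte if any two independent edges cross an even number of times. $G$ is level planar if it has a level drawing in which distinct edges meet only at common endpoints. The system $\mathcal S(G)$ has a Boolean variable $uw$ for each ordered pair of distinct vertices $u,w$ with $\ell(u)=\ell(w)$, and consists of the consistency constraints $uw\Leftrightarrow\neg wu$ for all variables $uw$, and the planarity constraints $uw\Leftrightarrow vx$ for all variables $uw,vx$ such that $(u,v),(w,x)\in E$ are independent. The star form $G^\star$ is obtained as follows. For each level $i$, number its vertices $v_1,\dots,v_{n_i}$ in an arbitrary way and replace level $i$ by $2n_i$ consecutive sublevels $1^i,\dots,(2n_i)^i$ (those of level $i$ lie below those of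 level $i+1$). Replace $v_j$ by two vertices $v_j',v_j''$ on the sublevels $j^i$ and $(n_i+j)^i$, joined by an edge $(v_j',v_j'')$, and replace each edge $(u,v)\in E$ by $(u'',v')$. **Theorem.** Let $G$ be a proper level graph and let $G^\star$ be its star form with respect to any numbering of the vertices on the levels. Then $$\mathcal S(G)\text{ is satisfiable}\iff G^\star\text{ has a Hanani–Tutte level drawing}\iff G\text{ is level planar}.$$ -/

import Mathlib

open Set Filter Topology

/-- A level graph on the vertex set `V`: a directed graph without parallel edges, given by its set
of edges `(u, v)`, with a level assignment into `{1, …, k}` that increases along every edge. -/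
structure LevelGraph (V : Type*) where
  /-- the number `k` of levels -/
  height : ℕ
  /-- the set of directed edges -/
  edges : Set (V × V)
  /-- the level assignment -/
  level : V → ℕ
  level_mem : ∀ v, level v ∈ Icc 1 height
  level_lt : ∀ u v, (u, v) ∈ edges → level u < level v

/-- Two edges are independent if they share no endpoint. -/
def IndependentPairs {V : Type*} (e f : V × V) : Prop :=
  e.1 ≠ f.1 ∧ e.1 ≠ f.2 ∧ e.2 ≠ f.1 ∧ e.2 ≠ f.2

namespace LevelGraph

variable {V : Type*}

/-- Every edge joins two consecutive levels. -/
def IsProper (G : LevelGraph V) : Prop :=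
  ∀ u v, (u, v) ∈ G.edges → G.level u + 1 = G.level v

/-! ### The reduced constraint system -/

/-- The variables: ordered pairs `uw` of distinct vertices on the same level. -/
def Var (G : LevelGraph V) : Type _ :=
  {p : V × V // p.1 ≠ p.2 ∧ G.level p.1 = G.level p.2}

/-- The variable `wu` obtained from the variable `uw`. -/
def Var.swap {G : LevelGraph V} (p : G.Var) : G.Var :=
  ⟨(p.1.2, p.1.1), p.2.1.symm, p.2.2.symm⟩

/-- The consistency clauses: `uw ↔ ¬ wu` for every variable `uw`. -/
def Consistency (G : LevelGraph V) (φ : G.Var → Bool) : Prop :=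
  ∀ p : G.Var, φ p = true ↔ ¬ φ p.swap = true

/-- The planarity clauses: `uw ↔ vx` for all variables `uw`, `vx` such that `(u, v)` and `(w, x)`
are independent edges. -/
def Planarity (G : LevelGraph V) (φ : G.Var → Bool) : Prop :=
  ∀ p q : G.Var, (p.1.1, q.1.1) ∈ G.edges → (p.1.2, q.1.2) ∈ G.edges →
    IndependentPairs (p.1.1, q.1.1) (p.1.2, q.1.2) → (φ p = true ↔ φ q = true)

/-- The reduced system, consisting of the consistency clauses and the planarity clauses (but no
transitivity clauses), has a satisfying truth assignment. -/
def ReducedSystemSatisfiable (G : LevelGraph V) : Prop :=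
  ∃ φ : G.Var → Bool, G.Consistency φ ∧ G.Planarity φ

/-! ### Level drawings -/

/-- The open interval of heights strictly between the endpoints of an edge. -/
def span (G : LevelGraph V) (e : G.edges) : Set ℝ :=
  Ioo (G.level e.1.1 : ℝ) (G.level e.1.2)

/-- A (not necessarily planar) level drawing. The vertex `v` is drawn at the point
`(pos v, level v)`. The edge `e` is drawn as an upward monotone curve, i.e. a curve which meets each
horizontal line at most once, and hence consists of the points `(curve e t, t)`, where `t` runs
from the level of its lower endpoint to the level of its upper endpoint and `curve e` is continuous
there (values of `curve e` elsewhere play no role). -/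
structure Drawing (G : LevelGraph V) where
  /-- the horizontal coordinate of a vertex -/
  pos : V → ℝ
  /-- the horizontal coordinate of an edge, as a function of the height -/
  curve : G.edges → ℝ → ℝ
  continuousOn_curve : ∀ e : G.edges,
    ContinuousOn (curve e) (Icc (G.level e.1.1 : ℝ) (G.level e.1.2))
  curve_source : ∀ e : G.edges, curve e (G.level e.1.1) = pos e.1.1
  curve_target : ∀ e : G.edges, curve e (G.level e.1.2) = pos e.1.2
  /-- distinct vertices are drawn at distinct points -/
  pos_ne : ∀ u v, u ≠ v → G.level u = G.level v → pos u ≠ pos v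
  /-- no edge passes through a vertex -/
  curve_ne_pos : ∀ (e : G.edges) (v : V),
    (G.level v : ℝ) ∈ G.span e → curve e (G.level v) ≠ pos v
  /-- two distinct edges have only finitely many common points -/
  finite_meet : ∀ e f : G.edges, e ≠ f →
    {t | t ∈ G.span e ∩ G.span f ∧ curve e t = curve f t}.Finite
  /-- no three edges meet in a common interior point -/
  no_triple : ∀ e f g : G.edges, e ≠ f → e ≠ g → f ≠ g →
    ∀ t ∈ G.span e ∩ G.span f ∩ G.span g, ¬ (curve e t = curve f t ∧ curve f t = curve g t)

/-- The heights of the crossings of two edges. A crossing is a common interior point at which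
the two edges change sides: one of them is to the left of the other just below this point, and
to the right of it just above this point. -/
def Drawing.crossings {G : LevelGraph V} (Γ : G.Drawing) (e f : G.edges) : Set ℝ :=
  {t | t ∈ G.span e ∩ G.span f ∧ Γ.curve e t = Γ.curve f t ∧
    (((∀ᶠ s in 𝓝[<] t, Γ.curve e s < Γ.curve f s) ∧
        ∀ᶠ s in 𝓝[>] t, Γ.curve f s < Γ.curve e s) ∨
      ((∀ᶠ s in 𝓝[<] t, Γ.curve f s < Γ.curve e s) ∧
        ∀ᶠ s in 𝓝[>] t, Γ.curve e s < Γ.curve f s))}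

/-- The set of crossings of two distinct edges is finite, so that its cardinality is meaningful. -/
theorem Drawing.finite_crossings {G : LevelGraph V} (Γ : G.Drawing) {e f : G.edges} (h : e ≠ f) :
    (Γ.crossings e f).Finite :=
  (Γ.finite_meet e f h).subset fun _ ht => ⟨ht.1, ht.2.1⟩

/-- Any two independent edges cross an even number of times. -/
def Drawing.IsHananiTutte {G : LevelGraph V} (Γ : G.Drawing) : Prop :=
  ∀ e f : G.edges, IndependentPairs e.1 f.1 → Even (Γ.crossings e f).ncard

/-- Any two distinct edges are disjoint except for common endpoints. -/
def Drawing.IsPlanar {G : LevelGraph V} (Γ : G.Drawing) : Prop :=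
  ∀ e f : G.edges, e ≠ f → ∀ t ∈ G.span e ∩ G.span f, Γ.curve e t ≠ Γ.curve f t

/-- The graph has a Hanani-Tutte level drawing. -/
def HasHananiTutteDrawing (G : LevelGraph V) : Prop :=
  ∃ Γ : G.Drawing, Γ.IsHananiTutte

/-- The graph has a planar level drawing. -/
def IsLevelPlanar (G : LevelGraph V) : Prop :=
  ∃ Γ : G.Drawing, Γ.IsPlanar

/-! ### The star form -/

/-- The number `n_i` of vertices on level `i`. -/
noncomputable def levelCard (G : LevelGraph V) (i : ℕ) : ℕ :=
  {v | G.level v = i}.ncard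

/-- The number `n_1 + ⋯ + n_{i-1}` of vertices below level `i`. -/
noncomputable def cardBelow (G : LevelGraph V) (i : ℕ) : ℕ :=
  {v | G.level v < i}.ncard

/-- A numbering `v_1, …, v_{n_i}` of the vertices on each level `i`; `idx v = j` means that `v` is
the vertex `v_j` of its level. -/
structure Numbering (G : LevelGraph V) where
  /-- the index of a vertex within its level -/
  idx : V → ℕ
  bijOn : ∀ i, BijOn idx {v | G.level v = i} (Icc 1 (G.levelCard i))

/-- Numberings exist. -/
theorem nonempty_numbering [Finite V] (G : LevelGraph V) : Nonempty G.Numbering := by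
  classical
  have key : ∀ i, ∃ g : V → ℕ, BijOn g {v | G.level v = i} (Icc 1 (G.levelCard i)) := by
    intro i
    refine (Set.toFinite _).exists_bijOn_of_encard_eq ?_
    rw [← (Set.toFinite {v | G.level v = i}).cast_ncard_eq,
      ← (Set.finite_Icc 1 (G.levelCard i)).cast_ncard_eq]
    congr 1
    rw [← Finset.coe_Icc, Set.ncard_coe_finset]
    simp [levelCard]
  choose g hg using key
  refine ⟨⟨fun v => g (G.level v) v, fun i => (hg i).congr ?_⟩⟩
  intro v hv
  have h : G.level v = i := hv
  simp [h]

/-- The vertices of the star form: every vertex `v` is replaced by two vertices `v'` (here `bot v`)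
and `v''` (here `top v`). -/
inductive StarVertex (V : Type*) where
  | bot (v : V) : StarVertex V
  | top (v : V) : StarVertex V

/-- The levels of the star form. Level `i` is replaced by the `2 n_i` sublevels
`1^i, …, (2 n_i)^i`; counted from the bottom, `j^i` is level `2 (n_1 + ⋯ + n_{i-1}) + j`. For the
`j`-th vertex `v` of level `i`, `v'` is put on level `j^i` and `v''` on level `(n_i + j)^i`. -/
noncomputable def starLevel (G : LevelGraph V) (ν : G.Numbering) : StarVertex V → ℕ
  | .bot v => 2 * G.cardBelow (G.level v) + ν.idx v
  | .top v => 2 * G.cardBelow (G.level v) + (G.levelCard (G.level v) + ν.idx v)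

/-- The edges of the star form: the stretch edges `(v', v'')`, and the edge `(u'', v')` for every
edge `(u, v)`. -/
def starEdges (G : LevelGraph V) : Set (StarVertex V × StarVertex V) :=
  {p | ∃ v, p = (.bot v, .top v)} ∪ {p | ∃ u v, (u, v) ∈ G.edges ∧ p = (.top u, .bot v)}

theorem Numbering.idx_mem {G : LevelGraph V} (ν : G.Numbering) (v : V) :
    1 ≤ ν.idx v ∧ ν.idx v ≤ G.levelCard (G.level v) :=
  (ν.bijOn (G.level v)).mapsTo (show G.level v = G.level v from rfl)

theorem cardBelow_add_levelCard_le [Finite V] (G : LevelGraph V) {i j : ℕ} (h : i < j) :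
    G.cardBelow i + G.levelCard i ≤ G.cardBelow j := by
  unfold cardBelow levelCard
  rw [← Set.ncard_union_eq]
  · refine Set.ncard_le_ncard ?_ (Set.toFinite _)
    rintro v (hv | hv)
    · exact lt_trans (show G.level v < i from hv) h
    · exact lt_of_eq_of_lt (show G.level v = i from hv) h
  · rw [Set.disjoint_left]
    intro v hv hv'
    exact absurd (show G.level v = i from hv') (ne_of_lt (show G.level v < i from hv))

theorem cardBelow_le_card [Finite V] (G : LevelGraph V) (i : ℕ) : G.cardBelow i ≤ Nat.card V := by
  unfold cardBelow
  rw [← Set.ncard_univ]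
  exact Set.ncard_le_ncard (subset_univ _)

/-- The star form `G*`, with `2 n_1 + ⋯ + 2 n_k = 2 |V|` levels. -/
noncomputable def star [Finite V] (G : LevelGraph V) (ν : G.Numbering) :
    LevelGraph (StarVertex V) where
  height := 2 * Nat.card V
  edges := G.starEdges
  level := G.starLevel ν
  level_mem := by
    have h (v : V) := (G.cardBelow_add_levelCard_le (Nat.lt_succ_self (G.level v))).trans
      (G.cardBelow_le_card _)
    rintro (v | v) <;> have h1 := h v <;> have h2 := ν.idx_mem v <;>
      simp only [starLevel, mem_Icc] <;> omega
  level_lt := by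
    rintro a b (⟨v, h⟩ | ⟨u, v, huv, h⟩)
    · obtain ⟨rfl, rfl⟩ := Prod.mk.inj h
      have h2 := ν.idx_mem v
      simp only [starLevel]
      omega
    · obtain ⟨rfl, rfl⟩ := Prod.mk.inj h
      have h1 := G.cardBelow_add_levelCard_le (G.level_lt u v huv)
      have h2 := ν.idx_mem u
      have h3 := ν.idx_mem v
      simp only [starLevel]
      omega

end LevelGraph

-- The core is to turn a satisfying assignment into genuine orders on the levels that independent
-- edges preserve (`exists_isOrdering`). Straight segments then draw `G` without crossings
-- (`IsOrdering.isLevelPlanar`), and bent curves draw the star form without crossings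
-- (`IsOrdering.star_isLevelPlanar`). For the converses, two edges that cross an even number of
-- times have the same order at both ends of their common range of heights
-- (`Drawing.lt_iff_lt_of_even`). In a planar drawing of `G` the assignment is read off the
-- positions. In the star form the vertices of one level become edges that overlap in height, and no
-- two vertices share a height; the order of `u`, `w` is therefore carried to their neighbours `v`,
-- `x` along a chain of independent pairs of edges.
--
-- An assignment is a tournament on every level, possibly with cycles. The edges leaving a level
-- also form a tournament, lexicographically by source and target, and the planarity constraints
-- make both endpoint maps weak homomorphisms. Levels and edge sets thus form a zigzag, and linear
-- orders compatible with all its maps are wanted. The orders admitted are the linearizations: they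
-- may disagree with the tournament, but they keep its twins (its two-element modules) adjacent.
--
-- A weak homomorphism collapses modules, its fibres, and then embeds, so it decomposes into drops:
-- collapses of one module and deletions of one element. Linearizations lift along drops
-- (`Down.exists_lift`), and two drops of one tournament complete to a diamond with an amalgamation
-- property: linearizations of the two results with a common image come from a single linearization
-- above (`Drop.joins`). Most lifts rest on inserting a point into a module
-- (`exists_linearization_insert`). Diamonds paste to confluence (`Down.confluent`), so the two ends
-- of the zigzag drop to a common tournament in such a way that linearizations of the ends with a
-- common image extend to a compatible family (`exists_compatible_lin`).

universe u

/-! ### Tournaments, twins and linearizations -/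

/-- A tournament relation. -/
structure IsTournament {α : Type u} (r : α → α → Prop) : Prop where
  asymm : ∀ a b, r a b → ¬ r b a
  total : ∀ a b, a ≠ b → r a b ∨ r b a

/-- Two elements that no third element distinguishes. -/
def IsTwin {α : Type u} (r : α → α → Prop) (a b : α) : Prop :=
  ∀ c, c ≠ a → c ≠ b → (r c a ↔ r c b)

/-- A strict linear order in which the twins of `r` are adjacent. -/
structure IsLinearization {α : Type u} (r s : α → α → Prop) : Prop extends IsTournament s where
  trans : ∀ a b c, s a b → s b c → s a c
  twin : ∀ a b, IsTwin r a b → IsTwin s a b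

/-- A map that preserves and reflects the relation between elements with distinct images. -/
def WeakHom {α β : Type u} (h : α → β) (r : α → α → Prop) (s : β → β → Prop) : Prop :=
  ∀ a b, h a ≠ h b → (r a b ↔ s (h a) (h b))

theorem IsTwin.symm {α : Type u} {r : α → α → Prop} {a b : α} (h : IsTwin r a b) :
    IsTwin r b a := fun c hb ha => (h c ha hb).symm

theorem IsTournament.irrefl {α : Type u} {r : α → α → Prop} (h : IsTournament r) (a : α) :
    ¬ r a a := fun ha => h.asymm a a ha ha

theorem IsTournament.iff_not {α : Type u} {r : α → α → Prop} (h : IsTournament r) {a b : α}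
    (hab : a ≠ b) : r a b ↔ ¬ r b a :=
  ⟨h.asymm a b, fun hn => (h.total a b hab).resolve_right hn⟩

theorem IsTwin.right {α : Type u} {r : α → α → Prop} (hr : IsTournament r) {a b : α}
    (h : IsTwin r a b) {c : α} (ha : c ≠ a) (hb : c ≠ b) : r a c ↔ r b c := by
  rw [hr.iff_not ha.symm, hr.iff_not hb.symm, h c ha hb]

/-! ### Inserting a point into a linearization -/

/-- A linear order on the complement of a point extends along a cut. -/
theorem exists_linearization_of_cut {α β : Type u} {r : α → α → Prop}
    {ι : β → α} (hι : Function.Injective ι) {x : α} (hx : ∀ a, a ≠ x ↔ ∃ b, ι b = a)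
    {μ : β → β → Prop} (hμ : IsLinearization (fun a b => r (ι a) (ι b)) μ) (C : Set α)
    (L : Set β) (hL : ∀ a b, μ a b → b ∈ L → a ∈ L)
    (h1 : ∀ a b, IsTwin r (ι a) (ι b) → (a ∈ L ↔ b ∈ L))
    (h2 : ∀ t, IsTwin r x (ι t) → ∀ c, c ≠ t → (c ∈ L ↔ μ c t))
    (h3 : ∀ b c, ι b ∉ C → ι c ∈ C → (b ∈ L ↔ μ b c)) (hxC : x ∈ C)
    (hC : ∀ b c c', ι b ∉ C → ι c ∈ C → ι c' ∈ C → (μ b c ↔ μ b c')) :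
    ∃ s, IsLinearization r s ∧ WeakHom ι μ s ∧
      (∀ b, b ∉ C → ∀ c ∈ C, ∀ c' ∈ C, (s b c ↔ s b c')) ∧ ∀ b, s (ι b) x ↔ b ∈ L := by
  have hxι : ∀ b, ι b ≠ x := fun b => (hx _).2 ⟨b, rfl⟩
  -- The point `x` goes directly above the lower set `L`. By `h1` the cut separates no twins, by
  -- `h2` the twins of `x` are adjacent to it, and by `h3` it lies inside the interval `C` or at its
  -- border.
  let s : α → α → Prop := fun a b => (∃ a' b', ι a' = a ∧ ι b' = b ∧ μ a' b') ∨
    (b = x ∧ ∃ a' ∈ L, ι a' = a) ∨ (a = x ∧ ∃ b', b' ∉ L ∧ ι b' = b)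
  have s1 : ∀ a b, s (ι a) (ι b) ↔ μ a b := by
    intro a b
    constructor
    · rintro (⟨a', b', ha, hb, h⟩ | ⟨h, -⟩ | ⟨h, -⟩)
      · rwa [← hι ha, ← hι hb]
      · exact absurd h (hxι _)
      · exact absurd h (hxι _)
    · intro h
      exact Or.inl ⟨a, b, rfl, rfl, h⟩
  have s2 : ∀ a, s (ι a) x ↔ a ∈ L := by
    intro a
    constructor
    · rintro (⟨a', b', ha, hb, h⟩ | ⟨h, a', ha', h'⟩ | ⟨h, -⟩)
      · exact absurd hb (hxι _)
      · rwa [← hι h']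
      · exact absurd h (hxι _)
    · intro h
      exact Or.inr (Or.inl ⟨rfl, a, h, rfl⟩)
  have s3 : ∀ a, s x (ι a) ↔ a ∉ L := by
    intro a
    constructor
    · rintro (⟨a', b', ha, hb, h⟩ | ⟨h, -⟩ | ⟨h, a', ha', h'⟩)
      · exact absurd ha (hxι _)
      · exact absurd h (hxι _)
      · rwa [← hι h']
    · intro h
      exact Or.inr (Or.inr ⟨rfl, a, h, rfl⟩)
  have s4 : ¬ s x x := by
    rintro (⟨a', b', ha, hb, h⟩ | ⟨h, a', ha', h'⟩ | ⟨h, a', ha', h'⟩)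
    exacts [hxι _ ha, hxι _ h', hxι _ h']
  have cov : ∀ a, a = x ∨ ∃ b, ι b = a := fun a => by
    by_cases h : a = x
    · exact Or.inl h
    · exact Or.inr ((hx a).1 h)
  have tri : ∀ a b, a ∉ L → b ∈ L → μ b a := by
    intro a b ha hb
    by_contra h
    rcases hμ.total a b (by rintro rfl; exact ha hb) with h' | h'
    · exact ha (hL _ _ h' hb)
    · exact h h'
  have tw : ∀ a b, IsTwin r (ι a) (ι b) → IsTwin μ a b := by
    intro a b h
    exact hμ.twin a b fun c ha hb => h (ι c) (hι.ne ha) (hι.ne hb)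
  refine ⟨s, ⟨⟨?_, ?_⟩, ?_, ?_⟩, fun a b _ => (s1 a b).symm, ?_, s2⟩
  · intro a b
    rcases cov a with rfl | ⟨a, rfl⟩ <;> rcases cov b with rfl | ⟨b, rfl⟩ <;>
      simp only [s1, s2, s3, s4] <;> try tauto
    exact hμ.asymm a b
  · intro a b
    rcases cov a with rfl | ⟨a, rfl⟩ <;> rcases cov b with rfl | ⟨b, rfl⟩ <;>
      simp only [s1, s2, s3, s4] <;> try tauto
    intro h
    exact hμ.total a b fun h' => h (congrArg ι h')
  · intro a b c
    rcases cov a with rfl | ⟨a, rfl⟩ <;> rcases cov b with rfl | ⟨b, rfl⟩ <;>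
      rcases cov c with rfl | ⟨c, rfl⟩ <;> simp only [s1, s2, s3, s4] <;> try tauto
    exact hμ.trans a b c
  · intro a b h c hca hcb
    rcases cov a with rfl | ⟨a, rfl⟩ <;> rcases cov b with rfl | ⟨b, rfl⟩ <;>
      rcases cov c with rfl | ⟨c, rfl⟩ <;> simp only [s1, s2, s3] <;> try tauto
    · exact h2 b h c fun h' => hcb (congrArg ι h')
    · exact (h2 a h.symm c fun h' => hca (congrArg ι h')).symm
    · exact not_congr (h1 a b h)
    · exact tw a b h c (fun h' => hca (congrArg ι h')) (fun h' => hcb (congrArg ι h'))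
  · intro b hb c hc c' hc'
    rcases cov b with rfl | ⟨b, rfl⟩
    · exact absurd hxC hb
    rcases cov c with rfl | ⟨c, rfl⟩ <;> rcases cov c' with rfl | ⟨c', rfl⟩ <;>
      simp only [s1, s2]
    · exact h3 b c' hb hc'
    · exact (h3 b c hb hc).symm
    · exact hC b c c' hb hc hc'

section Insert

variable {α β : Type u} {r : α → α → Prop} {ι : β → α} {x : α} {μ : β → β → Prop} {C : Set α}

/-- Extending a linearization next to a twin of the new point. -/
theorem exists_linearization_of_twin (hι : Function.Injective ι) (hx : ∀ a, a ≠ x ↔ ∃ b, ι b = a)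
    (hμ : IsLinearization (fun a b => r (ι a) (ι b)) μ) (hxC : x ∈ C)
    (hC : ∀ b c c', ι b ∉ C → ι c ∈ C → ι c' ∈ C → (μ b c ↔ μ b c'))
    {t₀ : β} (ht₀ : IsTwin r x (ι t₀)) (P : Prop)
    (H1 : ∀ b c, ι b ∉ C → ι c ∈ C → b ≠ t₀ → (μ b t₀ ↔ μ b c))
    (H2 : ι t₀ ∉ C → ∀ c, ι c ∈ C → (P ↔ μ t₀ c))
    (H3 : ∀ t, t ≠ t₀ → IsTwin r x (ι t) → (P ↔ μ t₀ t))
    (H4 : ∀ b, b ≠ t₀ → IsTwin r (ι t₀) (ι b) → (P ↔ μ b t₀)) :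
    ∃ s, IsLinearization r s ∧ WeakHom ι μ s ∧
      (∀ b, b ∉ C → ∀ c ∈ C, ∀ c' ∈ C, (s b c ↔ s b c')) ∧ (s (ι t₀) x ↔ P) := by
  have hxι : ∀ b, ι b ≠ x := fun b => (hx _).2 ⟨b, rfl⟩
  have tw : ∀ a b, IsTwin r (ι a) (ι b) → IsTwin μ a b := by
    intro a b h
    exact hμ.twin a b fun c ha hb => h (ι c) (hι.ne ha) (hι.ne hb)
  have irr := hμ.irrefl t₀
  -- The new point goes immediately next to `t₀`, above it exactly when `P` holds. `H1` and `H2`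
  -- keep it at the interval `C`; `H3` puts it between `t₀` and a further twin of its own, `H4` on
  -- the side of `t₀` away from another twin of `t₀`.
  refine Exists.imp (fun s h => ⟨h.1, h.2.1, h.2.2.1, (h.2.2.2 t₀).trans (by simp [irr])⟩)
    (exists_linearization_of_cut hι hx hμ C {c | μ c t₀ ∨ (c = t₀ ∧ P)} ?_ ?_ ?_ ?_ hxC hC)
  · rintro a b hab (hb | ⟨rfl, -⟩)
    · exact Or.inl (hμ.trans _ _ _ hab hb)
    · exact Or.inl hab
  · intro a b hab
    simp only [mem_ofPred_eq]
    by_cases ha : a = t₀ <;> by_cases hb : b = t₀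
    · rw [ha, hb]
    · subst ha
      simp [irr, hb, H4 b hb hab]
    · subst hb
      simp [irr, ha, H4 a ha hab.symm]
    · simp [ha, hb, (tw a b hab).right hμ.toIsTournament (Ne.symm ha) (Ne.symm hb)]
  · intro t ht c hct
    simp only [mem_ofPred_eq]
    by_cases h : t = t₀
    · subst h
      simp [hct]
    by_cases hc : c = t₀
    · subst hc
      simp [irr, H3 t h ht]
    have : IsTwin μ t₀ t := hμ.twin _ _ fun d hd hd' =>
      (ht₀ (ι d) (hxι d) (hι.ne hd)).symm.trans (ht (ι d) (hxι d) (hι.ne hd'))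
    simp [hc, this c hc hct]
  · intro b c hb hc
    simp only [mem_ofPred_eq]
    by_cases h : b = t₀
    · subst h
      simp [irr, H2 hb c hc]
    · simp [h, H1 b c hb hc h]

/-- Of two twins of `a`, exactly one precedes `a`; three elements cannot lie pairwise on opposite
sides. -/
theorem IsTwin.not_three (hr : IsTournament r) {a b c d : α} (hb : IsTwin r a b)
    (hc : IsTwin r a c) (hd : IsTwin r a d) (hab : a ≠ b) (hac : a ≠ c) (had : a ≠ d)
    (hbc : b ≠ c) (hbd : b ≠ d) (hcd : c ≠ d) : False := by
  have key : ∀ b c, IsTwin r a b → IsTwin r a c → a ≠ b → a ≠ c → b ≠ c → (r b a ↔ ¬ r c a) := by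
    intro b c hb hc hab hac hbc
    rw [hc b hab.symm hbc, hb c hac.symm hbc.symm, hr.iff_not hbc]
  have h1 := key b c hb hc hab hac hbc
  have h2 := key b d hb hd hab had hbd
  have h3 := key c d hc hd hac had hcd
  tauto

/-- Each twin pair transports a comparison with the third element; going once round the triangle
would reverse a comparison. -/
theorem IsTwin.not_cycle (hr : IsTournament r) {a b c : α} (hab : IsTwin r a b)
    (hbc : IsTwin r b c) (hac : IsTwin r a c) (h1 : a ≠ b) (h2 : b ≠ c) (h3 : a ≠ c) : False := by
  have e1 := hab c h3.symm h2.symm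
  have e2 := hbc a h1 h3
  have e3 := hac b h1.symm h2
  have n1 := hr.iff_not h1
  have n2 := hr.iff_not h2
  have n3 := hr.iff_not h3
  tauto

/-- Extending a linearization to a point without twins. -/
theorem exists_linearization_of_forall_not_twin (hr : IsTournament r)
    (hι : Function.Injective ι) (hx : ∀ a, a ≠ x ↔ ∃ b, ι b = a)
    (hμ : IsLinearization (fun a b => r (ι a) (ι b)) μ) (hxC : x ∈ C)
    (hCr : ∀ b, b ∉ C → ∀ c ∈ C, ∀ c' ∈ C, (r b c ↔ r b c')) (hne : ∃ c, ι c ∈ C)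
    (hC : ∀ b c c', ι b ∉ C → ι c ∈ C → ι c' ∈ C → (μ b c ↔ μ b c'))
    (hx' : ∀ t, ¬ IsTwin r x (ι t)) :
    ∃ s, IsLinearization r s ∧ WeakHom ι μ s ∧
      ∀ b, b ∉ C → ∀ c ∈ C, ∀ c' ∈ C, (s b c ↔ s b c') := by
  have hxι : ∀ b, ι b ≠ x := fun b => (hx _).2 ⟨b, rfl⟩
  have tw : ∀ a b, IsTwin r (ι a) (ι b) → IsTwin μ a b := by
    intro a b h
    exact hμ.twin a b fun c ha hb => h (ι c) (hι.ne ha) (hι.ne hb)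
  have neC : ∀ {b c}, ι b ∉ C → ι c ∈ C → b ≠ c := by
    rintro b c hb hc rfl
    exact hb hc
  have hC' : ∀ b c c', ι b ∉ C → ι c ∈ C → ι c' ∈ C → (μ c b ↔ μ c' b) := by
    intro b c c' hb hc hc'
    rw [hμ.iff_not (neC hb hc).symm, hμ.iff_not (neC hb hc').symm, hC b c c' hb hc hc']
  -- Try to place `x` just above a part `S` of `C`. This fails only if the cut separates adjacent
  -- twins: the maximum `a` of `S` and some `b` above all of `S`.
  have cut : ∀ S : Set β, (∀ c ∈ S, ι c ∈ C) → S.Nonempty →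
      (∀ a b, IsTwin r (ι a) (ι b) → a ∈ S → b ∉ S → (∀ c ∈ S, μ c b) →
        (∀ c ∈ S, μ c a ∨ c = a) → False) →
      ∃ s, IsLinearization r s ∧ WeakHom ι μ s ∧
      ∀ b, b ∉ C → ∀ c ∈ C, ∀ c' ∈ C, (s b c ↔ s b c') := by
    intro S hS ⟨c₀, hc₀⟩ h
    have half : ∀ a b, IsTwin r (ι a) (ι b) → a ∈ {b | ∃ c ∈ S, μ b c ∨ b = c} →
        b ∈ {b | ∃ c ∈ S, μ b c ∨ b = c} := by
      rintro a b hab ⟨c, hc, hac⟩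
      by_contra hb
      have hb' : ∀ d ∈ S, μ d b := by
        intro d hd
        by_contra hn
        refine hb ⟨d, hd, ?_⟩
        by_cases e : b = d
        · exact Or.inr e
        · exact Or.inl ((hμ.iff_not e).2 hn)
      have hbS : b ∉ S := fun h => hμ.irrefl b (hb' b h)
      have hac' : a = c := by
        by_contra hne
        have h1 := hac.resolve_right hne
        have h2 := hb' c hc
        have := (tw a b hab c (Ne.symm hne) (by rintro rfl; exact hbS hc)).2 h2
        exact hμ.asymm _ _ h1 this
      subst hac'
      refine h a b hab hc hbS hb' fun d hd => ?_
      by_cases e : d = a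
      · exact Or.inr e
      · exact Or.inl ((tw a b hab d e (by rintro rfl; exact hbS hd)).2 (hb' d hd))
    refine Exists.imp (fun s h => ⟨h.1, h.2.1, h.2.2.1⟩) (exists_linearization_of_cut hι hx hμ C
      {b | ∃ c ∈ S, μ b c ∨ b = c} ?_ ?_ ?_ ?_ hxC hC)
    · rintro a b hab ⟨c, hc, hbc | rfl⟩
      · exact ⟨c, hc, Or.inl (hμ.trans _ _ _ hab hbc)⟩
      · exact ⟨b, hc, Or.inl hab⟩
    · exact fun a b hab => ⟨half a b hab, half b a hab.symm⟩
    · exact fun t ht => absurd ht (hx' t)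
    · intro b c hb hc
      constructor
      · rintro ⟨d, hd, h | rfl⟩
        · exact (hC b d c hb (hS d hd) hc).1 h
        · exact absurd (hS b hd) hb
      · intro h
        exact ⟨c₀, hc₀, Or.inl ((hC b c c₀ hb hc (hS _ hc₀)).1 h)⟩
  -- If `S` is closed under twins inside `C`, the obstructing `b` lies outside the interval `C`,
  -- hence above all of it, and adjacency makes `a` the maximum of `C`.
  have signs : ∀ S : Set β, S.Nonempty → S ⊆ {c | ι c ∈ C} →
      (∀ a b, IsTwin r (ι a) (ι b) → ι a ∈ C → ι b ∈ C → a ∈ S → b ∈ S) →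
      (∃ a ∈ S, ∃ b, ι a ∈ C ∧ ι b ∉ C ∧ IsTwin r (ι a) (ι b) ∧
        (∀ c, ι c ∈ C → μ c b) ∧ (∀ c, ι c ∈ C → μ c a ∨ c = a)) ∨
      ∃ s, IsLinearization r s ∧ WeakHom ι μ s ∧
      ∀ b, b ∉ C → ∀ c ∈ C, ∀ c' ∈ C, (s b c ↔ s b c') := by
    intro S hne hS hS'
    by_contra hcon
    rw [not_or] at hcon
    refine hcon.2 (cut S hS hne fun a b hab ha hb h1 h2 => hcon.1 ?_)
    have hbC : ι b ∉ C := fun h => hb (hS' a b hab (hS ha) h ha)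
    have h1' : ∀ c, ι c ∈ C → μ c b := fun c hc => (hC' b a c hbC (hS ha) hc).1 (h1 a ha)
    refine ⟨a, ha, b, hS ha, hbC, hab, h1', fun c hc => ?_⟩
    by_cases e : c = a
    · exact Or.inr e
    · exact Or.inl ((tw a b hab c e (neC hbC hc).symm).2 (h1' c hc))
  by_contra hcon
  have maxC : ∀ {a b}, (∀ c, ι c ∈ C → μ c a ∨ c = a) → (∀ c, ι c ∈ C → μ c b ∨ c = b) →
      ι a ∈ C → ι b ∈ C → a = b := by
    intro a b ha hb haC hbC
    by_contra hne
    exact hμ.asymm a b ((hb a haC).resolve_right hne) ((ha b hbC).resolve_right (Ne.symm hne))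
  -- The cut above `C` is blocked: its maximum `M` has a twin `s'` outside `C`.
  obtain ⟨M, -, s', hM, hs', hMs, hs'C, hMax⟩ := (signs {c | ι c ∈ C} hne (fun _ h => h)
    (fun a b _ _ hb _ => hb)).resolve_right hcon
  -- Twins are not distinguished by `x`, so the successors of `x` in `C` and the other elements of
  -- `C` are both closed under twins. If both sets were nonempty, each would contain the maximum of
  -- `C`.
  by_cases both : (∃ c, ι c ∈ C ∧ r x (ι c)) ∧ ∃ c, ι c ∈ C ∧ ¬ r x (ι c)
  · obtain ⟨a, ha, -, haC, -, -, -, ha'⟩ := (signs {c | ι c ∈ C ∧ r x (ι c)} both.1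
      (fun _ h => h.1) (fun a b hab _ hb ha =>
        ⟨hb, (hab x (hxι a).symm (hxι b).symm).1 ha.2⟩)).resolve_right hcon
    obtain ⟨b, hb, -, hbC, -, -, -, hb'⟩ := (signs {c | ι c ∈ C ∧ ¬ r x (ι c)} both.2
      (fun _ h => h.1) (fun a b hab _ hb ha =>
        ⟨hb, fun h => ha.2 ((hab x (hxι a).symm (hxι b).symm).2 h)⟩)).resolve_right hcon
    have := maxC ha' hb' haC hbC
    subst this
    exact hb.2 ha.2
  -- The cut below `C` must be blocked as well, by a twin pair that it separates.
  have bad : ∃ a b, IsTwin r (ι a) (ι b) ∧ (∀ c, ι c ∈ C → μ a c) ∧ ∃ c, ι c ∈ C ∧ ¬ μ b c := by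
    by_contra hno
    push Not at hno
    refine hcon (Exists.imp (fun s h => ⟨h.1, h.2.1, h.2.2.1⟩) (exists_linearization_of_cut hι hx hμ C
      {b | ∀ c, ι c ∈ C → μ b c} ?_ ?_ ?_ ?_ hxC hC))
    · exact fun a b hab hb c hc => hμ.trans _ _ _ hab (hb c hc)
    · exact fun a b hab => ⟨hno a b hab, hno b a hab.symm⟩
    · exact fun t ht => absurd ht (hx' t)
    · exact fun b c hb hc => ⟨fun h => h c hc, fun h d hd => (hC b c d hb hc hd).1 h⟩
  obtain ⟨s, m, hsm, hs, c₀, hc₀, hmc⟩ := bad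
  have hsC : ι s ∉ C := fun h => hμ.irrefl s (hs s h)
  have hmC : ι m ∈ C := by
    by_contra hmC
    exact hmc ((IsTwin.right hμ.toIsTournament (tw _ _ hsm) (neC hsC hc₀).symm
      (neC hmC hc₀).symm).1 (hs c₀ hc₀))
  -- If `m = M`, this is the only element of `C` besides `x`, and the module property makes it a
  -- twin of `x`.
  have hmM : m ≠ M := by
    rintro rfl
    refine hx' m fun c hcx hcm => ?_
    by_cases hc : c ∈ C
    · obtain ⟨c, rfl⟩ := (hx c).1 hcx
      have hcm' : c ≠ m := fun h => hcm (congrArg ι h)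
      have h1 := (hMax c hc).resolve_right hcm'
      have h2 := (tw _ _ hsm c (neC hsC hc).symm hcm').2 h1
      exact absurd h2 (hμ.asymm _ _ (hs c hc))
    · exact hCr c hc x hxC _ hmC
  have sgn : r x (ι m) ↔ r x (ι M) := by
    by_contra h
    apply both
    by_cases h' : r x (ι m)
    · exact ⟨⟨m, hmC, h'⟩, M, hM, fun h2 => h (iff_of_true h' h2)⟩
    · exact ⟨⟨M, hM, by_contra fun h2 => h (iff_of_false h' h2)⟩, m, hmC, h'⟩
  have neI : ∀ {b c}, b ≠ c → ι b ≠ ι c := fun h => hι.ne h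
  have e1 := hsm x (hxι _).symm (hxι _).symm
  have e2 := hMs x (hxι _).symm (hxι _).symm
  have e3 := hsm (ι M) (neI (neC hsC hM).symm) (neI hmM.symm)
  have e4 := hMs (ι m) (neI hmM) (neI (neC hs' hmC).symm)
  have e5 := hCr _ hsC x hxC _ hM
  have e6 := hCr _ hs' x hxC _ hmC
  -- Replace `m` by its twin `s`, which lies outside the module and so does not distinguish `x` from
  -- `M`, and go back. With the mirror statement `B`, the equal signs of `m` and `M` give `r M m ↔ r
  -- m M`.
  have A : r x (ι m) ↔ r (ι M) (ι m) := by
    rw [← e1, hr.iff_not (hxι s).symm, e5, ← hr.iff_not (neI (neC hsC hM)).symm, e3]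
  have B : r x (ι M) ↔ r (ι m) (ι M) := by
    rw [e2, hr.iff_not (hxι s').symm, e6, ← hr.iff_not (neI (neC hs' hmC)).symm, e4]
  exact iff_not_self ((A.symm.trans (sgn.trans B)).trans (hr.iff_not (neI hmM)))

/-- A linearization of the complement of a point `x` in which the rest of a module `C ∋ x` is an
interval extends to a linearization in which `C` is an interval. -/
theorem exists_linearization_insert (hr : IsTournament r)
    (hι : Function.Injective ι) (hx : ∀ a, a ≠ x ↔ ∃ b, ι b = a)
    (hμ : IsLinearization (fun a b => r (ι a) (ι b)) μ) (hxC : x ∈ C)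
    (hCr : ∀ b, b ∉ C → ∀ c ∈ C, ∀ c' ∈ C, (r b c ↔ r b c')) (hne : ∃ c, ι c ∈ C)
    (hC : ∀ b c c', ι b ∉ C → ι c ∈ C → ι c' ∈ C → (μ b c ↔ μ b c'))
    (H : ∀ t b c, ι t ∉ C → IsTwin r x (ι t) → ι b ∉ C → b ≠ t → ι c ∈ C → (μ b t ↔ μ b c)) :
    ∃ s, IsLinearization r s ∧ WeakHom ι μ s ∧
      ∀ b, b ∉ C → ∀ c ∈ C, ∀ c' ∈ C, (s b c ↔ s b c') := by
  have hxι : ∀ b, ι b ≠ x := fun b => (hx _).2 ⟨b, rfl⟩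
  have tw : ∀ a b, IsTwin r (ι a) (ι b) → IsTwin μ a b := by
    intro a b h
    exact hμ.twin a b fun c ha hb => h (ι c) (hι.ne ha) (hι.ne hb)
  have tw' : ∀ a b, IsTwin r x (ι a) → IsTwin r x (ι b) → IsTwin μ a b := fun a b ha hb =>
    hμ.twin _ _ fun d hd hd' =>
      (ha (ι d) (hxι d) (hι.ne hd)).symm.trans (hb (ι d) (hxι d) (hι.ne hd'))
  -- Next to a twin inside `C` the interval stays intact, and only the side `P` has to be chosen. It
  -- is dictated by a second twin of `x`, otherwise by a second twin of `t₀`, and otherwise it is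
  -- free.
  by_cases hA : ∃ t₀, ι t₀ ∈ C ∧ IsTwin r x (ι t₀)
  · obtain ⟨t₀, hC₀, ht₀⟩ := hA
    have main : ∀ P : Prop, (∀ t, t ≠ t₀ → IsTwin r x (ι t) → (P ↔ μ t₀ t)) →
        (∀ b, b ≠ t₀ → IsTwin r (ι t₀) (ι b) → (P ↔ μ b t₀)) →
        ∃ s, IsLinearization r s ∧ WeakHom ι μ s ∧
      ∀ b, b ∉ C → ∀ c ∈ C, ∀ c' ∈ C, (s b c ↔ s b c') := fun P h1 h2 =>
      Exists.imp (fun s h => ⟨h.1, h.2.1, h.2.2.1⟩) (exists_linearization_of_twin hι hx hμ hxC hC ht₀ P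
        (fun b c hb hc _ => hC b t₀ c hb hC₀ hc) (fun h => absurd hC₀ h) h1 h2)
    by_cases h1 : ∃ t₁, t₁ ≠ t₀ ∧ IsTwin r x (ι t₁)
    · obtain ⟨t₁, h10, ht₁⟩ := h1
      refine main (μ t₀ t₁) ?_ ?_
      · intro t ht0 ht
        by_cases e : t = t₁
        · rw [e]
        · exact (IsTwin.not_three hr ht₀ ht₁ ht (hxι _).symm (hxι _).symm (hxι _).symm
            (hι.ne h10.symm) (hι.ne ht0.symm) (hι.ne (Ne.symm e))).elim
      · intro b hb0 hb
        by_cases e : b = t₁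
        · subst e
          exact (IsTwin.not_cycle hr ht₀ hb ht₁ (hxι _).symm (hι.ne hb0.symm) (hxι _).symm).elim
        · have e1 := tw' t₀ t₁ ht₀ ht₁ b hb0 e
          have e2 := tw _ _ hb t₁ h10 (Ne.symm e)
          have n1 := hμ.iff_not h10
          have n2 := hμ.iff_not e
          tauto
    by_cases h2 : ∃ b, b ≠ t₀ ∧ IsTwin r (ι t₀) (ι b)
    · obtain ⟨b, hb0, hb⟩ := h2
      refine main (μ b t₀) (fun t ht0 ht => absurd ⟨t, ht0, ht⟩ h1) ?_
      intro b' hb0' hb'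
      by_cases e : b' = b
      · rw [e]
      · exact (IsTwin.not_three hr ht₀.symm hb hb' (hxι _) (hι.ne hb0.symm) (hι.ne hb0'.symm)
          (hxι _).symm (hxι _).symm (hι.ne (Ne.symm e))).elim
    exact main True (fun t ht0 ht => absurd ⟨t, ht0, ht⟩ h1)
      (fun t ht0 ht => absurd ⟨t, ht0, ht⟩ h2)
  -- All twins of `x` lie outside `C`. By `H` they are adjacent to the interval, so `x` goes to the
  -- border of `C` next to `t₀`.
  by_cases hB : ∃ t₀, IsTwin r x (ι t₀)
  · obtain ⟨t₀, ht₀⟩ := hB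
    have hC₀ : ι t₀ ∉ C := fun h => hA ⟨t₀, h, ht₀⟩
    obtain ⟨m, hm⟩ := hne
    have neC : ∀ {b c}, ι b ∉ C → ι c ∈ C → b ≠ c := by
      rintro b c hb hc rfl
      exact hb hc
    refine Exists.imp (fun s h => ⟨h.1, h.2.1, h.2.2.1⟩) (exists_linearization_of_twin hι hx hμ hxC hC
      ht₀ (μ t₀ m) (fun b c hb hc hb0 => H t₀ b c hC₀ ht₀ hb hb0 hc)
      (fun _ c hc => hC t₀ m c hC₀ hm hc) ?_ ?_)
    · intro t ht0 ht
      exact (H t t₀ m (fun h => hA ⟨t, h, ht⟩) ht hC₀ ht0.symm hm).symm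
    · intro b hb0 hb
      -- This case is impossible: in the triple `x`, `t₀`, `b` no element would distinguish the
      -- other two.
      by_cases hbC : ι b ∈ C
      · have e1 := hCr _ hC₀ x hxC _ hbC
        have e2 := hb x (hxι _).symm (hxι _).symm
        have e3 := ht₀ _ (hxι b) (hι.ne hb0)
        have n1 := hr.iff_not (hxι t₀)
        have n2 := hr.iff_not (hxι b)
        have n3 := hr.iff_not (hι.ne hb0)
        tauto
      · have e1 := H t₀ b m hC₀ ht₀ hbC hb0 hm
        have e2 := tw _ _ hb m (neC hC₀ hm).symm (neC hbC hm).symm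
        have n1 := hμ.iff_not (neC hC₀ hm)
        have n2 := hμ.iff_not (neC hbC hm)
        tauto
  · exact exists_linearization_of_forall_not_twin hr hι hx hμ hxC hCr hne hC
      fun t ht => hB ⟨t, ht⟩

end Insert

/-! ### Drops between tournaments and their diamonds -/

/-- A finite tournament. -/
structure Tournament : Type (u + 1) where
  carrier : Type u
  finite : Finite carrier
  r : carrier → carrier → Prop
  isTournament : IsTournament r

/-- The linearizations of a tournament. -/
abbrev Lin (A : Tournament.{u}) : Type u := {s : A.carrier → A.carrier → Prop // IsLinearization A.r s}

/-- The subtournament on the elements that satisfy `p`. -/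
abbrev Tournament.sub (A : Tournament.{u}) (p : A.carrier → Prop) : Tournament.{u} where
  carrier := {a // p a}
  finite := haveI := A.finite; inferInstance
  r := fun a b => A.r a b
  isTournament := ⟨fun a b => A.isTournament.asymm a b,
    fun a b h => A.isTournament.total a b fun h' => h (Subtype.ext h')⟩

/-- `Drop A B R` says that `B` arises from `A` by deleting one element or by collapsing a module
`Y`, and `R` is the induced relation between linearizations. -/
inductive Drop (A B : Tournament.{u}) : (Lin A → Lin B → Prop) → Prop
  | del (d : A.carrier) (ι : B.carrier → A.carrier) (inj : Function.Injective ι)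
      (hd : ∀ a, a ≠ d ↔ ∃ b, ι b = a) (w : WeakHom ι B.r A.r) :
      Drop A B fun lam mu => WeakHom ι mu.1 lam.1
  | col (Y : Set A.carrier) (f : A.carrier → B.carrier) (surj : Function.Surjective f)
      (hf : ∀ a b, f a = f b ↔ a = b ∨ (a ∈ Y ∧ b ∈ Y)) (w : WeakHom f A.r B.r) :
      Drop A B fun lam mu => WeakHom f lam.1 mu.1

/-- The two drops `A → B`, `A → C` with relations `R`, `S` can be completed to a diamond. -/
def Joins {A B C : Tournament.{u}} (R : Lin A → Lin B → Prop) (S : Lin A → Lin C → Prop) : Prop :=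
  ∃ (W : Tournament.{u}) (R' : Lin B → Lin W → Prop) (S' : Lin C → Lin W → Prop),
    Drop B W R' ∧ Drop C W S' ∧ ∀ b c w, R' b w → S' c w → ∃ a, R a b ∧ S a c

theorem Joins.symm {A B C : Tournament.{u}} {R : Lin A → Lin B → Prop} {S : Lin A → Lin C → Prop}
    (h : Joins R S) : Joins S R := by
  obtain ⟨W, R', S', h1, h2, h3⟩ := h
  refine ⟨W, S', R', h2, h1, fun b c w hb hc => ?_⟩
  obtain ⟨a, ha⟩ := h3 c b w hc hb
  exact ⟨a, ha.2, ha.1⟩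

section

variable {α β γ : Type u} {r : α → α → Prop} {s : β → β → Prop}

theorem IsTwin.image {f : α → β} (hf : Function.Surjective f) (hw : WeakHom f r s) {a b : α}
    (h : IsTwin r a b) : IsTwin s (f a) (f b) := by
  intro c ha hb
  obtain ⟨c, rfl⟩ := hf c
  rw [← hw c a ha, ← hw c b hb]
  exact h c (fun e => ha (congrArg f e)) fun e => hb (congrArg f e)

theorem IsTwin.of_image {f : β → α} (hf : Function.Injective f) (hw : WeakHom f s r) {a b : β}
    (h : IsTwin r (f a) (f b)) : IsTwin s a b := by
  intro c ha hb
  rw [hw c a (hf.ne ha), hw c b (hf.ne hb)]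
  exact h _ (hf.ne ha) (hf.ne hb)

theorem WeakHom.iff_of_injective {f : α → β} (hw : WeakHom f r s) (hf : Function.Injective f)
    (hr : IsTournament r) (hs : IsTournament s) (a b : α) : r a b ↔ s (f a) (f b) := by
  by_cases h : a = b
  · subst h
    exact iff_of_false (hr.irrefl _) (hs.irrefl _)
  · exact hw a b (hf.ne h)

theorem WeakHom.module {f : α → β} (hw : WeakHom f r s) {Y : Set α}
    (hf : ∀ a b, f a = f b ↔ a = b ∨ (a ∈ Y ∧ b ∈ Y)) (b : α) (hb : b ∉ Y) (c : α) (hc : c ∈ Y)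
    (c' : α) (hc' : c' ∈ Y) : r b c ↔ r b c' := by
  have key : ∀ c ∈ Y, f b ≠ f c := by
    intro c hc h
    rcases (hf b c).1 h with rfl | h
    · exact hb hc
    · exact hb h.1
  rw [hw b c (key c hc), hw b c' (key c' hc'), (hf c c').2 (Or.inr ⟨hc, hc'⟩)]

theorem WeakHom.comp {t : γ → γ → Prop} {f : α → β} {g : β → γ} (hf : WeakHom f r s)
    (hg : WeakHom g s t) : WeakHom (g ∘ f) r t := fun a b h =>
  (hf a b fun e => h (congrArg g e)).trans (hg _ _ h)

end

/-- Pulling back a linearization along an isomorphism. -/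
theorem exists_lin_of_bijective {A B : Tournament.{u}} {f : A.carrier → B.carrier}
    (hf : Function.Bijective f) (hw : WeakHom f A.r B.r) (b : Lin B) :
    ∃ a : Lin A, WeakHom f a.1 b.1 := by
  have hb := b.2
  refine ⟨⟨fun x y => b.1 (f x) (f y), ⟨⟨fun x y => hb.asymm _ _, fun x y h => hb.total _ _
    (hf.1.ne h)⟩, fun x y z => hb.trans _ _ _, fun x y h z hx hy => ?_⟩⟩, fun x y _ => Iff.rfl⟩
  exact hb.twin _ _ (h.image hf.2 hw) _ (hf.1.ne hx) (hf.1.ne hy)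

/-- Every linearization extends along a deletion. -/
theorem exists_lin_of_del {A B : Tournament.{u}} {d : A.carrier} {ι : B.carrier → A.carrier}
    (inj : Function.Injective ι) (hd : ∀ a, a ≠ d ↔ ∃ b, ι b = a) (w : WeakHom ι B.r A.r)
    (b : Lin B) : ∃ a : Lin A, WeakHom ι b.1 a.1 := by
  have hr : B.r = fun a b => A.r (ι a) (ι b) := by
    funext x y
    exact propext (w.iff_of_injective inj B.isTournament A.isTournament x y)
  have hb : IsLinearization (fun a b => A.r (ι a) (ι b)) b.1 := hr ▸ b.2
  -- The whole carrier serves as the module, but insertion needs it to have an element besides the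
  -- new one.
  by_cases hne : Nonempty B.carrier
  · obtain ⟨c⟩ := hne
    obtain ⟨s, hs, hw, -⟩ := exists_linearization_insert A.isTournament inj hd hb (C := univ)
      (mem_univ d) (by simp) ⟨c, mem_univ _⟩ (by simp) (by simp)
    exact ⟨⟨s, hs⟩, hw⟩
  · have all : ∀ a, a = d := by
      intro a
      by_contra h
      obtain ⟨b, -⟩ := (hd a).1 h
      exact hne ⟨b⟩
    refine ⟨⟨fun _ _ => False, ⟨⟨fun _ _ h => h.elim, fun x y h => ?_⟩, fun _ _ _ h => h.elim,
      fun _ _ _ _ _ _ => Iff.rfl⟩⟩, fun x _ _ => absurd ⟨x⟩ hne⟩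
    exact absurd ((all x).trans (all y).symm) h

theorem Drop.refl (A : Tournament.{u}) : Drop A A fun lam mu => WeakHom id lam.1 mu.1 :=
  .col (B := A) ∅ id Function.surjective_id (by simp) fun _ _ _ => Iff.rfl

/-- An isomorphism can be completed to a diamond with any drop. -/
theorem joins_of_bijective {A B C : Tournament.{u}} {R : Lin A → Lin B → Prop} (hR : Drop A B R)
    {f : A.carrier → C.carrier} (hf : Function.Bijective f) (hw : WeakHom f A.r C.r) :
    Joins R fun (a : Lin A) (c : Lin C) => WeakHom f a.1 c.1 := by
  let e := Equiv.ofBijective f hf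
  have he : ∀ a, e.symm (f a) = a := e.symm_apply_apply
  have he' : ∀ a, f (e.symm a) = a := e.apply_symm_apply
  have hwe : WeakHom e.symm C.r A.r := by
    intro a b h
    have h1 := hw (e.symm a) (e.symm b)
    rw [he', he'] at h1
    exact (h1 fun h' => h (congrArg e.symm h')).symm
  have lin : ∀ {a : Lin A} {c : Lin C}, WeakHom f a.1 c.1 → WeakHom e.symm c.1 a.1 := by
    intro a c hac x y h
    have h1 := hac (e.symm x) (e.symm y)
    rw [he', he'] at h1
    exact (h1 fun h' => h (congrArg e.symm h')).symm
  cases hR with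
  | del d ι inj hd w =>
    refine ⟨B, _, _, Drop.refl B, .del (f d) (f ∘ ι) (hf.1.comp inj) ?_ ?_, ?_⟩
    · intro c
      obtain ⟨a, rfl⟩ := hf.2 c
      rw [hf.1.ne_iff, hd a]
      simp [hf.1.eq_iff]
    · exact w.comp hw
    · intro b c b' h1 h2
      obtain ⟨a, ha⟩ := exists_lin_of_bijective hf hw c
      refine ⟨a, ?_, ha⟩
      have h3 := WeakHom.comp h2 (lin ha)
      have h4 : e.symm ∘ (f ∘ ι) = ι := by
        funext x
        exact he _
      rw [h4] at h3
      exact WeakHom.comp h1 h3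
  | col Y g surj hg w =>
    refine ⟨B, _, _, Drop.refl B, .col (e.symm ⁻¹' Y) (g ∘ e.symm)
      (surj.comp e.symm.surjective) ?_ (hwe.comp w), ?_⟩
    · intro a b
      simp [hg]
    · intro b c b' h1 h2
      obtain ⟨a, ha⟩ := exists_lin_of_bijective hf hw c
      refine ⟨a, ?_, ha⟩
      have h3 := WeakHom.comp ha h2
      have h4 : (g ∘ e.symm) ∘ f = g := by
        funext x
        exact congrArg g (he x)
      rw [h4] at h3
      intro x y hxy
      exact (h3 x y hxy).trans (h1 _ _ hxy).symm

/-! ### Diamonds of two deletions -/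

theorem IsTwin.between {α : Type u} {r : α → α → Prop} (hr : IsTournament r) {x y d : α}
    (hxy : IsTwin r x y) (hyd : IsTwin r y d) (h1 : x ≠ y) (h2 : y ≠ d) (h3 : x ≠ d) :
    r x y ↔ r y d := by
  rw [hyd x h1 h3, hr.iff_not h3, hxy d h3.symm h2.symm, ← hr.iff_not h2]

section

variable {A B C : Tournament.{u}} {x d : A.carrier} {ι₀ : B.carrier → A.carrier}
  {ι₂ : C.carrier → A.carrier}

/-- Here `e` identifies the two deletions, so `B` itself can be the bottom of the diamond. The two
linearizations then have to coincide up to `e`, which demands more than agreement off `x` and `d`.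
-/
theorem joins_del_of_equiv
    (inj₀ : Function.Injective ι₀) (hd₀ : ∀ a, a ≠ x ↔ ∃ b, ι₀ b = a) (w₀ : WeakHom ι₀ B.r A.r)
    (inj₂ : Function.Injective ι₂) (hd₂ : ∀ a, a ≠ d ↔ ∃ b, ι₂ b = a) (w₂ : WeakHom ι₂ C.r A.r)
    (e : A.carrier ≃ A.carrier) (he : e d = x)
    (her : ∀ a b, a ≠ d → b ≠ d → a ≠ b → (A.r a b ↔ A.r (e a) (e b)))
    (hes : ∀ b : Lin B, ∃ a : Lin A, WeakHom ι₀ b.1 a.1 ∧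
      ∀ y z, y ≠ d → z ≠ d → y ≠ z → (a.1 y z ↔ a.1 (e y) (e z))) :
    Joins (fun (a : Lin A) (b : Lin B) => WeakHom ι₀ b.1 a.1)
      fun (a : Lin A) (c : Lin C) => WeakHom ι₂ c.1 a.1 := by
  have hι₂ : ∀ c, ι₂ c ≠ d := fun c => (hd₂ _).2 ⟨c, rfl⟩
  have hg : ∀ c, ∃ b, ι₀ b = e (ι₂ c) := fun c => (hd₀ _).1 (by
    rw [← he, e.injective.ne_iff]
    exact hι₂ c)
  choose g hg using hg
  have ginj : Function.Injective g := by
    intro c c' h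
    have h' := congrArg ι₀ h
    rw [hg, hg] at h'
    exact inj₂ (e.injective h')
  have gsurj : Function.Surjective g := by
    intro b
    have hb : e.symm (ι₀ b) ≠ d := by
      intro h
      rw [Equiv.symm_apply_eq, he] at h
      exact (hd₀ _).2 ⟨b, rfl⟩ h
    obtain ⟨c, hc⟩ := (hd₂ _).1 hb
    refine ⟨c, inj₀ ?_⟩
    rw [hg, hc, Equiv.apply_symm_apply]
  refine ⟨B, _, _, Drop.refl B, .col ∅ g gsurj (by simp [ginj.eq_iff]) ?_, ?_⟩
  · intro a b h
    have h' : a ≠ b := fun e => h (congrArg g e)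
    rw [w₂ a b (inj₂.ne h'), her _ _ (hι₂ a) (hι₂ b) (inj₂.ne h'), w₀ _ _ (inj₀.ne h), hg, hg]
  · intro b c w hb hc
    obtain ⟨a, h1, h2⟩ := hes b
    refine ⟨a, h1, ?_⟩
    intro y z h
    have h' : y ≠ z := fun e => h (congrArg ι₂ e)
    rw [hc y z (ginj.ne h'), h2 _ _ (hι₂ y) (hι₂ z) h, ← hg, ← hg, ← h1 _ _ (inj₀.ne (ginj.ne h'))]
    exact (hb _ _ (ginj.ne h')).symm

/-- If only the order off `x` and `d` were shared, the two orders could place the twins far apart.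
Identifying the deletions by the transposition of `x` and `d` prevents this. -/
theorem joins_del_of_twin
    (inj₀ : Function.Injective ι₀) (hd₀ : ∀ a, a ≠ x ↔ ∃ b, ι₀ b = a) (w₀ : WeakHom ι₀ B.r A.r)
    (inj₂ : Function.Injective ι₂) (hd₂ : ∀ a, a ≠ d ↔ ∃ b, ι₂ b = a) (w₂ : WeakHom ι₂ C.r A.r)
    (h : IsTwin A.r x d) :
    Joins (fun (a : Lin A) (b : Lin B) => WeakHom ι₀ b.1 a.1)
      fun (a : Lin A) (c : Lin C) => WeakHom ι₂ c.1 a.1 := by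
  classical
  have key : ∀ s : A.carrier → A.carrier → Prop, IsTournament s → IsTwin s x d →
      ∀ y z, y ≠ d → z ≠ d → y ≠ z → (s y z ↔ s (Equiv.swap x d y) (Equiv.swap x d z)) := by
    intro s hs ht y z hy hz hyz
    by_cases h1 : y = x
    · subst h1
      rw [Equiv.swap_apply_left, Equiv.swap_apply_of_ne_of_ne hyz.symm hz]
      exact ht.right hs hyz.symm hz
    · rw [Equiv.swap_apply_of_ne_of_ne h1 hy]
      by_cases h2 : z = x
      · subst h2
        rw [Equiv.swap_apply_left]
        exact ht y hyz hy
      · rw [Equiv.swap_apply_of_ne_of_ne h2 hz]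
  refine joins_del_of_equiv inj₀ hd₀ w₀ inj₂ hd₂ w₂ (Equiv.swap x d) (Equiv.swap_apply_right _ _)
    (key A.r A.isTournament h) fun b => ?_
  obtain ⟨a, ha⟩ := exists_lin_of_del inj₀ hd₀ w₀ b
  exact ⟨a, ha, key a.1 a.2.toIsTournament (a.2.twin _ _ h)⟩

/-- On pairs avoiding `d`, shifting the chain of twins by `x ↦ y ↦ d` preserves the tournament and
each of its linearizations, because `y` lies between `x` and `d` in both. -/
theorem joins_del_of_chain
    (inj₀ : Function.Injective ι₀) (hd₀ : ∀ a, a ≠ x ↔ ∃ b, ι₀ b = a) (w₀ : WeakHom ι₀ B.r A.r)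
    (inj₂ : Function.Injective ι₂) (hd₂ : ∀ a, a ≠ d ↔ ∃ b, ι₂ b = a) (w₂ : WeakHom ι₂ C.r A.r)
    {y : A.carrier} (hxy : x ≠ y) (hyd : y ≠ d) (hxd : x ≠ d)
    (h : IsTwin A.r x y) (h' : IsTwin A.r y d) :
    Joins (fun (a : Lin A) (b : Lin B) => WeakHom ι₀ b.1 a.1)
      fun (a : Lin A) (c : Lin C) => WeakHom ι₂ c.1 a.1 := by
  classical
  let e : A.carrier ≃ A.carrier := (Equiv.swap x y).trans (Equiv.swap x d)
  have ex : e x = y := by simp [e, Equiv.swap_apply_of_ne_of_ne hxy.symm hyd]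
  have ey : e y = d := by simp [e]
  have ed : e d = x := by simp [e, Equiv.swap_apply_of_ne_of_ne hxd.symm hyd.symm]
  have ez : ∀ z, z ≠ x → z ≠ y → z ≠ d → e z = z := by
    intro z h1 h2 h3
    simp [e, Equiv.swap_apply_of_ne_of_ne h1 h2, Equiv.swap_apply_of_ne_of_ne h1 h3]
  have key : ∀ s : A.carrier → A.carrier → Prop, IsTournament s → IsTwin s x y → IsTwin s y d →
      ∀ z z', z ≠ d → z' ≠ d → z ≠ z' → (s z z' ↔ s (e z) (e z')) := by
    intro s hs t1 t2
    have bet := t1.between hs t2 hxy hyd hxd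
    have half : ∀ z z', z ≠ d → z' ≠ d → z ≠ x → z ≠ y → (s z z' ↔ s (e z) (e z')) := by
      intro z z' h1 h2 h3 h4
      rw [ez z h3 h4 h1]
      by_cases e1 : z' = x
      · rw [e1, ex]
        exact t1 z h3 h4
      by_cases e2 : z' = y
      · rw [e2, ey]
        exact t2 z h4 h1
      rw [ez z' e1 e2 h2]
    have bet' : s y x ↔ s d y := by
      rw [hs.iff_not hxy.symm, bet, hs.iff_not hyd, not_not]
    intro z z' h1 h2 h3
    by_cases e1 : z = x
    · by_cases e2 : z' = y
      · rw [e1, e2, ex, ey, bet]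
      · rw [hs.iff_not h3, hs.iff_not (e.injective.ne h3),
          half z' z h2 h1 (fun h => h3 (e1.trans h.symm)) e2]
    by_cases e1' : z = y
    · by_cases e2 : z' = x
      · rw [e1', e2, ex, ey, bet']
      · rw [hs.iff_not h3, hs.iff_not (e.injective.ne h3),
          half z' z h2 h1 e2 (fun h => h3 (e1'.trans h.symm))]
    exact half z z' h1 h2 e1 e1'
  refine joins_del_of_equiv inj₀ hd₀ w₀ inj₂ hd₂ w₂ e ed
    (key A.r A.isTournament h h') fun b => ?_
  obtain ⟨a, ha⟩ := exists_lin_of_del inj₀ hd₀ w₀ b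
  exact ⟨a, ha, key a.1 a.2.toIsTournament (a.2.twin _ _ h) (a.2.twin _ _ h')⟩

end

/-- The order of two points relative to linear orders on their complements. -/
theorem exists_order_of_complements {α : Type u} {r : α → α → Prop} {x d : α} (hxd : x ≠ d)
    (hnc : ∀ y, y ≠ x → y ≠ d → IsTwin r x y → IsTwin r y d → False)
    {P Q : α → α → Prop}
    (Pa : ∀ a b, a ≠ x → b ≠ x → P a b → ¬ P b a)
    (Pt : ∀ a b, a ≠ x → b ≠ x → a ≠ b → P a b ∨ P b a)
    (Ptr : ∀ a b c, a ≠ x → b ≠ x → c ≠ x → P a b → P b c → P a c)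
    (Ptw : ∀ a b, a ≠ x → b ≠ x → (∀ c, c ≠ x → c ≠ a → c ≠ b → (r c a ↔ r c b)) →
      ∀ c, c ≠ x → c ≠ a → c ≠ b → (P c a ↔ P c b))
    (Qa : ∀ a b, a ≠ d → b ≠ d → Q a b → ¬ Q b a)
    (Qt : ∀ a b, a ≠ d → b ≠ d → a ≠ b → Q a b ∨ Q b a)
    (Qtr : ∀ a b c, a ≠ d → b ≠ d → c ≠ d → Q a b → Q b c → Q a c)
    (Qtw : ∀ a b, a ≠ d → b ≠ d → (∀ c, c ≠ d → c ≠ a → c ≠ b → (r c a ↔ r c b)) →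
      ∀ c, c ≠ d → c ≠ a → c ≠ b → (Q c a ↔ Q c b))
    (PQ : ∀ a b, a ≠ x → a ≠ d → b ≠ x → b ≠ d → (P a b ↔ Q a b)) :
    ∃ T : Prop, (T → ∀ c, c ≠ x → c ≠ d → P d c → Q c x → False) ∧
      (¬ T → ∀ c, c ≠ x → c ≠ d → Q x c → P c d → False) ∧
      (∀ t, t ≠ x → t ≠ d → IsTwin r x t → (T ↔ P t d)) ∧
      (∀ t, t ≠ x → t ≠ d → IsTwin r d t → (T ↔ Q x t)) := by
  -- `T` is to mean that `x` precedes `d`. A twin `t` of `x` dictates it: `d` lies on the same side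
  -- of `x` as of `t`.
  by_cases h1 : ∃ t, t ≠ x ∧ t ≠ d ∧ IsTwin r x t
  · obtain ⟨t, htx, htd, ht⟩ := h1
    have adj := Qtw x t hxd htd fun c _ => ht c
    refine ⟨P t d, ?_, ?_, ?_, ?_⟩
    · intro h c hcx hcd h1 h2
      have h3 := Ptr t d c htx hxd.symm hcx h h1
      have hct : c ≠ t := by
        rintro rfl
        exact Pa _ _ hcx hcx h3 h3
      exact Pa t c htx hcx h3 ((PQ c t hcx hcd htx htd).2 ((adj c hcd hcx hct).1 h2))
    · intro h c hcx hcd h1 h2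
      have h3 := Ptr c d t hcx hxd.symm htx h2 ((Pt t d htx hxd.symm htd).resolve_left h)
      have hct : c ≠ t := by
        rintro rfl
        exact Pa _ _ hcx hcx h3 h3
      have h4 := (adj c hcd hcx hct).not.1 (Qa x c hxd hcd h1)
      exact h4 ((PQ c t hcx hcd htx htd).1 h3)
    · intro t' htx' htd' ht'
      by_cases e : t = t'
      · rw [e]
      have h1 := Ptw t t' htx htx' (fun c h1 h2 h3 => (ht c h1 h2).symm.trans (ht' c h1 h3))
        d hxd.symm htd.symm htd'.symm
      by_cases h2 : P t d
      · exact iff_of_true h2 ((Pt t' d htx' hxd.symm htd').resolve_right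
          (h1.not.1 (Pa t d htx hxd.symm h2)))
      · exact iff_of_false h2 (Pa d t' hxd.symm htx'
          (h1.1 ((Pt t d htx hxd.symm htd).resolve_left h2)))
    · intro t' htx' htd' ht'
      have e : t' ≠ t := by
        rintro rfl
        exact hnc t' htx htd ht ht'.symm
      have h1 := Ptw d t' hxd.symm htx' (fun c _ h2 h3 => ht' c h2 h3) t htx htd e.symm
      have h2 := adj t' htd' htx' e
      rw [h1, PQ t t' htx htd htx' htd']
      by_cases h3 : Q t t'
      · exact iff_of_true h3 ((Qt x t' hxd htd' htx'.symm).resolve_right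
          (h2.not.2 (Qa _ _ htd htd' h3)))
      · exact iff_of_false h3 (Qa _ _ htd' hxd
          (h2.2 ((Qt t t' htd htd' e.symm).resolve_left h3)))
  by_cases h2 : ∃ t, t ≠ x ∧ t ≠ d ∧ IsTwin r d t
  · obtain ⟨t, htx, htd, ht⟩ := h2
    have adj := Ptw d t hxd.symm htx fun c _ => ht c
    refine ⟨Q x t, ?_, ?_, fun t' h1' h2' h3' => (h1 ⟨t', h1', h2', h3'⟩).elim, ?_⟩
    · intro h c hcx hcd h1 h2
      have h3 := Qtr c x t hcd hxd htd h2 h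
      have hct : c ≠ t := by
        rintro rfl
        exact Qa _ _ hcd hcd h3 h3
      have h4 := (adj c hcx hcd hct).not.1 (Pa _ _ hxd.symm hcx h1)
      exact h4 ((PQ c t hcx hcd htx htd).2 h3)
    · intro h c hcx hcd h1 h2
      have h3 := Qtr t x c htd hxd hcd ((Qt x t hxd htd htx.symm).resolve_left h) h1
      have hct : c ≠ t := by
        rintro rfl
        exact Qa _ _ hcd hcd h3 h3
      exact Qa t c htd hcd h3 ((PQ c t hcx hcd htx htd).1 ((adj c hcx hcd hct).1 h2))
    · intro t' htx' htd' ht'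
      by_cases e : t = t'
      · rw [e]
      exact Qtw t t' htd htd' (fun c h1 h2 h3 => (ht c h1 h2).symm.trans (ht' c h1 h3))
        x hxd htx.symm htx'.symm
  -- Neither point has a further twin, so only transitivity constrains the order: `x` precedes `d`
  -- if some third element forces it.
  refine ⟨∃ c, c ≠ x ∧ c ≠ d ∧ Q x c ∧ P c d, ?_, ?_,
    fun t' h1' h2' h3' => (h1 ⟨t', h1', h2', h3'⟩).elim,
    fun t' h1' h2' h3' => (h2 ⟨t', h1', h2', h3'⟩).elim⟩
  · rintro ⟨c, hcx, hcd, hc1, hc2⟩ c' hcx' hcd' h1 h2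
    have h3 := Ptr _ _ _ hcx hxd.symm hcx' hc2 h1
    exact Qa _ _ hcd hcd' ((PQ _ _ hcx hcd hcx' hcd').1 h3) (Qtr _ _ _ hcd' hxd hcd h2 hc1)
  · exact fun h c hcx hcd h1 h2 => h ⟨c, hcx, hcd, h1, h2⟩
/-- The linear orders on the complements of two points have a common extension. -/
theorem exists_linearization_union {α : Type u} {r : α → α → Prop} {x d : α} (hxd : x ≠ d)
    (hnt : ¬ IsTwin r x d) (hnc : ∀ y, y ≠ x → y ≠ d → IsTwin r x y → IsTwin r y d → False)
    {P Q : α → α → Prop}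
    (Pa : ∀ a b, a ≠ x → b ≠ x → P a b → ¬ P b a)
    (Pt : ∀ a b, a ≠ x → b ≠ x → a ≠ b → P a b ∨ P b a)
    (Ptr : ∀ a b c, a ≠ x → b ≠ x → c ≠ x → P a b → P b c → P a c)
    (Ptw : ∀ a b, a ≠ x → b ≠ x → (∀ c, c ≠ x → c ≠ a → c ≠ b → (r c a ↔ r c b)) →
      ∀ c, c ≠ x → c ≠ a → c ≠ b → (P c a ↔ P c b))
    (Qa : ∀ a b, a ≠ d → b ≠ d → Q a b → ¬ Q b a)
    (Qt : ∀ a b, a ≠ d → b ≠ d → a ≠ b → Q a b ∨ Q b a)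
    (Qtr : ∀ a b c, a ≠ d → b ≠ d → c ≠ d → Q a b → Q b c → Q a c)
    (Qtw : ∀ a b, a ≠ d → b ≠ d → (∀ c, c ≠ d → c ≠ a → c ≠ b → (r c a ↔ r c b)) →
      ∀ c, c ≠ d → c ≠ a → c ≠ b → (Q c a ↔ Q c b))
    (PQ : ∀ a b, a ≠ x → a ≠ d → b ≠ x → b ≠ d → (P a b ↔ Q a b)) :
    ∃ s, IsLinearization r s ∧ (∀ a b, a ≠ x → b ≠ x → (s a b ↔ P a b)) ∧
      ∀ a b, a ≠ d → b ≠ d → (s a b ↔ Q a b) := by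
  obtain ⟨T, T1, T2, T3, T4⟩ :=
    exists_order_of_complements hxd hnc Pa Pt Ptr Ptw Qa Qt Qtr Qtw PQ
  let s : α → α → Prop := fun a b => (a ≠ x ∧ b ≠ x ∧ P a b) ∨ (a ≠ d ∧ b ≠ d ∧ Q a b) ∨
    (a = x ∧ b = d ∧ T) ∨ (a = d ∧ b = x ∧ ¬ T)
  have sP : ∀ a b, a ≠ x → b ≠ x → (s a b ↔ P a b) := by
    intro a b ha hb
    constructor
    · rintro (h | h | h | h)
      exacts [h.2.2, (PQ a b ha h.1 hb h.2.1).2 h.2.2, absurd h.1 ha, absurd h.2.1 hb]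
    · exact fun h => Or.inl ⟨ha, hb, h⟩
  have sQ : ∀ a b, a ≠ d → b ≠ d → (s a b ↔ Q a b) := by
    intro a b ha hb
    constructor
    · rintro (h | h | h | h)
      exacts [(PQ a b h.1 ha h.2.1 hb).1 h.2.2, h.2.2, absurd h.2.1 hb, absurd h.1 ha]
    · exact fun h => Or.inr (Or.inl ⟨ha, hb, h⟩)
  have sxd : s x d ↔ T := by
    constructor
    · rintro (h | h | h | h)
      exacts [absurd rfl h.1, absurd rfl h.2.1, h.2.2, absurd h.1 hxd]
    · exact fun h => Or.inr (Or.inr (Or.inl ⟨rfl, rfl, h⟩))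
  have sdx : s d x ↔ ¬ T := by
    constructor
    · rintro (h | h | h | h)
      exacts [absurd rfl h.2.1, absurd rfl h.1, absurd h.2.1 hxd, h.2.2]
    · exact fun h => Or.inr (Or.inr (Or.inr ⟨rfl, rfl, h⟩))
  clear_value s
  have cov : ∀ a b, (a ≠ x ∧ b ≠ x) ∨ (a ≠ d ∧ b ≠ d) ∨ (a = x ∧ b = d) ∨ (a = d ∧ b = x) := by
    intro a b
    by_cases h1 : a = x
    · by_cases h2 : b = d
      · exact Or.inr (Or.inr (Or.inl ⟨h1, h2⟩))
      · exact Or.inr (Or.inl ⟨fun h => hxd (h1.symm.trans h), h2⟩)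
    · by_cases h2 : b = x
      · by_cases h3 : a = d
        · exact Or.inr (Or.inr (Or.inr ⟨h3, h2⟩))
        · exact Or.inr (Or.inl ⟨h3, fun h => hxd (h2.symm.trans h)⟩)
      · exact Or.inl ⟨h1, h2⟩
  have asy : ∀ a b, s a b → ¬ s b a := by
    intro a b
    rcases cov a b with ⟨h1, h2⟩ | ⟨h1, h2⟩ | ⟨rfl, rfl⟩ | ⟨rfl, rfl⟩
    · rw [sP a b h1 h2, sP b a h2 h1]
      exact Pa a b h1 h2
    · rw [sQ a b h1 h2, sQ b a h2 h1]
      exact Qa a b h1 h2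
    · rw [sxd, sdx, not_not]
      exact fun h => h
    · rw [sxd, sdx]
      exact fun h => h
  have tot : ∀ a b, a ≠ b → s a b ∨ s b a := by
    intro a b hab
    rcases cov a b with ⟨h1, h2⟩ | ⟨h1, h2⟩ | ⟨rfl, rfl⟩ | ⟨rfl, rfl⟩
    · rw [sP a b h1 h2, sP b a h2 h1]
      exact Pt a b h1 h2 hab
    · rw [sQ a b h1 h2, sQ b a h2 h1]
      exact Qt a b h1 h2 hab
    · rw [sxd, sdx]
      exact em T
    · rw [sxd, sdx]
      exact (em T).symm
  -- A triangle missing `x` or `d` is ordered by `P` or `Q`; the remaining triangles are where the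
  -- choice of `T` is used.
  have no3 : ∀ c, ¬ (s x d ∧ s d c ∧ s c x) ∧ ¬ (s d x ∧ s x c ∧ s c d) := by
    intro c
    by_cases hcx : c = x
    · subst hcx
      exact ⟨fun h => asy _ _ h.2.2 h.2.2, fun h => asy _ _ h.2.1 h.2.1⟩
    by_cases hcd : c = d
    · subst hcd
      exact ⟨fun h => asy _ _ h.2.1 h.2.1, fun h => asy _ _ h.2.2 h.2.2⟩
    rw [sxd, sdx, sP d c hxd.symm hcx, sQ c x hcd hxd, sQ x c hxd hcd, sP c d hcx hxd.symm]
    exact ⟨fun h => T1 h.1 c hcx hcd h.2.1 h.2.2, fun h => T2 h.1 c hcx hcd h.2.1 h.2.2⟩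
  have tri : ∀ a b c, ¬ (s a b ∧ s b c ∧ s c a) := by
    intro a b c
    by_cases h1 : a ≠ x ∧ b ≠ x ∧ c ≠ x
    · rw [sP a b h1.1 h1.2.1, sP b c h1.2.1 h1.2.2, sP c a h1.2.2 h1.1]
      exact fun h => Pa _ _ h1.1 h1.2.2 (Ptr a b c h1.1 h1.2.1 h1.2.2 h.1 h.2.1) h.2.2
    by_cases h2 : a ≠ d ∧ b ≠ d ∧ c ≠ d
    · rw [sQ a b h2.1 h2.2.1, sQ b c h2.2.1 h2.2.2, sQ c a h2.2.2 h2.1]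
      exact fun h => Qa _ _ h2.1 h2.2.2 (Qtr a b c h2.1 h2.2.1 h2.2.2 h.1 h.2.1) h.2.2
    rintro ⟨e1, e2, e3⟩
    by_cases ax : a = x <;> by_cases bx : b = x <;> by_cases cx : c = x <;>
    by_cases ad : a = d <;> by_cases bd : b = d <;> by_cases cd : c = d <;>
      first
        | exact h1 ⟨ax, bx, cx⟩
        | exact h2 ⟨ad, bd, cd⟩
        | exact hxd (ax.symm.trans ad)
        | exact hxd (bx.symm.trans bd)
        | exact hxd (cx.symm.trans cd)
        | (rw [ax] at e1 e3; rw [bd] at e1 e2; exact (no3 c).1 ⟨e1, e2, e3⟩)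
        | (rw [bx] at e1 e2; rw [cd] at e2 e3; exact (no3 a).1 ⟨e2, e3, e1⟩)
        | (rw [cx] at e2 e3; rw [ad] at e1 e3; exact (no3 b).1 ⟨e3, e1, e2⟩)
        | (rw [ad] at e1 e3; rw [bx] at e1 e2; exact (no3 c).2 ⟨e1, e2, e3⟩)
        | (rw [bd] at e1 e2; rw [cx] at e2 e3; exact (no3 a).2 ⟨e2, e3, e1⟩)
        | (rw [cd] at e2 e3; rw [ax] at e1 e3; exact (no3 b).2 ⟨e3, e1, e2⟩)
  have hs : IsTournament s := ⟨asy, tot⟩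
  have half : ∀ a b, a ≠ b → IsTwin r a b → a = x → IsTwin s a b := by
    intro a b hab h ax c hca hcb
    subst ax
    by_cases hbd : b = d
    · exact absurd (hbd ▸ h) hnt
    by_cases hcd : c = d
    · rw [hcd, sdx, T3 b hab.symm hbd h, sP d b hxd.symm hab.symm]
      exact ⟨fun h => (Pt b d hab.symm hxd.symm hbd).resolve_left h,
        Pa d b hxd.symm hab.symm⟩
    · rw [sQ c a hcd hxd, sQ c b hcd hbd]
      exact Qtw a b hxd hbd (fun c _ => h c) c hcd hca hcb
  have half' : ∀ a b, a ≠ b → IsTwin r a b → a = d → IsTwin s a b := by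
    intro a b hab h ad c hca hcb
    subst ad
    by_cases hbx : b = x
    · exact absurd (hbx ▸ h.symm) hnt
    by_cases hcx : c = x
    · rw [hcx, sxd, T4 b hbx hab.symm h, sQ x b hxd hab.symm]
    · rw [sP c a hcx hxd.symm, sP c b hcx hbx]
      exact Ptw a b hxd.symm hbx (fun c _ => h c) c hcx hca hcb
  refine ⟨s, ⟨hs, fun a b c h1 h2 => ?_, fun a b h => ?_⟩, sP, sQ⟩
  · by_cases e : a = c
    · subst e
      exact absurd h2 (asy _ _ h1)
    · exact (tot a c e).resolve_right fun h3 => tri a b c ⟨h1, h2, h3⟩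
  · by_cases hab : a = b
    · subst hab
      exact fun _ _ _ => Iff.rfl
    by_cases ax : a = x
    · exact half a b hab h ax
    by_cases bx : b = x
    · exact (half b a (Ne.symm hab) h.symm bx).symm
    by_cases ad : a = d
    · exact half' a b hab h ad
    by_cases bd : b = d
    · exact (half' b a (Ne.symm hab) h.symm bd).symm
    intro c hca hcb
    by_cases cx : c = x
    · have cd : c ≠ d := fun e => hxd (cx.symm.trans e)
      rw [sQ c a cd ad, sQ c b cd bd]
      exact Qtw a b ad bd (fun c _ => h c) c cd hca hcb
    · rw [sP c a cx ax, sP c b cx bx]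
      exact Ptw a b ax bx (fun c _ => h c) c cx hca hcb

section

variable {A B C : Tournament.{u}} {x d : A.carrier} {ι₀ : B.carrier → A.carrier}
  {ι₂ : C.carrier → A.carrier}

/-- Outside the two twin configurations, the bottom of the diamond is `A` without both points, and
the two orders are glued along it. -/
theorem joins_del_del
    (inj₀ : Function.Injective ι₀) (hd₀ : ∀ a, a ≠ x ↔ ∃ b, ι₀ b = a) (w₀ : WeakHom ι₀ B.r A.r)
    (inj₂ : Function.Injective ι₂) (hd₂ : ∀ a, a ≠ d ↔ ∃ b, ι₂ b = a) (w₂ : WeakHom ι₂ C.r A.r) :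
    Joins (fun (a : Lin A) (b : Lin B) => WeakHom ι₀ b.1 a.1)
      fun (a : Lin A) (c : Lin C) => WeakHom ι₂ c.1 a.1 := by
  classical
  by_cases hnt : IsTwin A.r x d
  · exact joins_del_of_twin inj₀ hd₀ w₀ inj₂ hd₂ w₂ hnt
  have hxd : x ≠ d := by
    rintro rfl
    exact hnt fun _ _ _ => Iff.rfl
  by_cases hch : ∃ y, y ≠ x ∧ y ≠ d ∧ IsTwin A.r x y ∧ IsTwin A.r y d
  · obtain ⟨y, h1, h2, h3, h4⟩ := hch
    exact joins_del_of_chain inj₀ hd₀ w₀ inj₂ hd₂ w₂ h1.symm h2 hxd h3 h4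
  have hι₀ : ∀ b, ι₀ b ≠ x := fun b => (hd₀ _).2 ⟨b, rfl⟩
  have hι₂ : ∀ b, ι₂ b ≠ d := fun b => (hd₂ _).2 ⟨b, rfl⟩
  let W := A.sub fun a => a ≠ x ∧ a ≠ d
  have hp : ∀ w : W.carrier, ∃ b, ι₀ b = w.1 := fun w => (hd₀ _).1 w.2.1
  have hq : ∀ w : W.carrier, ∃ b, ι₂ b = w.1 := fun w => (hd₂ _).1 w.2.2
  choose p hp using hp
  choose q hq using hq
  obtain ⟨d', hd'⟩ := (hd₀ d).1 hxd.symm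
  obtain ⟨x', hx'⟩ := (hd₂ x).1 hxd
  have pinj : Function.Injective p := fun a b h => Subtype.ext (by rw [← hp, ← hp, h])
  have qinj : Function.Injective q := fun a b h => Subtype.ext (by rw [← hq, ← hq, h])
  refine ⟨W, _, _, .del d' p pinj ?_ ?_, .del x' q qinj ?_ ?_, ?_⟩
  · intro b
    constructor
    · intro h
      exact ⟨⟨ι₀ b, hι₀ b, fun e => h (inj₀ (e.trans hd'.symm))⟩, inj₀ (hp _)⟩
    · rintro ⟨w, rfl⟩ e
      exact w.2.2 (by rw [← hp, e, hd'])
  · intro a b h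
    have h1 := w₀ (p a) (p b) (inj₀.ne h)
    rw [hp, hp] at h1
    exact h1.symm
  · intro b
    constructor
    · intro h
      exact ⟨⟨ι₂ b, fun e => h (inj₂ (e.trans hx'.symm)), hι₂ b⟩, inj₂ (hq _)⟩
    · rintro ⟨w, rfl⟩ e
      exact w.2.1 (by rw [← hq, e, hx'])
  · intro a b h
    have h1 := w₂ (q a) (q b) (inj₂.ne h)
    rw [hq, hq] at h1
    exact h1.symm
  intro b c w hb hc
  -- `i` and `j` invert the two inclusions; their values at the missing points `x` and `d` play no
  -- role.
  obtain ⟨i, hi⟩ : ∃ i : A.carrier → B.carrier, ∀ a, a ≠ x → ι₀ (i a) = a := by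
    refine ⟨fun a => if h : a ≠ x then ((hd₀ a).1 h).choose else d', fun a h => ?_⟩
    dsimp only
    rw [dif_pos h]
    exact ((hd₀ a).1 h).choose_spec
  obtain ⟨j, hj⟩ : ∃ j : A.carrier → C.carrier, ∀ a, a ≠ d → ι₂ (j a) = a := by
    refine ⟨fun a => if h : a ≠ d then ((hd₂ a).1 h).choose else x', fun a h => ?_⟩
    dsimp only
    rw [dif_pos h]
    exact ((hd₂ a).1 h).choose_spec
  have iinj : ∀ a b, a ≠ x → b ≠ x → a ≠ b → i a ≠ i b := by
    intro a b ha hb h e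
    exact h (by rw [← hi a ha, e, hi b hb])
  have jinj : ∀ a b, a ≠ d → b ≠ d → a ≠ b → j a ≠ j b := by
    intro a b ha hb h e
    exact h (by rw [← hj a ha, e, hj b hb])
  obtain ⟨s, hs, hsP, hsQ⟩ := exists_linearization_union (r := A.r) hxd hnt
    (fun y h1 h2 h3 h4 => hch ⟨y, h1, h2, h3, h4⟩)
    (P := fun a a' => b.1 (i a) (i a')) (Q := fun a a' => c.1 (j a) (j a'))
    (fun a a' _ _ => b.2.asymm _ _) (fun a a' h1 h2 h => b.2.total _ _ (iinj _ _ h1 h2 h))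
    (fun _ _ _ _ _ _ => b.2.trans _ _ _)
    (fun a a' h1 h2 h z hz h3 h4 => b.2.twin (i a) (i a') (fun y hy1 hy2 => by
      rw [w₀ _ _ (inj₀.ne hy1), w₀ _ _ (inj₀.ne hy2), hi a h1, hi a' h2]
      refine h _ (hι₀ y) (fun e => hy1 (inj₀ ?_)) (fun e => hy2 (inj₀ ?_))
      · rw [e, hi a h1]
      · rw [e, hi a' h2]) _ (iinj _ _ hz h1 h3) (iinj _ _ hz h2 h4))
    (fun a a' _ _ => c.2.asymm _ _) (fun a a' h1 h2 h => c.2.total _ _ (jinj _ _ h1 h2 h))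
    (fun _ _ _ _ _ _ => c.2.trans _ _ _)
    (fun a a' h1 h2 h z hz h3 h4 => c.2.twin (j a) (j a') (fun y hy1 hy2 => by
      rw [w₂ _ _ (inj₂.ne hy1), w₂ _ _ (inj₂.ne hy2), hj a h1, hj a' h2]
      refine h _ (hι₂ y) (fun e => hy1 (inj₂ ?_)) (fun e => hy2 (inj₂ ?_))
      · rw [e, hj a h1]
      · rw [e, hj a' h2]) _ (jinj _ _ hz h1 h3) (jinj _ _ hz h2 h4))
    (fun a a' h1 h2 h3 h4 => by
      by_cases e : a = a'
      · subst e
        exact iff_of_false (b.2.irrefl _) (c.2.irrefl _)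
      have pi : ∀ a (h1 : a ≠ x) (h2 : a ≠ d), p ⟨a, h1, h2⟩ = i a := fun a h1 h2 =>
        inj₀ ((hp _).trans (hi a h1).symm)
      have qj : ∀ a (h1 : a ≠ x) (h2 : a ≠ d), q ⟨a, h1, h2⟩ = j a := fun a h1 h2 =>
        inj₂ ((hq _).trans (hj a h2).symm)
      rw [← pi a h1 h2, ← pi a' h3 h4, ← qj a h1 h2, ← qj a' h3 h4]
      have ne : (⟨a, h1, h2⟩ : W.carrier) ≠ ⟨a', h3, h4⟩ := fun h => e (congrArg Subtype.val h)
      exact (hb _ _ (pinj.ne ne)).symm.trans (hc _ _ (qinj.ne ne)))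
  refine ⟨⟨s, hs⟩, ?_, ?_⟩
  · intro y z h
    change _ ↔ s _ _
    rw [hsP _ _ (hι₀ y) (hι₀ z), inj₀ (hi _ (hι₀ y)), inj₀ (hi _ (hι₀ z))]
  · intro y z h
    change _ ↔ s _ _
    rw [hsQ _ _ (hι₂ y) (hι₂ z), inj₂ (hj _ (hι₂ y)), inj₂ (hj _ (hι₂ z))]

end

/-! ### Diamonds of a deletion and a collapse -/

section

variable {A B C : Tournament.{u}} {x : A.carrier} {ι : B.carrier → A.carrier}
  {Y : Set A.carrier} {f : A.carrier → C.carrier}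

/-- Extending a linearization to a point of a module that is collapsed. -/
theorem exists_lin_of_del_col
    (inj : Function.Injective ι) (hd : ∀ a, a ≠ x ↔ ∃ b, ι b = a) (w : WeakHom ι B.r A.r)
    (surj : Function.Surjective f) (hf : ∀ a b, f a = f b ↔ a = b ∨ (a ∈ Y ∧ b ∈ Y))
    (v : WeakHom f A.r C.r) (hxY : x ∈ Y) {y : A.carrier} (hy : y ∈ Y) (hyx : y ≠ x)
    (b : Lin B) (c : Lin C) (bc' : WeakHom (f ∘ ι) b.1 c.1) :
    ∃ a : Lin A, WeakHom ι b.1 a.1 ∧ WeakHom f a.1 c.1 := by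
  have hι : ∀ b, ι b ≠ x := fun b => (hd _).2 ⟨b, rfl⟩
  obtain ⟨y', rfl⟩ := (hd y).1 hyx
  have hr : B.r = fun a b => A.r (ι a) (ι b) := by
    funext x y
    exact propext (w.iff_of_injective inj B.isTournament A.isTournament x y)
  have fne : ∀ a b, a ∉ Y → b ∈ Y → f a ≠ f b := by
    intro a b ha hb h
    rcases (hf a b).1 h with rfl | h
    exacts [ha hb, ha h.1]
  have fY : ∀ a b, a ∈ Y → b ∈ Y → f a = f b := fun a b ha hb => (hf a b).2 (Or.inr ⟨ha, hb⟩)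
  have bc : ∀ a a', f (ι a) ≠ f (ι a') → (b.1 a a' ↔ c.1 (f (ι a)) (f (ι a'))) := bc'
  have hbl : IsLinearization (fun a b => A.r (ι a) (ι b)) b.1 := hr ▸ b.2
  obtain ⟨s, hs, hw, hm⟩ := exists_linearization_insert A.isTournament inj hd hbl hxY
    (v.module hf) ⟨y', hy⟩
    (fun a a₁ a₂ h h₁ h₂ => by
      rw [bc _ _ (fne _ _ h h₁), bc _ _ (fne _ _ h h₂), fY _ _ h₁ h₂])
    -- The image of a twin `t ∉ Y` of `x` is a twin of the collapsed point, hence adjacent to it in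
    -- `c`: no other element outside `Y` separates `t` from `Y`.
    (fun t b c' ht hxt hb' hbt hc => by
      have h1 : f (ι b) ≠ f (ι t) := fun e => by
        rcases (hf _ _).1 e with e | e
        exacts [hbt (inj e), hb' e.1]
      rw [bc _ _ h1, bc _ _ (fne _ _ hb' hc), fY _ _ hc hxY]
      exact (c.2.twin _ _ (hxt.image surj v) _ (fne _ _ hb' hxY) h1).symm)
  refine ⟨⟨s, hs⟩, hw, ?_⟩
  have half : ∀ a a', a ≠ x → f a ≠ f a' → (s a a' ↔ c.1 (f a) (f a')) := by
    intro a a' ha h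
    obtain ⟨a, rfl⟩ := (hd a).1 ha
    by_cases ha' : a' = x
    · subst ha'
      have h1 : ι a ∉ Y := fun h1 => h (fY _ _ h1 hxY)
      rw [hm _ h1 _ hxY _ hy, ← hw a y' (fun e => h1 (e ▸ hy)), fY _ _ hxY hy]
      exact bc _ _ (fne _ _ h1 hy)
    · obtain ⟨a', rfl⟩ := (hd a').1 ha'
      rw [← hw _ _ (fun e => h (congrArg f e)), bc _ _ h]
  intro a a' h
  change s _ _ ↔ _
  by_cases ha : a = x
  · have ha' : a' ≠ x := fun e => h (by rw [ha, e])
    rw [hs.iff_not (fun e => h (congrArg f e)), c.2.iff_not h, half a' a ha' h.symm]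
  · exact half a a' ha h

/-- `Y` keeps an element after the deletion, so collapsing what remains of `Y` yields `C` again, and
`C` is the bottom of the diamond. -/
theorem joins_del_col_of_mem
    (inj : Function.Injective ι) (hd : ∀ a, a ≠ x ↔ ∃ b, ι b = a) (w : WeakHom ι B.r A.r)
    (surj : Function.Surjective f) (hf : ∀ a b, f a = f b ↔ a = b ∨ (a ∈ Y ∧ b ∈ Y))
    (v : WeakHom f A.r C.r) (hxY : x ∈ Y) {y : A.carrier} (hy : y ∈ Y) (hyx : y ≠ x) :
    Joins (fun (a : Lin A) (b : Lin B) => WeakHom ι b.1 a.1)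
      fun (a : Lin A) (c : Lin C) => WeakHom f a.1 c.1 := by
  have hyx' := hyx
  obtain ⟨y', rfl⟩ := (hd y).1 hyx
  refine ⟨C, _, _, .col (ι ⁻¹' Y) (f ∘ ι) ?_ ?_ (w.comp v), Drop.refl C, fun b c k hb hc => ?_⟩
  · intro c
    obtain ⟨a, rfl⟩ := surj c
    by_cases h : a = x
    · exact ⟨y', (hf _ _).2 (Or.inr ⟨hy, h ▸ hxY⟩)⟩
    · obtain ⟨b, rfl⟩ := (hd a).1 h
      exact ⟨b, rfl⟩
  · intro a b
    simp [hf, inj.eq_iff]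
  · exact exists_lin_of_del_col inj hd w surj hf v hxY hy hyx' b c fun a a' h =>
      (hb a a' h).trans (hc _ _ h).symm

/-- The bottom is again `C`, but `t` stands in for the deleted `x`: `g` sends `t` to `f x` and
collapses only the rest of `Y`. The plain choice, `C` without `f x`, would forget on which side of
`Y` the twin `x` lies. -/
theorem joins_del_col_of_twin
    (inj : Function.Injective ι) (hd : ∀ a, a ≠ x ↔ ∃ b, ι b = a) (w : WeakHom ι B.r A.r)
    (surj : Function.Surjective f) (hf : ∀ a b, f a = f b ↔ a = b ∨ (a ∈ Y ∧ b ∈ Y))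
    (v : WeakHom f A.r C.r) (hxY : x ∉ Y) {y t : A.carrier} (hy : y ∈ Y) (hyt : y ≠ t)
    (ht : t ∈ Y) (hxt : IsTwin A.r x t) :
    Joins (fun (a : Lin A) (b : Lin B) => WeakHom ι b.1 a.1)
      fun (a : Lin A) (c : Lin C) => WeakHom f a.1 c.1 := by
  classical
  have hι : ∀ b, ι b ≠ x := fun b => (hd _).2 ⟨b, rfl⟩
  have ne_x : ∀ a, a ∈ Y → a ≠ x := fun a ha e => hxY (e ▸ ha)
  have hr : B.r = fun a b => A.r (ι a) (ι b) := by
    funext x y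
    exact propext (w.iff_of_injective inj B.isTournament A.isTournament x y)
  have fne : ∀ a b, a ∉ Y → b ∈ Y → f a ≠ f b := by
    intro a b ha hb h
    rcases (hf a b).1 h with rfl | h
    exacts [ha hb, ha h.1]
  have fne' : ∀ a b, a ∉ Y → a ≠ b → f a ≠ f b := by
    intro a b ha hb h
    rcases (hf a b).1 h with rfl | h
    exacts [hb rfl, ha h.1]
  have fY : ∀ a b, a ∈ Y → b ∈ Y → f a = f b := fun a b ha hb => (hf a b).2 (Or.inr ⟨ha, hb⟩)
  obtain ⟨y', rfl⟩ := (hd y).1 (ne_x y hy)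
  obtain ⟨t', rfl⟩ := (hd t).1 (ne_x t ht)
  have hyt' : y' ≠ t' := fun e => hyt (congrArg ι e)
  let g : B.carrier → C.carrier := fun b => if b = t' then f x else f (ι b)
  have gt : g t' = f x := if_pos rfl
  have gn : ∀ b, b ≠ t' → g b = f (ι b) := fun b h => if_neg h
  have tx := hxt.image surj v
  have fxt : f x ≠ f (ι t') := fne _ _ hxY ht
  refine ⟨C, _, _, .col {b | ι b ∈ Y ∧ b ≠ t'} g ?_ ?_ ?_, Drop.refl C, ?_⟩
  · intro c
    obtain ⟨a, rfl⟩ := surj c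
    by_cases h : a = x
    · exact ⟨t', h ▸ gt⟩
    · obtain ⟨b, rfl⟩ := (hd a).1 h
      by_cases e : b = t'
      · exact ⟨y', by rw [gn y' hyt', e, fY _ _ hy ht]⟩
      · exact ⟨b, gn b e⟩
  · intro a b
    by_cases ea : a = t' <;> by_cases eb : b = t'
    · simp [ea, eb]
    · rw [ea, gt, gn b eb]
      simp [fne' _ _ hxY (hι b).symm, Ne.symm eb]
    · rw [eb, gt, gn a ea]
      simp [(fne' _ _ hxY (hι a).symm).symm, ea]
    · rw [gn a ea, gn b eb]
      simp [hf, ea, eb, inj.eq_iff]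
  · have half : ∀ a, a ≠ t' → (B.r a t' ↔ C.r (f (ι a)) (f x)) := by
      intro a ha
      rw [w a t' (inj.ne ha), ← hxt _ (hι a) (inj.ne ha)]
      exact v _ _ (fne' _ _ hxY (hι a).symm).symm
    intro a b h
    by_cases ea : a = t' <;> by_cases eb : b = t'
    · exact absurd (by rw [ea, eb]) h
    · subst ea
      rw [B.isTournament.iff_not (Ne.symm eb), half b eb, C.isTournament.iff_not h, gt, gn b eb]
    · rw [eb, gt, gn a ea]
      exact half a ea
    · rw [gn a ea, gn b eb] at h ⊢
      exact (w.comp v) a b h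
  intro b c k hb hc
  have bc : ∀ a a', a ≠ t' → a' ≠ t' → f (ι a) ≠ f (ι a') →
      (b.1 a a' ↔ c.1 (f (ι a)) (f (ι a'))) := by
    intro a a' h1 h2 h
    rw [← gn a h1, ← gn a' h2] at h ⊢
    exact (hb a a' h).trans (hc _ _ h).symm
  have bt : ∀ a, a ≠ t' → (b.1 a t' ↔ c.1 (f (ι a)) (f x)) := by
    intro a h1
    have h : g a ≠ g t' := by
      rw [gt, gn a h1]
      exact (fne' _ _ hxY (hι a).symm).symm
    rw [← gn a h1, ← gt]
    exact (hb a t' h).trans (hc _ _ h).symm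
  have hbl : IsLinearization (fun a b => A.r (ι a) (ι b)) b.1 := hr ▸ b.2
  have cx := c.2.twin _ _ tx
  obtain ⟨s, hs, hw, hm, hst⟩ := exists_linearization_of_twin inj hd hbl (C := {x, ι t'})
    (mem_insert _ _)
    (fun a a₁ a₂ h h₁ h₂ => by
      have h3 : ∀ a, ι a ∈ ({x, ι t'} : Set A.carrier) → a = t' := fun a ha =>
        inj (ha.resolve_left (hι a))
      rw [h3 _ h₁, h3 _ h₂])
    -- In the lift, `x` goes next to `t`, on the side away from the rest of `Y`, which `y'`
    -- represents.
    (t₀ := t') hxt (b.1 y' t')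
    (fun a a' _ ha' _ => by rw [inj (ha'.resolve_left (hι a'))])
    (fun h => absurd (Or.inr rfl) h)
    (fun u hut hxu => by
      -- `Y` contains only one twin of `x`: since `x` lies outside the module, two twins in it would
      -- form with `x` a triple in which no element distinguishes the others.
      by_cases huY : ι u ∈ Y
      · exact (hut (inj (by
          by_contra hne
          have e1 := v.module hf x hxY _ ht _ huY
          have e2 := hxt _ (hι u) hne
          have e3 := hxu _ (hι t') (Ne.symm hne)
          have n1 := A.isTournament.iff_not (hι u)
          have n2 := A.isTournament.iff_not (hι t')
          have n3 := A.isTournament.iff_not hne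
          tauto))).elim
      · have h1 := c.2.twin _ _ (hxu.image surj v)
        have h2 := cx.symm.between c.2.toIsTournament h1 fxt.symm (fne' _ _ hxY (hι u).symm)
          (fne _ _ huY ht).symm
        rw [bt y' hyt', fY _ _ hy ht, h2, b.2.iff_not (Ne.symm hut), bt u hut, 
          ← c.2.iff_not (fne' _ _ hxY (hι u).symm)])
    (fun u hut htu => by
      rw [bt y' hyt', bt u hut]
      by_cases huY : ι u ∈ Y
      · rw [fY _ _ hy huY]
      · have h1 := c.2.twin _ _ (htu.image surj v)
        rw [fY _ _ hy ht, h1.right c.2.toIsTournament fxt (fne' _ _ hxY (hι u).symm)])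
  refine ⟨⟨s, hs⟩, hw, ?_⟩
  have half : ∀ a, a ≠ ι t' → a ≠ x → (s a x ↔ c.1 (f a) (f x)) := by
    intro a h1 h2
    obtain ⟨a, rfl⟩ := (hd a).1 h2
    rw [hm (ι a) (fun h => h.elim h2 h1) x (Or.inl rfl) (ι t') (Or.inr rfl), ← hw _ _ h1]
    exact bt a fun e => h1 (congrArg ι e)
  have half' : ∀ a, a ≠ x → (s a x ↔ c.1 (f a) (f x)) := by
    intro a h2
    by_cases h1 : a = ι t'
    · rw [h1, hst, bt y' hyt', fY _ _ hy ht]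
    · exact half a h1 h2
  have third : ∀ a, a ≠ x → a ∉ Y → (s a (ι t') ↔ c.1 (f a) (f (ι t'))) := by
    intro a h1 h2
    have h3 : a ≠ ι t' := fun e => h2 (e ▸ ht)
    rw [← hm a (fun h => h.elim h1 h3) x (Or.inl rfl) (ι t') (Or.inr rfl), half' a h1]
    exact cx _ (fne' _ _ h2 h1) (fne _ _ h2 ht)
  intro a a' h
  change s _ _ ↔ _
  have hne : a ≠ a' := fun e => h (congrArg f e)
  by_cases ha' : a' = x
  · rw [ha']
    exact half' a fun e => hne (e.trans ha'.symm)
  by_cases ha : a = x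
  · rw [hs.iff_not hne, c.2.iff_not h, ha, half' a' ha']
  by_cases ht' : a' = ι t'
  · subst ht'
    exact third a ha fun h1 => h (fY _ _ h1 ht)
  by_cases ht : a = ι t'
  · subst ht
    rw [hs.iff_not hne, c.2.iff_not h, third a' ha' fun h1 => h (fY _ _ ‹_› h1)]
  obtain ⟨a, rfl⟩ := (hd a).1 ha
  obtain ⟨a', rfl⟩ := (hd a').1 ha'
  rw [← hw _ _ hne]
  exact bc _ _ (fun e => ht (congrArg ι e)) (fun e => ht' (congrArg ι e)) h

/-- Deletion and collapse commute, and the bottom is `C` without `f x`. The lift uses `c` between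
the fibres and `b` inside `Y`. If a twin pair has exactly one member in `Y`, then by `hxt` the other
one is not `x`, so `b` sees both. -/
theorem joins_del_col_of_not_twin
    (inj : Function.Injective ι) (hd : ∀ a, a ≠ x ↔ ∃ b, ι b = a) (w : WeakHom ι B.r A.r)
    (surj : Function.Surjective f) (hf : ∀ a b, f a = f b ↔ a = b ∨ (a ∈ Y ∧ b ∈ Y))
    (v : WeakHom f A.r C.r) (hxY : x ∉ Y) (hxt : ∀ t ∈ Y, ¬ IsTwin A.r x t) :
    Joins (fun (a : Lin A) (b : Lin B) => WeakHom ι b.1 a.1)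
      fun (a : Lin A) (c : Lin C) => WeakHom f a.1 c.1 := by
  have hι : ∀ b, ι b ≠ x := fun b => (hd _).2 ⟨b, rfl⟩
  have fne : ∀ a b, a ∉ Y → b ∈ Y → f a ≠ f b := by
    intro a b ha hb h
    rcases (hf a b).1 h with rfl | h
    exacts [ha hb, ha h.1]
  have fne' : ∀ a b, a ∉ Y → a ≠ b → f a ≠ f b := by
    intro a b ha hb h
    rcases (hf a b).1 h with rfl | h
    exacts [hb rfl, ha h.1]
  have fY : ∀ a b, a ∈ Y → b ∈ Y → f a = f b := fun a b ha hb => (hf a b).2 (Or.inr ⟨ha, hb⟩)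
  have fx : ∀ a, a ≠ x → f a ≠ f x := fun a h => (fne' _ _ hxY h.symm).symm
  let W := C.sub fun c => c ≠ f x
  let g : B.carrier → W.carrier := fun b => ⟨f (ι b), fx _ (hι b)⟩
  have gne : ∀ {a b}, f (ι a) ≠ f (ι b) → g a ≠ g b := fun h e => h (congrArg Subtype.val e)
  refine ⟨W, _, _, .col (ι ⁻¹' Y) g ?_ ?_ ?_,
    .del (f x) Subtype.val Subtype.val_injective (fun a => ⟨fun h => ⟨⟨a, h⟩, rfl⟩, ?_⟩)
      (fun _ _ _ => Iff.rfl), ?_⟩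
  · rintro ⟨c, hc⟩
    obtain ⟨a, rfl⟩ := surj c
    obtain ⟨b, rfl⟩ := (hd a).1 fun e => hc (congrArg f e)
    exact ⟨b, rfl⟩
  · intro a b
    rw [Subtype.ext_iff]
    change f (ι a) = f (ι b) ↔ _
    rw [hf, inj.eq_iff]
    rfl
  · intro a b h
    exact (w.comp v) a b fun e => h (Subtype.ext e)
  · rintro ⟨b, rfl⟩
    exact b.2
  intro b c k hb hc
  have bc : ∀ a a', f (ι a) ≠ f (ι a') → (b.1 a a' ↔ c.1 (f (ι a)) (f (ι a'))) := by
    intro a a' h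
    exact (hb a a' (gne h)).trans (hc (g a) (g a') h)
  let s : A.carrier → A.carrier → Prop := fun a a' => c.1 (f a) (f a') ∨
    (f a = f a' ∧ ∃ z z', ι z = a ∧ ι z' = a' ∧ b.1 z z')
  have s1 : ∀ a a', f a ≠ f a' → (s a a' ↔ c.1 (f a) (f a')) := fun a a' h =>
    ⟨fun h' => h'.resolve_right fun e => h e.1, Or.inl⟩
  have s2 : ∀ a a', s (ι a) (ι a') ↔ b.1 a a' := by
    intro a a'
    by_cases h : f (ι a) = f (ι a')
    · constructor
      · rintro (h' | ⟨-, z, z', h1, h2, h3⟩)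
        · exact absurd h' (h ▸ c.2.irrefl _)
        · rwa [← inj h1, ← inj h2]
      · exact fun h' => Or.inr ⟨h, a, a', rfl, rfl, h'⟩
    · rw [s1 _ _ h, bc _ _ h]
  have sx : ¬ s x x := by
    rintro (h | ⟨-, z, z', h1, -⟩)
    exacts [c.2.irrefl _ h, hι z h1]
  clear_value s
  have cov : ∀ a, a = x ∨ ∃ b, ι b = a := fun a => by
    by_cases h : a = x
    · exact Or.inl h
    · exact Or.inr ((hd a).1 h)
  have s3 : ∀ a, s (ι a) x ↔ c.1 (f (ι a)) (f x) := fun a => s1 _ _ (fx _ (hι a))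
  have s4 : ∀ a, s x (ι a) ↔ c.1 (f x) (f (ι a)) := fun a => s1 _ _ (fx _ (hι a)).symm
  have le : ∀ a a', b.1 a a' → c.1 (f (ι a)) (f (ι a')) ∨ f (ι a) = f (ι a') := by
    intro a a' h
    by_cases e : f (ι a) = f (ι a')
    · exact Or.inr e
    · exact Or.inl ((bc _ _ e).1 h)
  have hs : IsTournament s := by
    constructor
    · intro a a'
      by_cases e : f a = f a'
      · rcases cov a with rfl | ⟨a, rfl⟩ <;> rcases cov a' with rfl | ⟨a', rfl⟩
        · exact fun h => absurd h sx
        · exact absurd e.symm (fx _ (hι _))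
        · exact absurd e (fx _ (hι _))
        · rw [s2, s2]
          exact b.2.asymm _ _
      · rw [s1 _ _ e, s1 _ _ (Ne.symm e)]
        exact c.2.asymm _ _
    · intro a a' h
      by_cases e : f a = f a'
      · rcases cov a with rfl | ⟨a, rfl⟩ <;> rcases cov a' with rfl | ⟨a', rfl⟩
        · exact absurd rfl h
        · exact absurd e.symm (fx _ (hι _))
        · exact absurd e (fx _ (hι _))
        · rw [s2, s2]
          exact b.2.total _ _ fun e => h (congrArg ι e)
      · rw [s1 _ _ e, s1 _ _ (Ne.symm e)]
        exact c.2.total _ _ e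
  refine ⟨⟨s, ⟨hs, ?_, ?_⟩⟩, fun a a' _ => (s2 a a').symm, s1⟩
  · have key : ∀ a a', s a a' → c.1 (f a) (f a') ∨ f a = f a' := by
      intro a a' h
      by_cases e : f a = f a'
      · exact Or.inr e
      · exact Or.inl ((s1 _ _ e).1 h)
    intro a₁ a₂ a₃ h1 h2
    rcases cov a₁ with rfl | ⟨a₁, rfl⟩ <;> rcases cov a₂ with rfl | ⟨a₂, rfl⟩ <;>
      rcases cov a₃ with rfl | ⟨a₃, rfl⟩
    · exact absurd h1 sx
    · exact h2
    · exact absurd h2 (hs.asymm _ _ h1)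
    · rw [s4] at h1 ⊢
      rcases key _ _ h2 with h3 | h3
      · exact c.2.trans _ _ _ h1 h3
      · rwa [← h3]
    · exact h1
    · rw [s3] at h1
      rw [s4] at h2
      have h3 := c.2.trans _ _ _ h1 h2
      exact (s1 _ _ fun e => c.2.irrefl _ (e ▸ h3)).2 h3
    · rw [s3] at h2 ⊢
      rcases key _ _ h1 with h3 | h3
      · exact c.2.trans _ _ _ h3 h2
      · rwa [h3]
    · rw [s2] at h1 h2 ⊢
      exact b.2.trans _ _ _ h1 h2
  -- Against elements of `Y` adjacency comes from `b`, against all others from `c`.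
  · have mixed : ∀ a a', IsTwin A.r a a' → a ∈ Y → a' ∉ Y → IsTwin s a a' := by
      intro a a' h ha ha' z hz hz'
      have ha'x : a' ≠ x := fun e => hxt a ha (e ▸ h.symm)
      by_cases hzY : z ∈ Y
      · have zx : z ≠ x := fun e => hxY (e ▸ hzY)
        have ax : a ≠ x := fun e => hxY (e ▸ ha)
        obtain ⟨z, rfl⟩ := (hd z).1 zx
        obtain ⟨a, rfl⟩ := (hd a).1 ax
        obtain ⟨a', rfl⟩ := (hd a').1 ha'x
        rw [s2, s2]
        exact b.2.twin _ _ (h.of_image inj w) _ (fun e => hz (congrArg ι e))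
          fun e => hz' (congrArg ι e)
      · rw [s1 _ _ (fne' _ _ hzY hz), s1 _ _ (fne' _ _ hzY hz')]
        exact c.2.twin _ _ (h.image surj v) _ (fne' _ _ hzY hz) (fne' _ _ hzY hz')
    intro a a' h
    by_cases ha : a ∈ Y <;> by_cases ha' : a' ∈ Y
    · intro z hz hz'
      by_cases hzY : z ∈ Y
      · obtain ⟨z, rfl⟩ := (hd z).1 fun e => hxY (e ▸ hzY)
        obtain ⟨a, rfl⟩ := (hd a).1 fun e => hxY (e ▸ ha)
        obtain ⟨a', rfl⟩ := (hd a').1 fun e => hxY (e ▸ ha')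
        rw [s2, s2]
        exact b.2.twin _ _ (h.of_image inj w) _ (fun e => hz (congrArg ι e))
          fun e => hz' (congrArg ι e)
      · rw [s1 _ _ (fne' _ _ hzY hz), s1 _ _ (fne' _ _ hzY hz'), fY _ _ ha ha']
    · exact mixed a a' h ha ha'
    · exact (mixed a' a h.symm ha' ha).symm
    · intro z hz hz'
      have h1 := (fne' _ _ ha hz.symm).symm
      have h2 := (fne' _ _ ha' hz'.symm).symm
      rw [s1 _ _ h1, s1 _ _ h2]
      exact c.2.twin _ _ (h.image surj v) _ h1 h2

end

/-! ### Diamonds of two collapses -/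

section

variable {A B C : Tournament.{u}} {X Y : Set A.carrier} {g : A.carrier → B.carrier}
  {f : A.carrier → C.carrier}

/-- `A.sub P` keeps `x` from `X`, `d` from `Y`, and everything outside both. The module property
lets elements be replaced by these representatives. A common element of `X` and `Y` goes to `x`
here, and to `d` when the roles of `X` and `Y` are exchanged. -/
theorem drop_col_of_inter_subsingleton
    (gsurj : Function.Surjective g) (hg : ∀ a b, g a = g b ↔ a = b ∨ (a ∈ X ∧ b ∈ X))
    (w : WeakHom g A.r B.r) (hf : ∀ a b, f a = f b ↔ a = b ∨ (a ∈ Y ∧ b ∈ Y))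
    (v : WeakHom f A.r C.r) {x d : A.carrier}
    (hx : x ∈ X) (hxY : x ∉ Y) (hd : d ∈ Y) (hdX : d ∉ X) {P : A.carrier → Prop}
    (hP : ∀ a, P a ↔ (a ∈ X → a = x) ∧ (a ∈ Y → a = d)) :
    ∃ p : B.carrier → (A.sub P).carrier,
      (∀ a ∈ X, (p (g a)).1 = x) ∧ (∀ a ∉ X, a ∈ Y → (p (g a)).1 = d) ∧
      (∀ a ∉ X, a ∉ Y → (p (g a)).1 = a) ∧
      Drop B (A.sub P)
        fun lam mu => WeakHom p lam.1 mu.1 := by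
  classical
  have hxd : x ≠ d := fun e => hxY (e ▸ hd)
  have Xm := w.module hg
  have Ym := v.module hf
  let q : A.carrier → A.carrier := fun a => if a ∈ X then x else if a ∈ Y then d else a
  have q1 : ∀ a, a ∈ X → q a = x := fun a h => if_pos h
  have q2 : ∀ a, a ∉ X → a ∈ Y → q a = d := fun a h h' => (if_neg h).trans (if_pos h')
  have q3 : ∀ a, a ∉ X → a ∉ Y → q a = a := fun a h h' => (if_neg h).trans (if_neg h')
  clear_value q
  have hq : ∀ a, (q a ∈ X → q a = x) ∧ (q a ∈ Y → q a = d) := by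
    intro a
    by_cases h1 : a ∈ X
    · rw [q1 a h1]
      exact ⟨fun _ => rfl, fun h => absurd h hxY⟩
    by_cases h2 : a ∈ Y
    · rw [q2 a h1 h2]
      exact ⟨fun h => absurd h hdX, fun _ => rfl⟩
    rw [q3 a h1 h2]
    exact ⟨fun h => absurd h h1, fun h => absurd h h2⟩
  have qg : ∀ a a', g a = g a' → q a = q a' := by
    intro a a' h
    rcases (hg a a').1 h with rfl | h
    · rfl
    · rw [q1 _ h.1, q1 _ h.2]
  choose j hj using gsurj
  have qj : ∀ a, q (j (g a)) = q a := fun a => qg _ _ (hj _)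
  have key : ∀ a a', q a = q a' ↔ g a = g a' ∨ ((a ∈ Y ∧ a ∉ X) ∧ (a' ∈ Y ∧ a' ∉ X)) := by
    intro a a'
    constructor
    · intro h
      rw [hg]
      by_cases h1 : a ∈ X <;> by_cases h1' : a' ∈ X
      · exact Or.inl (Or.inr ⟨h1, h1'⟩)
      · rw [q1 a h1] at h
        have h2 := (hq a').1
        by_cases h3 : a' ∈ Y
        · exact absurd (h.trans (q2 _ h1' h3)) hxd
        · rw [q3 _ h1' h3] at h
          exact absurd (h ▸ hx) h1'
      · rw [q1 a' h1'] at h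
        by_cases h3 : a ∈ Y
        · exact absurd (h.symm.trans (q2 _ h1 h3)) hxd
        · rw [q3 _ h1 h3] at h
          exact absurd (h ▸ hx) h1
      · by_cases h2 : a ∈ Y <;> by_cases h2' : a' ∈ Y
        · exact Or.inr ⟨⟨h2, h1⟩, h2', h1'⟩
        · rw [q2 _ h1 h2, q3 _ h1' h2'] at h
          exact absurd (h ▸ hd) h2'
        · rw [q2 _ h1' h2', q3 _ h1 h2] at h
          exact absurd (h ▸ hd) h2
        · rw [q3 _ h1 h2, q3 _ h1' h2'] at h
          exact Or.inl (Or.inl h)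
    · rintro (h | ⟨⟨h1, h2⟩, h3, h4⟩)
      · exact qg _ _ h
      · rw [q2 _ h2 h1, q2 _ h4 h3]
  have half : ∀ a a', q a ≠ q a' → a ∈ X ∨ (a ∉ X ∧ a ∈ Y ∧ a' ∉ X) →
      (A.r a' a ↔ A.r (q a') (q a)) := by
    rintro a a' h (h1 | ⟨h2, h1, h1'⟩)
    · have h2 : a' ∉ X := fun h2 => h (by rw [q1 a h1, q1 a' h2])
      rw [q1 a h1, Xm a' h2 a h1 x hx]
      by_cases h3 : a' ∈ Y
      · have h4 : a' ≠ x := fun e => h2 (e ▸ hx)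
        rw [q2 a' h2 h3, A.isTournament.iff_not h4, A.isTournament.iff_not hxd.symm,
          Ym x hxY a' h3 d hd]
      · rw [q3 a' h2 h3]
    · have h3 : a' ∉ Y := fun h3 => h (by rw [q2 a h2 h1, q2 a' h1' h3])
      rw [q2 a h2 h1, q3 a' h1' h3]
      exact Ym a' h3 a h1 d hd
  have qr : ∀ a a', q a ≠ q a' → (A.r a a' ↔ A.r (q a) (q a')) := by
    intro a a' h
    have flip : (A.r a' a ↔ A.r (q a') (q a)) → (A.r a a' ↔ A.r (q a) (q a')) := fun h' => by
      rw [A.isTournament.iff_not h, A.isTournament.iff_not fun e => h (congrArg q e), h']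
    by_cases h1 : a ∈ X
    · exact flip (half a a' h (Or.inl h1))
    by_cases h1' : a' ∈ X
    · exact half a' a h.symm (Or.inl h1')
    by_cases h2 : a ∈ Y
    · exact flip (half a a' h (Or.inr ⟨h1, h2, h1'⟩))
    by_cases h2' : a' ∈ Y
    · exact half a' a h.symm (Or.inr ⟨h1', h2', h1⟩)
    rw [q3 a h1 h2, q3 a' h1' h2']
  refine ⟨fun b => ⟨q (j b), (hP _).2 (hq _)⟩, fun a h => (qj a).trans (q1 a h),
    fun a h h' => (qj a).trans (q2 a h h'), fun a h h' => (qj a).trans (q3 a h h'),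
    .col {b | j b ∈ Y ∧ j b ∉ X} _ ?_ ?_ ?_⟩
  · rintro ⟨a, ha⟩
    refine ⟨g a, Subtype.ext ((qj a).trans ?_)⟩
    by_cases h1 : a ∈ X
    · exact (q1 a h1).trans (((hP a).1 ha).1 h1).symm
    by_cases h2 : a ∈ Y
    · exact (q2 a h1 h2).trans (((hP a).1 ha).2 h2).symm
    exact q3 a h1 h2
  · intro b b'
    rw [Subtype.ext_iff]
    change q _ = q _ ↔ _
    rw [key, hj, hj]
    rfl
  · intro b b' h
    have h' : q (j b) ≠ q (j b') := fun e => h (Subtype.ext e)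
    have h2 := w (j b) (j b') fun e => h' (qg _ _ e)
    rw [hj, hj] at h2
    exact h2.symm.trans (qr _ _ h')

/-- The lift follows `b`, except inside `X`, where `f` is injective and `c` decides. The delicate
point is a common element of `X` and `Y`, which `b` sees as `x` and `c` sees as `d`; its existence
makes `x` and `d` twins at the bottom of the diamond, so both views agree on elements outside `X ∪
Y`. -/
theorem joins_col_col_of_inter_subsingleton
    (gsurj : Function.Surjective g) (hg : ∀ a b, g a = g b ↔ a = b ∨ (a ∈ X ∧ b ∈ X))
    (w : WeakHom g A.r B.r)
    (fsurj : Function.Surjective f) (hf : ∀ a b, f a = f b ↔ a = b ∨ (a ∈ Y ∧ b ∈ Y))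
    (v : WeakHom f A.r C.r) {x d : A.carrier}
    (hx : x ∈ X) (hxY : x ∉ Y) (hd : d ∈ Y) (hdX : d ∉ X) (hXY : (X ∩ Y).Subsingleton) :
    Joins (fun (a : Lin A) (b : Lin B) => WeakHom g a.1 b.1)
      fun (a : Lin A) (c : Lin C) => WeakHom f a.1 c.1 := by
  have hxd : x ≠ d := fun e => hxY (e ▸ hd)
  have Xm := w.module hg
  have Ym := v.module hf
  let P : A.carrier → Prop := fun a => (a ∈ X → a = x) ∧ (a ∈ Y → a = d)
  obtain ⟨p, p1, p2, p3, hp⟩ := drop_col_of_inter_subsingleton gsurj hg w hf v hx hxY hd hdX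
    (P := P) fun _ => Iff.rfl
  obtain ⟨q, q1, q2, q3, hq⟩ := drop_col_of_inter_subsingleton fsurj hf v hg w hd hdX hx hxY
    (P := P) fun _ => and_comm
  refine ⟨A.sub P, _, _, hp, hq, ?_⟩
  intro b c k hb hc
  have gX : ∀ a a', a ∈ X → a' ∈ X → g a = g a' := fun a a' h h' => (hg a a').2 (Or.inr ⟨h, h'⟩)
  have fY : ∀ a a', a ∈ Y → a' ∈ Y → f a = f a' := fun a a' h h' => (hf a a').2 (Or.inr ⟨h, h'⟩)
  have gne : ∀ a a', a ≠ a' → ¬ (a ∈ X ∧ a' ∈ X) → g a ≠ g a' := fun a a' h h' e =>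
    ((hg a a').1 e).elim h h'
  have fne : ∀ a a', a ≠ a' → ¬ (a ∈ Y ∧ a' ∈ Y) → f a ≠ f a' := fun a a' h h' e =>
    ((hf a a').1 e).elim h h'
  have XY : ∀ a a', a ≠ a' → a ∈ X → a' ∈ X → ¬ (a ∈ Y ∧ a' ∈ Y) := fun a a' h h1 h2 h3 =>
    h (hXY ⟨h1, h3.1⟩ ⟨h2, h3.2⟩)
  have Px : P x := ⟨fun _ => rfl, fun h => absurd h hxY⟩
  have Pd : P d := ⟨fun h => absurd h hdX, fun _ => rfl⟩
  have pne : ∀ a a', (p (g a)).1 ≠ (p (g a')).1 →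
      (b.1 (g a) (g a') ↔ k.1 (p (g a)) (p (g a'))) := fun a a' h =>
    hb _ _ fun e => h (congrArg Subtype.val e)
  have qne : ∀ a a', (q (f a)).1 ≠ (q (f a')).1 →
      (c.1 (f a) (f a') ↔ k.1 (q (f a)) (q (f a'))) := fun a a' h =>
    hc _ _ fun e => h (congrArg Subtype.val e)
  have pq : ∀ a, ¬ (a ∈ X ∧ a ∈ Y) → p (g a) = q (f a) := by
    intro a h
    apply Subtype.ext
    by_cases h1 : a ∈ X
    · rw [p1 a h1, q2 a (fun h2 => h ⟨h1, h2⟩) h1]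
    by_cases h2 : a ∈ Y
    · rw [p2 a h1 h2, q1 a h2]
    · rw [p3 a h1 h2, q3 a h2 h1]
  have pinj : ∀ a a', a ≠ a' → ¬ (a ∈ X ∧ a' ∈ X) → ¬ (a ∈ Y ∧ a' ∈ Y) →
      (p (g a)).1 ≠ (p (g a')).1 := by
    intro a a' h h1 h2
    by_cases ax : a ∈ X <;> by_cases ax' : a' ∈ X <;> by_cases ay : a ∈ Y <;>
      by_cases ay' : a' ∈ Y <;> simp only [ax, ax', ay, ay', p1, p2, p3, not_false_eq_true] <;>
      first
        | exact (h1 ⟨ax, ax'⟩).elim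
        | exact (h2 ⟨ay, ay'⟩).elim
        | exact h
        | exact hxd
        | exact hxd.symm
        | (intro e; exact ax' (e ▸ hx))
        | (intro e; exact ax (e ▸ hx))
        | (intro e; exact ay' (e ▸ hd))
        | (intro e; exact ay (e ▸ hd))
  have bc : ∀ a a', a ≠ a' → ¬ (a ∈ X ∧ a' ∈ X) → ¬ (a ∈ Y ∧ a' ∈ Y) →
      ¬ (a' ∈ X ∧ a' ∈ Y) → (b.1 (g a) (g a') ↔ c.1 (f a) (f a')) := by
    intro a a' h h1 h2 h3
    have h4 := pinj a a' h h1 h2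
    rw [pne a a' h4]
    by_cases h5 : a ∈ X ∧ a ∈ Y
    · have h6 : a' ∉ X := fun h6 => h1 ⟨h5.1, h6⟩
      have h7 : a' ∉ Y := fun h7 => h2 ⟨h5.2, h7⟩
      have e1 : p (g a) = ⟨x, Px⟩ := Subtype.ext (p1 a h5.1)
      have e2 : q (f a) = ⟨d, Pd⟩ := Subtype.ext (q1 a h5.2)
      have h8 : a' ≠ x := fun e => h6 (e ▸ hx)
      have h9 : a' ≠ d := fun e => h7 (e ▸ hd)
      have e3 : (q (f a')).1 = a' := q3 a' h7 h6
      have tw : IsTwin (A.sub P).r ⟨x, Px⟩ ⟨d, Pd⟩ := by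
        rintro ⟨z, hz⟩ hzx hzd
        have zX : z ∉ X := fun h => hzx (Subtype.ext (hz.1 h))
        have zY : z ∉ Y := fun h => hzd (Subtype.ext (hz.2 h))
        exact (Xm z zX x hx a h5.1).trans (Ym z zY a h5.2 d hd)
      rw [qne a a' (by rw [q1 a h5.2, e3]; exact h9.symm), pq a' h3, e1, e2]
      refine (k.2.twin _ _ tw).right k.2.toIsTournament (fun e => h8 ?_) fun e => h9 ?_
      · rw [← e3, e]
      · rw [← e3, e]
    · rw [pq a h5, pq a' h3] at h4 ⊢
      exact (qne a a' h4).symm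
  have bc' : ∀ a a', a ≠ a' → ¬ (a ∈ X ∧ a' ∈ X) → ¬ (a ∈ Y ∧ a' ∈ Y) →
      (b.1 (g a) (g a') ↔ c.1 (f a) (f a')) := by
    intro a a' h h1 h2
    by_cases h3 : a' ∈ X ∧ a' ∈ Y
    · rw [b.2.iff_not (gne _ _ h h1), c.2.iff_not (fne _ _ h h2),
        bc a' a h.symm (fun e => h1 e.symm) (fun e => h2 e.symm)
          fun h4 => h1 ⟨h4.1, h3.1⟩]
    · exact bc a a' h h1 h2 h3
  let s : A.carrier → A.carrier → Prop := fun a a' => b.1 (g a) (g a') ∨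
    ((a ∈ X ∧ a' ∈ X) ∧ c.1 (f a) (f a'))
  have s1 : ∀ a a', ¬ (a ∈ X ∧ a' ∈ X) → (s a a' ↔ b.1 (g a) (g a')) := fun a a' h =>
    ⟨fun h' => h'.resolve_right fun e => h e.1, Or.inl⟩
  have s2 : ∀ a a', a ∈ X → a' ∈ X → (s a a' ↔ c.1 (f a) (f a')) := fun a a' h h' =>
    ⟨fun h1 => (h1.resolve_left fun e => b.2.irrefl _ (gX a a' h h' ▸ e)).2,
      fun h1 => Or.inr ⟨⟨h, h'⟩, h1⟩⟩
  clear_value s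
  have s3 : ∀ a a', f a ≠ f a' → (s a a' ↔ c.1 (f a) (f a')) := by
    intro a a' h
    by_cases h1 : a ∈ X ∧ a' ∈ X
    · exact s2 a a' h1.1 h1.2
    · rw [s1 a a' h1]
      exact bc' a a' (fun e => h (congrArg f e)) h1 fun e => h (fY _ _ e.1 e.2)
  have hs : IsTournament s := by
    constructor
    · intro a a'
      by_cases h1 : a ∈ X ∧ a' ∈ X
      · rw [s2 a a' h1.1 h1.2, s2 a' a h1.2 h1.1]
        exact c.2.asymm _ _
      · rw [s1 a a' h1, s1 a' a fun h => h1 h.symm]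
        exact b.2.asymm _ _
    · intro a a' h
      by_cases h1 : a ∈ X ∧ a' ∈ X
      · rw [s2 a a' h1.1 h1.2, s2 a' a h1.2 h1.1]
        exact c.2.total _ _ (fne _ _ h (XY _ _ h h1.1 h1.2))
      · rw [s1 a a' h1, s1 a' a fun h => h1 h.symm]
        exact b.2.total _ _ (gne _ _ h h1)
  refine ⟨⟨s, ⟨hs, ?_, ?_⟩⟩, fun a a' h => s1 a a' fun h1 => h (gX _ _ h1.1 h1.2), s3⟩
  · intro a₁ a₂ a₃ h1 h2
    by_cases h12 : a₁ ∈ X ∧ a₂ ∈ X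
    · by_cases h3 : a₃ ∈ X
      · rw [s2 _ _ h12.1 h12.2] at h1
        rw [s2 _ _ h12.2 h3] at h2
        rw [s2 _ _ h12.1 h3]
        exact c.2.trans _ _ _ h1 h2
      · rw [s1 _ _ fun h => h3 h.2] at h2 ⊢
        rwa [gX _ _ h12.1 h12.2]
    · rw [s1 _ _ h12] at h1
      by_cases h23 : a₂ ∈ X ∧ a₃ ∈ X
      · rw [s1 _ _ fun h => h12 ⟨h.1, h23.1⟩, ← gX _ _ h23.1 h23.2]
        exact h1
      · rw [s1 _ _ h23] at h2
        have h3 := b.2.trans _ _ _ h1 h2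
        rw [s1]
        · exact h3
        · intro h4
          exact b.2.irrefl _ (gX _ _ h4.1 h4.2 ▸ h3)
  · have mixed : ∀ a a', IsTwin A.r a a' → a ∈ X → a' ∉ X → IsTwin s a a' := by
      intro a a' h ha ha' z hz hz'
      rw [s1 z a' fun h => ha' h.2]
      by_cases hzX : z ∈ X
      · rw [s2 z a hzX ha]
        by_cases hY : z ∈ Y ∧ a' ∈ Y
        -- With `z ∈ X ∩ Y`, `a ∈ X \ Y` and `a' ∈ Y \ X`, the two modules and the twin pair would
        -- yield a triple in which no element distinguishes the others.
        · exfalso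
          have aY : a ∉ Y := fun h => hz (hXY ⟨hzX, hY.1⟩ ⟨ha, h⟩)
          have e1 := Xm a' ha' z hzX a ha
          have e2 := Ym a aY z hY.1 a' hY.2
          have e3 := h z hz hz'
          have n1 := A.isTournament.iff_not hz
          have n2 := A.isTournament.iff_not hz'
          have n3 := A.isTournament.iff_not fun e : a = a' => ha' (e ▸ ha)
          tauto
        · rw [bc' z a' hz' (fun h => ha' h.2) hY]
          by_cases e : f a = f a'
          · rw [e]
          · exact c.2.twin _ _ (h.image fsurj v) _ (fne _ _ hz (XY _ _ hz hzX ha))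
              (fne _ _ hz' hY)
      · rw [s1 z a fun h => hzX h.1]
        exact b.2.twin _ _ (h.image gsurj w) _ (gne _ _ hz fun h => hzX h.1)
          (gne _ _ hz' fun h => hzX h.1)
    intro a a' h
    by_cases ha : a ∈ X <;> by_cases ha' : a' ∈ X
    · intro z hz hz'
      by_cases hzX : z ∈ X
      · rw [s2 _ _ hzX ha, s2 _ _ hzX ha']
        exact c.2.twin _ _ (h.image fsurj v) _ (fne _ _ hz (XY _ _ hz hzX ha))
          (fne _ _ hz' (XY _ _ hz' hzX ha'))
      · rw [s1 _ _ fun h => hzX h.1, s1 _ _ fun h => hzX h.1, gX _ _ ha ha']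
    · exact mixed a a' h ha ha'
    · exact (mixed a' a h.symm ha' ha).symm
    · intro z hz hz'
      rw [s1 _ _ fun h => ha h.2, s1 _ _ fun h => ha' h.2]
      exact b.2.twin _ _ (h.image gsurj w) _ (gne _ _ hz fun h => ha h.2)
        (gne _ _ hz' fun h => ha' h.2)

end

/-- If the modules share two elements, one of them can be removed without changing either quotient;
after induction on the size it is reinserted into the module `X ∩ Y`. If they share at most one and
neither is trivial, each has an element outside the other. -/
theorem joins_col_col {A B C : Tournament.{u}} {X Y : Set A.carrier} {g : A.carrier → B.carrier}
    {f : A.carrier → C.carrier}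
    (gsurj : Function.Surjective g) (hg : ∀ a b, g a = g b ↔ a = b ∨ (a ∈ X ∧ b ∈ X))
    (w : WeakHom g A.r B.r)
    (fsurj : Function.Surjective f) (hf : ∀ a b, f a = f b ↔ a = b ∨ (a ∈ Y ∧ b ∈ Y))
    (v : WeakHom f A.r C.r) :
    Joins (fun (a : Lin A) (b : Lin B) => WeakHom g a.1 b.1)
      fun (a : Lin A) (c : Lin C) => WeakHom f a.1 c.1 := by
  have inj : ∀ {D : Tournament.{u}} {h : A.carrier → D.carrier} {Z : Set A.carrier},
      (∀ a b, h a = h b ↔ a = b ∨ (a ∈ Z ∧ b ∈ Z)) → Z.Subsingleton → Function.Injective h :=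
    fun h1 hZ a b h => ((h1 a b).1 h).elim (fun h => h) fun h => hZ h.1 h.2
  by_cases hX : X.Subsingleton
  · exact (joins_of_bijective (.col Y f fsurj hf v) ⟨inj hg hX, gsurj⟩ w).symm
  by_cases hY : Y.Subsingleton
  · exact joins_of_bijective (.col X g gsurj hg w) ⟨inj hf hY, fsurj⟩ v
  by_cases hXY : (X ∩ Y).Subsingleton
  · have pick : ∀ X Y : Set A.carrier, ¬ X.Subsingleton → (X ∩ Y).Subsingleton →
        ∃ x ∈ X, x ∉ Y := by
      intro X Y hX hXY
      by_contra! h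
      exact hX fun a ha b hb => hXY ⟨ha, h a ha⟩ ⟨hb, h b hb⟩
    obtain ⟨x, hx, hxY⟩ := pick X Y hX hXY
    obtain ⟨d, hd, hdX⟩ := pick Y X hY (inter_comm X Y ▸ hXY)
    exact joins_col_col_of_inter_subsingleton gsurj hg w fsurj hf v hx hxY hd hdX hXY
  obtain ⟨x, ⟨hxX, hxY⟩, y, ⟨hyX, hyY⟩, hxy⟩ := Set.not_subsingleton_iff.1 hXY
  have := A.finite
  have restr : ∀ {D : Tournament.{u}} {h : A.carrier → D.carrier} {Z : Set A.carrier},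
      (∀ a b, h a = h b ↔ a = b ∨ (a ∈ Z ∧ b ∈ Z)) → Function.Surjective h → x ∈ Z → y ∈ Z →
      Function.Surjective (fun a : (A.sub (· ≠ x)).carrier => h a.1) := by
    intro D h Z h1 h2 hx hy c
    obtain ⟨a, rfl⟩ := h2 c
    by_cases e : a = x
    · exact ⟨⟨y, hxy.symm⟩, (h1 _ _).2 (Or.inr ⟨hy, e ▸ hx⟩)⟩
    · exact ⟨⟨a, e⟩, rfl⟩
  have hcard : Nat.card (A.sub (· ≠ x)).carrier < Nat.card A.carrier :=
    Finite.card_subtype_lt (x := x) (by simp)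
  obtain ⟨W, R', S', hR, hS, h⟩ := joins_col_col (A := A.sub (· ≠ x)) (X := Subtype.val ⁻¹' X)
    (Y := Subtype.val ⁻¹' Y) (g := fun a => g a.1) (f := fun a => f a.1)
    (restr hg gsurj hxX hyX) (fun a b => by rw [hg, Subtype.ext_iff]; rfl)
    (fun a b h => w a.1 b.1 h)
    (restr hf fsurj hxY hyY) (fun a b => by rw [hf, Subtype.ext_iff]; rfl)
    (fun a b h => v a.1 b.1 h)
  refine ⟨W, R', S', hR, hS, fun b c k hb hc => ?_⟩
  obtain ⟨a, ha, ha'⟩ := h b c k hb hc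
  have gX : ∀ a a', a ∈ X → a' ∈ X → g a = g a' := fun a a' h h' => (hg a a').2 (Or.inr ⟨h, h'⟩)
  have fY : ∀ a a', a ∈ Y → a' ∈ Y → f a = f a' := fun a a' h h' => (hf a a').2 (Or.inr ⟨h, h'⟩)
  have gne : ∀ a a', a ∉ X → a ≠ a' → g a ≠ g a' := fun a a' h h' e =>
    ((hg a a').1 e).elim h' fun e => h e.1
  have fne : ∀ a a', a ∉ Y → a ≠ a' → f a ≠ f a' := fun a a' h h' e =>
    ((hf a a').1 e).elim h' fun e => h e.1
  have ne : ∀ a a', a ∉ X ∩ Y → a' ∈ X ∩ Y → a ≠ a' := fun a a' h h' e => h (e ▸ h')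
  have hxd : ∀ a, a ≠ x ↔ ∃ b : (A.sub (· ≠ x)).carrier, b.1 = a :=
    fun a => ⟨fun h => ⟨⟨a, h⟩, rfl⟩, by rintro ⟨b, rfl⟩; exact b.2⟩
  obtain ⟨s, hs, hw, hm⟩ := exists_linearization_insert (C := X ∩ Y) A.isTournament
    Subtype.val_injective hxd a.2 ⟨hxX, hxY⟩
    (fun b hb c hc c' hc' => by
      by_cases hbX : b ∈ X
      · exact v.module hf b (fun hbY => hb ⟨hbX, hbY⟩) c hc.2 c' hc'.2
      · exact w.module hg b hbX c hc.1 c' hc'.1)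
    ⟨⟨y, hxy.symm⟩, hyX, hyY⟩
    (fun b₁ c₁ c₂ h h₁ h₂ => by
      by_cases hbX : b₁.1 ∈ X
      · have hbY : b₁.1 ∉ Y := fun hbY => h ⟨hbX, hbY⟩
        rw [ha' _ _ (fne _ _ hbY (ne _ _ h h₁)), ha' _ _ (fne _ _ hbY (ne _ _ h h₂))]
        simp only [fY _ _ h₁.2 h₂.2]
      · rw [ha _ _ (gne _ _ hbX (ne _ _ h h₁)), ha _ _ (gne _ _ hbX (ne _ _ h h₂))]
        simp only [gX _ _ h₁.1 h₂.1])
    (fun t b₁ c₁ ht hxt hb₁ hbt hc₁ => by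
      have hbt' : b₁.1 ≠ t.1 := fun e => hbt (Subtype.ext e)
      by_cases hbX : b₁.1 ∈ X
      · have hbY : b₁.1 ∉ Y := fun hbY => hb₁ ⟨hbX, hbY⟩
        rw [ha' _ _ (fne _ _ hbY hbt'), ha' _ _ (fne _ _ hbY (ne _ _ hb₁ hc₁))]
        simp only [fY _ _ hc₁.2 hxY]
        exact (c.2.twin _ _ (hxt.image fsurj v) _ (fne _ _ hbY (ne _ _ hb₁ ⟨hxX, hxY⟩))
          (fne _ _ hbY hbt')).symm
      · rw [ha _ _ (gne _ _ hbX hbt'), ha _ _ (gne _ _ hbX (ne _ _ hb₁ hc₁))]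
        simp only [gX _ _ hc₁.1 hxX]
        exact (b.2.twin _ _ (hxt.image gsurj w) _ (gne _ _ hbX (ne _ _ hb₁ ⟨hxX, hxY⟩))
          (gne _ _ hbX hbt')).symm)
  have ext : ∀ {D : Tournament.{u}} {φ : A.carrier → D.carrier} {Z : Set A.carrier} {k : Lin D},
      (∀ a b, φ a = φ b ↔ a = b ∨ (a ∈ Z ∧ b ∈ Z)) → X ∩ Y ⊆ Z →
      WeakHom (fun a : (A.sub (· ≠ x)).carrier => φ a.1) a.1 k.1 → WeakHom φ s k.1 := by
    intro D φ Z k h1 hZ h2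
    have half : ∀ a a', a ≠ x → φ a ≠ φ a' → (s a a' ↔ k.1 (φ a) (φ a')) := by
      intro a₁ a₂ hne hh
      by_cases e : a₂ = x
      · subst e
        have h3 : a₁ ∉ Z := fun h3 => hh ((h1 _ _).2 (Or.inr ⟨h3, hZ ⟨hxX, hxY⟩⟩))
        have h4 : φ a₂ = φ y := (h1 _ _).2 (Or.inr ⟨hZ ⟨hxX, hxY⟩, hZ ⟨hyX, hyY⟩⟩)
        rw [hm a₁ (fun h => h3 (hZ h)) _ ⟨hxX, hxY⟩ y ⟨hyX, hyY⟩, h4]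
        rw [h4] at hh
        exact (hw ⟨a₁, hne⟩ ⟨y, hxy.symm⟩ (fun e => hh (congrArg φ e))).symm.trans
          (h2 ⟨a₁, hne⟩ ⟨y, hxy.symm⟩ hh)
      · exact (hw ⟨a₁, hne⟩ ⟨a₂, e⟩ (fun e => hh (congrArg φ e))).symm.trans
          (h2 ⟨a₁, hne⟩ ⟨a₂, e⟩ hh)
    intro a₁ a₂ hh
    by_cases e : a₁ = x
    · have e' : a₂ ≠ x := fun e' => hh (by rw [e, e'])
      rw [hs.iff_not fun e => hh (congrArg φ e), k.2.iff_not hh, half a₂ a₁ e' hh.symm]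
    · exact half a₁ a₂ e hh
  exact ⟨⟨s, hs⟩, ext hg inter_subset_left ha, ext hf inter_subset_right ha'⟩
termination_by Nat.card A.carrier

theorem joins_del_col {A B C : Tournament.{u}} {x : A.carrier} {ι : B.carrier → A.carrier}
    {Y : Set A.carrier} {f : A.carrier → C.carrier}
    (inj : Function.Injective ι) (hd : ∀ a, a ≠ x ↔ ∃ b, ι b = a) (w : WeakHom ι B.r A.r)
    (surj : Function.Surjective f) (hf : ∀ a b, f a = f b ↔ a = b ∨ (a ∈ Y ∧ b ∈ Y))
    (v : WeakHom f A.r C.r) :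
    Joins (fun (a : Lin A) (b : Lin B) => WeakHom ι b.1 a.1)
      fun (a : Lin A) (c : Lin C) => WeakHom f a.1 c.1 := by
  by_cases hY : Y.Subsingleton
  · exact joins_of_bijective (.del x ι inj hd w)
      ⟨fun a b h => ((hf a b).1 h).elim (fun h => h) fun h => hY h.1 h.2, surj⟩ v
  have pick : ∀ t, ∃ y ∈ Y, y ≠ t := by
    intro t
    by_contra! h
    exact hY fun a ha b hb => (h a ha).trans (h b hb).symm
  by_cases hx : x ∈ Y
  · obtain ⟨y, hy, hyx⟩ := pick x
    exact joins_del_col_of_mem inj hd w surj hf v hx hy hyx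
  by_cases ht : ∃ t ∈ Y, IsTwin A.r x t
  · obtain ⟨t, ht, hxt⟩ := ht
    obtain ⟨y, hy, hyt⟩ := pick t
    exact joins_del_col_of_twin inj hd w surj hf v hx hy hyt ht hxt
  · exact joins_del_col_of_not_twin inj hd w surj hf v hx fun t h h' => ht ⟨t, h, h'⟩

/-! ### Confluence of drops -/

theorem Drop.joins {A B C : Tournament.{u}} {R : Lin A → Lin B → Prop} {S : Lin A → Lin C → Prop}
    (hR : Drop A B R) (hS : Drop A C S) : Joins R S := by
  cases hR with
  | del x ι inj hd w =>
    cases hS with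
    | del x' ι' inj' hd' w' => exact joins_del_del inj hd w inj' hd' w'
    | col Y f surj hf v => exact joins_del_col inj hd w surj hf v
  | col X g surj hg w =>
    cases hS with
    | del x' ι' inj' hd' w' => exact (joins_del_col inj' hd' w' surj hg w).symm
    | col Y f surj' hf v => exact joins_col_col surj hg w surj' hf v

/-- A sequence of drops, with the composite relation between linearizations. -/
inductive Down : (A B : Tournament.{u}) → (Lin A → Lin B → Prop) → Prop
  | refl (A : Tournament.{u}) : Down A A Eq
  | cons {A B C : Tournament.{u}} {R : Lin A → Lin B → Prop} {S : Lin B → Lin C → Prop} :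
      Drop A B R → Down B C S → Down A C fun a c => ∃ b, R a b ∧ S b c

theorem Down.trans {A B C : Tournament.{u}} {R : Lin A → Lin B → Prop}
    {S : Lin B → Lin C → Prop} (hR : Down A B R) (hS : Down B C S) :
    Down A C fun a c => ∃ b, R a b ∧ S b c := by
  induction hR with
  | refl A => simpa using hS
  | cons h _ ih =>
    have := Down.cons h (ih hS)
    convert this using 3 with a c
    constructor
    · rintro ⟨b, ⟨b', h1, h2⟩, h3⟩
      exact ⟨b', h1, b, h2, h3⟩
    · rintro ⟨b', h1, b, h2, h3⟩
      exact ⟨b, ⟨b', h1, h2⟩, h3⟩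

/-- Each diamond closes with a single drop on either side, so diamonds paste along the sequence by
plain induction. -/
theorem Down.strip {A B C : Tournament.{u}} {R : Lin A → Lin B → Prop}
    {S : Lin A → Lin C → Prop} (hS : Down A C S) (hR : Drop A B R) :
    ∃ (W : Tournament.{u}) (R' : Lin B → Lin W → Prop) (S' : Lin C → Lin W → Prop),
      Down B W R' ∧ Drop C W S' ∧ ∀ b c w, R' b w → S' c w → ∃ a, R a b ∧ S a c := by
  induction hS generalizing B with
  | refl A =>
    exact ⟨B, _, _, .refl B, hR, by rintro b c w rfl h; exact ⟨c, h, rfl⟩⟩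
  | @cons A D C R₁ S₁ h _ ih =>
    obtain ⟨W, R', S', h1, h2, h3⟩ := hR.joins h
    obtain ⟨W', R'', S'', h4, h5, h6⟩ := ih h2
    refine ⟨W', _, _, .cons h1 h4, h5, ?_⟩
    rintro b c w ⟨k, hk, hk'⟩ hc
    obtain ⟨d, hd, hd'⟩ := h6 k c w hk' hc
    obtain ⟨a, ha, ha'⟩ := h3 b d k hk hd
    exact ⟨a, ha, d, ha', hd'⟩

theorem Down.confluent {A B C : Tournament.{u}} {R : Lin A → Lin B → Prop}
    {S : Lin A → Lin C → Prop} (hR : Down A B R) (hS : Down A C S) :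
    ∃ (W : Tournament.{u}) (R' : Lin B → Lin W → Prop) (S' : Lin C → Lin W → Prop),
      Down B W R' ∧ Down C W S' ∧ ∀ b c w, R' b w → S' c w → ∃ a, R a b ∧ S a c := by
  induction hR generalizing C with
  | refl A =>
    exact ⟨C, _, _, hS, .refl C, by rintro b c w h rfl; exact ⟨b, rfl, h⟩⟩
  | @cons A D B R₁ S₁ h _ ih =>
    obtain ⟨W, R', S', h1, h2, h3⟩ := hS.strip h
    obtain ⟨W', R'', S'', h4, h5, h6⟩ := ih h1
    refine ⟨W', _, _, h4, .cons h2 h5, ?_⟩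
    rintro b c w hb ⟨k, hk, hk'⟩
    obtain ⟨d, hd, hd'⟩ := h6 b k w hb hk'
    obtain ⟨a, ha, ha'⟩ := h3 d c k hd' hk
    exact ⟨a, ⟨d, ha, hd⟩, ha'⟩

/-! ### Decomposing weak homomorphisms and lifting linearizations -/

theorem exists_down_of_injective {Q I : Tournament.{u}} {ι : I.carrier → Q.carrier}
    (inj : Function.Injective ι) (w : WeakHom ι I.r Q.r) :
    ∃ R, Down Q I R ∧ ∀ lam mu, R lam mu → WeakHom ι mu.1 lam.1 := by
  by_cases hs : Function.Surjective ι
  · let e := Equiv.ofBijective ι ⟨inj, hs⟩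
    have he : ∀ a, e.symm (ι a) = a := e.symm_apply_apply
    refine ⟨_, .cons (.col ∅ e.symm e.symm.surjective (by simp) ?_) (.refl I), ?_⟩
    · intro a b h
      obtain ⟨a, rfl⟩ := hs a
      obtain ⟨b, rfl⟩ := hs b
      rw [he, he] at *
      exact (w a b (inj.ne h)).symm
    · rintro lam mu ⟨_, h, rfl⟩ a b hab
      have := h (ι a) (ι b)
      rw [he, he] at this
      exact (this fun e => hab (congrArg ι e)).symm
  · obtain ⟨d, hd⟩ := not_forall.1 hs
    have := Q.finite
    have hcard : Nat.card (Q.sub (· ≠ d)).carrier < Nat.card Q.carrier :=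
      Finite.card_subtype_lt (x := d) (by simp)
    obtain ⟨R, hR, hR'⟩ := exists_down_of_injective (Q := Q.sub (· ≠ d)) (I := I)
      (ι := fun a => (⟨ι a, fun e => hd ⟨a, e⟩⟩ : (Q.sub (· ≠ d)).carrier)) (fun a b h => inj (congrArg Subtype.val h))
      (fun a b h => w a b fun e => h (Subtype.ext e))
    refine ⟨_, .cons (.del (B := Q.sub (· ≠ d)) d Subtype.val Subtype.val_injective
      (fun a => ⟨fun h => ⟨⟨a, h⟩, rfl⟩, by rintro ⟨b, rfl⟩; exact b.2⟩)
      fun _ _ _ => Iff.rfl) hR, ?_⟩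
    rintro lam mu ⟨k, h1, h2⟩
    intro a b h
    exact (hR' _ _ h2 a b fun e => h (congrArg Subtype.val e)).trans (h1 _ _ h)
termination_by Nat.card Q.carrier

/-- The fibres are modules, so they can be collapsed one after another, each to a representative in
`P`. -/
theorem exists_down_of_surjective {P I : Tournament.{u}} {f : P.carrier → I.carrier}
    (surj : Function.Surjective f) (w : WeakHom f P.r I.r) :
    ∃ R, Down P I R ∧ ∀ lam mu, R lam mu → WeakHom f lam.1 mu.1 := by
  classical
  by_cases hi : Function.Injective f
  · refine ⟨_, .cons (.col ∅ f surj (by simp [hi.eq_iff]) w) (.refl I), ?_⟩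
    rintro lam mu ⟨_, h, rfl⟩
    exact h
  · obtain ⟨a, b, hab, hne⟩ := Function.not_injective_iff.1 hi
    have := P.finite
    let p : P.carrier → Prop := fun c => f c = f a → c = a
    have hcard : Nat.card (P.sub p).carrier < Nat.card P.carrier :=
      Finite.card_subtype_lt (x := b) fun h => hne (h hab.symm).symm
    let q : P.carrier → P.carrier := fun c => if f c = f a then a else c
    have q1 : ∀ c, f c = f a → q c = a := fun c h => if_pos h
    have q2 : ∀ c, f c ≠ f a → q c = c := fun c h => if_neg h
    clear_value q
    have fq : ∀ c, f (q c) = f c := by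
      intro c
      by_cases h : f c = f a
      · rw [q1 c h, h]
      · rw [q2 c h]
    have pq : ∀ c, p (q c) := by
      intro c
      by_cases h : f c = f a
      · rw [q1 c h]
        exact fun _ => rfl
      · rw [q2 c h]
        exact fun h' => absurd h' h
    have qq : ∀ c c', q c = q c' ↔ c = c' ∨ (c ∈ {c | f c = f a} ∧ c' ∈ {c | f c = f a}) := by
      intro c c'
      constructor
      · intro h
        have h3 := congrArg f h
        rw [fq, fq] at h3
        by_cases h1 : f c = f a
        · exact Or.inr ⟨h1, h3.symm.trans h1⟩
        · rw [q2 c h1, q2 c' (h3 ▸ h1)] at h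
          exact Or.inl h
      · rintro (rfl | ⟨h, h'⟩)
        · rfl
        · rw [q1 c h, q1 c' h']
    obtain ⟨R, hR, hR'⟩ := exists_down_of_surjective (P := P.sub p) (I := I) (f := fun c => f c.1)
      (fun i => by
        obtain ⟨c, rfl⟩ := surj i
        exact ⟨⟨q c, pq c⟩, fq c⟩)
      (fun c c' h => w c c' h)
    refine ⟨_, .cons (.col {c | f c = f a} (fun c => (⟨q c, pq c⟩ : (P.sub p).carrier)) ?_ ?_ ?_) hR, ?_⟩
    · rintro ⟨c, hc⟩
      refine ⟨c, Subtype.ext ?_⟩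
      by_cases h : f c = f a
      · exact (q1 c h).trans (hc h).symm
      · exact q2 c h
    · intro c c'
      rw [Subtype.ext_iff]
      exact qq c c'
    · intro c c' h
      change _ ↔ P.r (q c) (q c')
      by_cases h1 : f c = f c'
      · have h2 : f c ≠ f a := fun h2 => h (Subtype.ext ((qq c c').2 (Or.inr ⟨h2, h1.symm.trans h2⟩)))
        rw [q2 c h2, q2 c' (h1 ▸ h2)]
      · rw [w c c' h1, w (q c) (q c') (by rwa [fq, fq]), fq, fq]
    · rintro lam mu ⟨k, h1, h2⟩
      have h3 := WeakHom.comp h1 (hR' _ _ h2)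
      have h4 : (fun c : (P.sub p).carrier => f c.1) ∘
          (fun c : P.carrier => (⟨q c, pq c⟩ : (P.sub p).carrier)) = f := funext fq
      rwa [h4] at h3
termination_by Nat.card P.carrier

theorem nonempty_lin (A : Tournament.{u}) : Nonempty (Lin A) := by
  by_cases h : Nonempty A.carrier
  · obtain ⟨d⟩ := h
    have := A.finite
    have hcard : Nat.card (A.sub (· ≠ d)).carrier < Nat.card A.carrier :=
      Finite.card_subtype_lt (x := d) (by simp)
    obtain ⟨b⟩ := nonempty_lin (A.sub (· ≠ d))
    obtain ⟨a, -⟩ := exists_lin_of_del (A := A) (B := A.sub (· ≠ d)) (d := d)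
      Subtype.val_injective
      (fun a => ⟨fun h => ⟨⟨a, h⟩, rfl⟩, by rintro ⟨b, rfl⟩; exact b.2⟩)
      (fun _ _ _ => Iff.rfl) b
    exact ⟨a⟩
  · rw [not_nonempty_iff] at h
    exact ⟨⟨fun _ _ => False, ⟨⟨fun a => h.elim a, fun a => h.elim a⟩, fun a => h.elim a,
      fun a => h.elim a⟩⟩⟩
termination_by Nat.card A.carrier

/-- The points of `Y` are put back one at a time, starting from a trivial module, where `f` is an
isomorphism. -/
theorem exists_lin_of_col {A B : Tournament.{u}} {Y : Set A.carrier} {f : A.carrier → B.carrier}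
    (surj : Function.Surjective f) (hf : ∀ a b, f a = f b ↔ a = b ∨ (a ∈ Y ∧ b ∈ Y))
    (w : WeakHom f A.r B.r) (b : Lin B) : ∃ a : Lin A, WeakHom f a.1 b.1 := by
  by_cases hY : Y.Subsingleton
  · exact exists_lin_of_bijective
      ⟨fun a b h => ((hf a b).1 h).elim (fun h => h) fun h => hY h.1 h.2, surj⟩ w b
  obtain ⟨x, hx, y, hy, hxy⟩ := Set.not_subsingleton_iff.1 hY
  have := A.finite
  have hcard : Nat.card (A.sub (· ≠ x)).carrier < Nat.card A.carrier :=
    Finite.card_subtype_lt (x := x) (by simp)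
  obtain ⟨a', ha'⟩ := exists_lin_of_col (A := A.sub (· ≠ x)) (Y := Subtype.val ⁻¹' Y)
    (f := fun a => f a.1)
    (fun c => by
      obtain ⟨a, rfl⟩ := surj c
      by_cases e : a = x
      · exact ⟨⟨y, hxy.symm⟩, (hf _ _).2 (Or.inr ⟨hy, e ▸ hx⟩)⟩
      · exact ⟨⟨a, e⟩, rfl⟩)
    (fun a b => by rw [hf, Subtype.ext_iff]; rfl) (fun a b h => w a.1 b.1 h) b
  obtain ⟨a, -, ha⟩ := exists_lin_of_del_col (A := A) (B := A.sub (· ≠ x))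
    Subtype.val_injective
    (fun a => ⟨fun h => ⟨⟨a, h⟩, rfl⟩, by rintro ⟨b, rfl⟩; exact b.2⟩)
    (fun _ _ _ => Iff.rfl) surj hf w hx hy hxy.symm a' b ha'
  exact ⟨a, ha⟩
termination_by Nat.card A.carrier

theorem Down.exists_lift {A B : Tournament.{u}} {R : Lin A → Lin B → Prop} (h : Down A B R)
    (b : Lin B) : ∃ a, R a b := by
  induction h with
  | refl A => exact ⟨b, rfl⟩
  | cons h _ ih =>
    obtain ⟨k, hk⟩ := ih b
    cases h with
    | del d ι inj hd w =>
      obtain ⟨a, ha⟩ := exists_lin_of_del inj hd w k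
      exact ⟨a, k, ha, hk⟩
    | col Y f surj hf w =>
      obtain ⟨a, ha⟩ := exists_lin_of_col surj hf w k
      exact ⟨a, k, ha, hk⟩

/-! ### Composing along a zigzag -/

/-- Two tournaments can be dropped to a common one, in such a way that linearizations with a common
image are related by `T`. -/
def Meet (A C : Tournament.{u}) (T : Lin A → Lin C → Prop) : Prop :=
  ∃ (W : Tournament.{u}) (R : Lin A → Lin W → Prop) (S : Lin C → Lin W → Prop),
    Down A W R ∧ Down C W S ∧ ∀ a c w, R a w → S c w → T a c

theorem Meet.exists_rel {A C : Tournament.{u}} {T : Lin A → Lin C → Prop} (h : Meet A C T) :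
    ∃ a c, T a c := by
  obtain ⟨W, R, S, hR, hS, h⟩ := h
  obtain ⟨w⟩ := nonempty_lin W
  obtain ⟨a, ha⟩ := hR.exists_lift w
  obtain ⟨c, hc⟩ := hS.exists_lift w
  exact ⟨a, c, h a c w ha hc⟩

theorem Meet.mono {A C : Tournament.{u}} {T T' : Lin A → Lin C → Prop} (h : Meet A C T)
    (hT : ∀ a c, T a c → T' a c) : Meet A C T' := by
  obtain ⟨W, R, S, hR, hS, h⟩ := h
  exact ⟨W, R, S, hR, hS, fun a c w ha hc => hT a c (h a c w ha hc)⟩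

theorem Meet.symm {A C : Tournament.{u}} {T : Lin A → Lin C → Prop} (h : Meet A C T) :
    Meet C A fun c a => T a c := by
  obtain ⟨W, R, S, hR, hS, h⟩ := h
  exact ⟨W, S, R, hS, hR, fun a c w ha hc => h c a w hc ha⟩

/-- Confluence below `B` supplies the common drop, and its amalgamation property the linearization
in the middle. -/
theorem Meet.trans {A B C : Tournament.{u}} {T : Lin A → Lin B → Prop} {U : Lin B → Lin C → Prop}
    (h : Meet A B T) (h' : Meet B C U) : Meet A C fun a c => ∃ b, T a b ∧ U b c := by
  obtain ⟨W, R, S, hR, hS, h⟩ := h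
  obtain ⟨W', R', S', hR', hS', h'⟩ := h'
  obtain ⟨X, P, Q, hP, hQ, hX⟩ := hS.confluent hR'
  refine ⟨X, _, _, hR.trans hP, hS'.trans hQ, ?_⟩
  rintro a c x ⟨w, h1, h2⟩ ⟨w', h3, h4⟩
  obtain ⟨b, hb, hb'⟩ := hX w w' x h2 h4
  exact ⟨b, h a b w h1 hb, h' b c w' hb' h3⟩

/-- Both sides drop to the image of `f`: `A` by collapsing fibres, `C` by deleting the elements not
attained. -/
theorem WeakHom.meet {A C : Tournament.{u}} {f : A.carrier → C.carrier} (w : WeakHom f A.r C.r) :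
    Meet A C fun a c => WeakHom f a.1 c.1 := by
  obtain ⟨R, hR, hR'⟩ := exists_down_of_surjective (P := A) (I := C.sub (· ∈ range f))
    (f := fun a => (⟨f a, a, rfl⟩ : (C.sub (· ∈ range f)).carrier)) (by rintro ⟨_, a, rfl⟩; exact ⟨a, rfl⟩)
    fun a b h => w a b fun e => h (Subtype.ext e)
  obtain ⟨S, hS, hS'⟩ := exists_down_of_injective (Q := C) (I := C.sub (· ∈ range f))
    Subtype.val_injective fun _ _ _ => Iff.rfl
  exact ⟨_, R, S, hR, hS, fun a c w ha hc x y h =>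
    (hR' _ _ ha x y fun e => h (congrArg Subtype.val e)).trans (hS' _ _ hc _ _ h)⟩

/-- Compatible linearizations along a zigzag of weak homomorphisms. -/
theorem exists_compatible_lin (V E : ℕ → Tournament.{u})
    (src : ∀ n, (E n).carrier → (V n).carrier) (tgt : ∀ n, (E n).carrier → (V (n + 1)).carrier)
    (hsrc : ∀ n, WeakHom (src n) (E n).r (V n).r)
    (htgt : ∀ n, WeakHom (tgt n) (E n).r (V (n + 1)).r) (n : ℕ) :
    ∃ (a : ∀ i, Lin (V i)) (e : ∀ i, Lin (E i)), ∀ i < n,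
      WeakHom (src i) (e i).1 (a i).1 ∧ WeakHom (tgt i) (e i).1 (a (i + 1)).1 := by
  classical
  -- The relation between the ends carries the whole compatible family as an existential, so that
  -- `Meet.trans` extends it step by step. Beyond the current stage the family has arbitrary values.
  have key : ∀ n, Meet (V 0) (V n) fun _ c => ∃ (a : ∀ i, Lin (V i)) (e : ∀ i, Lin (E i)),
      a n = c ∧ ∀ i < n,
        WeakHom (src i) (e i).1 (a i).1 ∧ WeakHom (tgt i) (e i).1 (a (i + 1)).1 := by
    intro n
    induction n with
    | zero =>
      refine ⟨_, _, _, .refl _, .refl _, fun a c w _ _ => ?_⟩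
      exact ⟨Function.update (fun i => (nonempty_lin (V i)).some) 0 c,
        fun i => (nonempty_lin (E i)).some, by simp, by simp⟩
    | succ n ih =>
      refine ((ih.trans (hsrc n).meet.symm).trans (htgt n).meet).mono ?_
      rintro - c ⟨ε, ⟨b, ⟨a, e, rfl, h⟩, h1⟩, h2⟩
      refine ⟨Function.update a (n + 1) c, Function.update e n ε, by simp, fun i hi => ?_⟩
      rw [Function.update_of_ne hi.ne]
      rcases Nat.lt_succ_iff_lt_or_eq.1 hi with hi | rfl
      · rw [Function.update_of_ne hi.ne, Function.update_of_ne (by omega)]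
        exact h i hi
      · rw [Function.update_self, Function.update_self]
        exact ⟨h1, h2⟩
  obtain ⟨-, c, a, e, -, h⟩ := (key n).exists_rel
  exact ⟨a, e, h⟩

/-! ### From truth assignments to level orders and planar drawings -/

namespace LevelGraph

variable {V : Type u}

/-- An order on each level, given by positions, that independent edges between consecutive levels
preserve. -/
structure IsOrdering (G : LevelGraph V) (pos : V → ℕ) : Prop where
  pos_ne : ∀ u w, u ≠ w → G.level u = G.level w → pos u ≠ pos w
  pos_lt : ∀ u v w x, (u, v) ∈ G.edges → (w, x) ∈ G.edges → G.level u = G.level w → u ≠ w →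
    v ≠ x → pos u < pos w → pos v < pos x

theorem exists_isOrdering [Finite V] {G : LevelGraph V} (hG : G.IsProper)
    (h : G.ReducedSystemSatisfiable) : ∃ pos : V → ℕ, G.IsOrdering pos := by
  obtain ⟨φ, hφ, hφ'⟩ := h
  let ρ : V → V → Prop := fun u w => ∃ h : u ≠ w ∧ G.level u = G.level w, φ ⟨(u, w), h⟩ = true
  have ρne : ∀ u w, ρ u w → u ≠ w := fun u w h => h.1.1
  have ρasymm : ∀ u w, ρ u w → ¬ ρ w u := by
    rintro u w ⟨h, h1⟩ ⟨h', h2⟩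
    exact (hφ ⟨(u, w), h⟩).1 h1 h2
  have ρtotal : ∀ u w, u ≠ w → G.level u = G.level w → ρ u w ∨ ρ w u := by
    intro u w h h'
    by_cases h1 : φ ⟨(u, w), h, h'⟩ = true
    · exact Or.inl ⟨_, h1⟩
    · refine Or.inr ⟨⟨h.symm, h'.symm⟩, ?_⟩
      by_contra h2
      exact h1 ((hφ ⟨(u, w), h, h'⟩).2 h2)
  have ρedge : ∀ u v w x, (u, v) ∈ G.edges → (w, x) ∈ G.edges → G.level u = G.level w → u ≠ w →
      v ≠ x → (ρ u w ↔ ρ v x) := by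
    intro u v w x h1 h2 h3 h4 h5
    have l1 := hG u v h1
    have l2 := hG w x h2
    have h6 : G.level v = G.level x := by omega
    have key := hφ' ⟨(u, w), h4, h3⟩ ⟨(v, x), h5, h6⟩ h1 h2
      ⟨h4, fun e => by have : u = x := e; subst this; omega,
        fun e => by have : v = w := e; subst this; omega, h5⟩
    exact ⟨fun ⟨_, h⟩ => ⟨_, key.1 h⟩, fun ⟨_, h⟩ => ⟨_, key.2 h⟩⟩
  clear_value ρ
  let A : ℕ → Tournament.{u} := fun i =>
    { carrier := {v // G.level v = i}
      finite := inferInstance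
      r := fun u w => ρ u w
      isTournament := ⟨fun u w => ρasymm u w, fun u w h =>
        ρtotal u w (fun e => h (Subtype.ext e)) (u.2.trans w.2.symm)⟩ }
  -- The edges leaving level `i`, compared by source and then by target. This makes the source map a
  -- weak homomorphism, and `ρedge` does the same for the target map.
  let E : ℕ → Tournament.{u} := fun i =>
    { carrier := {e : V × V // e ∈ G.edges ∧ G.level e.1 = i}
      finite := inferInstance
      r := fun e f => ρ e.1.1 f.1.1 ∨ (e.1.1 = f.1.1 ∧ ρ e.1.2 f.1.2)
      isTournament := by
        constructor
        · rintro e f (h | ⟨h, h'⟩) (h1 | ⟨h1, h1'⟩)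
          exacts [ρasymm _ _ h h1, ρne _ _ h h1.symm, ρne _ _ h1 h.symm, ρasymm _ _ h' h1']
        · intro e f h
          by_cases h1 : e.1.1 = f.1.1
          · have h2 : e.1.2 ≠ f.1.2 := fun h2 => h (Subtype.ext (Prod.ext h1 h2))
            have l1 := hG _ _ e.2.1
            have l2 := hG _ _ f.2.1
            have l3 : G.level e.1.2 = G.level f.1.2 := by
              rw [← l1, ← l2, h1]
            exact (ρtotal _ _ h2 l3).imp (fun h3 => Or.inr ⟨h1, h3⟩)
              fun h3 => Or.inr ⟨h1.symm, h3⟩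
          · exact (ρtotal _ _ h1 (e.2.2.trans f.2.2.symm)).imp Or.inl Or.inl }
  obtain ⟨a, e, hae⟩ := exists_compatible_lin A E (fun i e => ⟨e.1.1, e.2.2⟩)
    (fun i e => ⟨e.1.2, by rw [← hG _ _ e.2.1, e.2.2]⟩)
    (fun i e f h => by
      have h1 : e.1.1 ≠ f.1.1 := fun h1 => h (Subtype.ext h1)
      exact ⟨fun h2 => h2.resolve_right fun h3 => h1 h3.1, Or.inl⟩)
    (fun i e f h => by
      have h1 : e.1.2 ≠ f.1.2 := fun h1 => h (Subtype.ext h1)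
      change ρ _ _ ∨ _ ↔ ρ _ _
      by_cases h2 : e.1.1 = f.1.1
      · exact ⟨fun h3 => (h3.resolve_left fun h4 => ρne _ _ h4 h2).2, fun h3 => Or.inr ⟨h2, h3⟩⟩
      · rw [← ρedge _ _ _ _ e.2.1 f.2.1 (e.2.2.trans f.2.2.symm) h2 h1]
        exact ⟨fun h3 => h3.resolve_right fun h4 => h2 h4.1, Or.inl⟩) (G.height + 1)
  let S : V → V → Prop := fun u w =>
    ∃ (i : ℕ) (hu : G.level u = i) (hw : G.level w = i), (a i).1 ⟨u, hu⟩ ⟨w, hw⟩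
  have Strans : ∀ u v w, S u v → S v w → S u w := by
    rintro u v w ⟨i, rfl, hv, h⟩ ⟨j, hv', hw, h'⟩
    have hj : j = G.level u := hv'.symm.trans hv
    subst hj
    exact ⟨_, rfl, hw, (a _).2.trans _ _ _ h h'⟩
  have Sirr : ∀ u, ¬ S u u := by
    rintro u ⟨i, h, _, h'⟩
    exact (a i).2.irrefl _ h'
  have Stot : ∀ u w, u ≠ w → G.level u = G.level w → S u w ∨ S w u := by
    intro u w h h'
    refine ((a _).2.total ⟨u, rfl⟩ ⟨w, h'.symm⟩ fun e => h (congrArg Subtype.val e)).imp ?_ ?_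
    · exact fun h1 => ⟨_, _, _, h1⟩
    · exact fun h1 => ⟨_, _, _, h1⟩
  -- The position of a vertex is its number of predecessors in the linear order of its level.
  have mono : ∀ u w, S u w → {v | S v u}.ncard < {v | S v w}.ncard := by
    intro u w h
    refine Set.ncard_lt_ncard ⟨fun v hv => Strans _ _ _ hv h, fun h' => ?_⟩ (Set.toFinite _)
    exact Sirr u (h' h)
  refine ⟨fun v => {w | S w v}.ncard, ?_, ?_⟩
  · intro u w h h'
    rcases Stot u w h h' with h1 | h1
    exacts [(mono _ _ h1).ne, (mono _ _ h1).ne']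
  · intro u v w x huv hwx hl huw hvx hlt
    apply mono
    have h1 : S u w := (Stot u w huw hl).resolve_right fun h1 => (mono _ _ h1).not_gt hlt
    obtain ⟨i, hu, hw, h1⟩ := h1
    have hi : i < G.height + 1 := by
      have := (G.level_mem u).2
      omega
    have h2 := (hae i hi).1 ⟨(u, v), huv, hu⟩ ⟨(w, x), hwx, hw⟩
      fun e => huw (congrArg Subtype.val e)
    have h3 := (hae i hi).2 ⟨(u, v), huv, hu⟩ ⟨(w, x), hwx, hw⟩
      fun e => hvx (congrArg Subtype.val e)
    exact ⟨_, _, _, h3.1 (h2.2 h1)⟩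

/-- Disjoint curves yield a planar drawing. -/
theorem isLevelPlanar_of_curves {G : LevelGraph V} (pos : V → ℝ) (curve : G.edges → ℝ → ℝ)
    (h1 : ∀ e : G.edges, ContinuousOn (curve e) (Icc (G.level e.1.1 : ℝ) (G.level e.1.2)))
    (h2 : ∀ e : G.edges, curve e (G.level e.1.1) = pos e.1.1)
    (h3 : ∀ e : G.edges, curve e (G.level e.1.2) = pos e.1.2)
    (h4 : ∀ u v, u ≠ v → G.level u = G.level v → pos u ≠ pos v)
    (h5 : ∀ (e : G.edges) (v : V), (G.level v : ℝ) ∈ G.span e → curve e (G.level v) ≠ pos v)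
    (h6 : ∀ e f : G.edges, e ≠ f → ∀ t ∈ G.span e ∩ G.span f, curve e t ≠ curve f t) :
    G.IsLevelPlanar := by
  refine ⟨⟨pos, curve, h1, h2, h3, h4, h5, ?_, ?_⟩, h6⟩
  · intro e f hef
    convert Set.finite_empty
    rw [Set.eq_empty_iff_forall_notMem]
    exact fun t ht => h6 e f hef t ht.1 ht.2
  · exact fun e f g hef _ _ t ht h => h6 e f hef t ht.1 h.1

/-- Straight segments work: two edges between the same levels are weakly ordered alike at both ends
and strictly at one of them, so they do not meet in between. -/
theorem IsOrdering.isLevelPlanar {G : LevelGraph V} (hG : G.IsProper) {pos : V → ℕ}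
    (h : G.IsOrdering pos) : G.IsLevelPlanar := by
  have span_eq : ∀ e : G.edges, G.span e = Ioo (G.level e.1.1 : ℝ) (G.level e.1.1 + 1) := by
    intro e
    rw [span, ← hG _ _ e.2]
    push_cast
    rfl
  refine isLevelPlanar_of_curves (fun v => (pos v : ℝ))
    (fun e t => (pos e.1.1 : ℝ) + (t - G.level e.1.1) * ((pos e.1.2 : ℝ) - pos e.1.1))
    (fun e => by fun_prop) (fun e => by simp) (fun e => ?_) ?_ ?_ ?_
  · simp only [← hG _ _ e.2]
    push_cast
    ring
  · intro u v huv hl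
    exact_mod_cast h.pos_ne u v huv hl
  · intro e v hv
    rw [span_eq, mem_Ioo] at hv
    have h1 : G.level e.1.1 < G.level v := by exact_mod_cast hv.1
    have h2 : G.level v < G.level e.1.1 + 1 := by exact_mod_cast hv.2
    omega
  · rintro ⟨⟨u, v⟩, he⟩ ⟨⟨w, x⟩, hf⟩ hne t ⟨ht1, ht2⟩
    rw [span_eq, mem_Ioo] at ht1 ht2
    simp only at ht1 ht2 ⊢
    have hl : G.level u = G.level w := by
      have h1 : G.level u < G.level w + 1 := by exact_mod_cast ht1.1.trans ht2.2
      have h2 : G.level w < G.level u + 1 := by exact_mod_cast ht2.1.trans ht1.2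
      omega
    have hl' : G.level v = G.level x := by
      rw [← hG _ _ he, ← hG _ _ hf, hl]
    rw [← hl]
    have s0 : 0 < t - G.level u := by linarith [ht1.1]
    have s1 : t - G.level u < 1 := by linarith [ht1.2]
    generalize t - (G.level u : ℝ) = s at s0 s1
    by_cases huw : u = w
    · have hvx : v ≠ x := fun e => hne (by subst huw e; rfl)
      have := h.pos_ne v x hvx hl'
      subst huw
      intro e
      have h1 : s * ((pos v : ℝ) - pos x) = 0 := by linarith
      rcases mul_eq_zero.1 h1 with h2 | h2
      · exact s0.ne' h2
      · exact this (by exact_mod_cast sub_eq_zero.1 h2)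
    by_cases hvx : v = x
    · have := h.pos_ne u w huw hl
      subst hvx
      intro e
      have h1 : (1 - s) * ((pos u : ℝ) - pos w) = 0 := by linarith
      rcases mul_eq_zero.1 h1 with h2 | h2
      · linarith
      · exact this (by exact_mod_cast sub_eq_zero.1 h2)
    have key : ∀ a b c d : ℝ, a < c → b < d → a + s * (b - a) ≠ c + s * (d - c) := by
      intro a b c d h1 h2
      have h3 : 0 < s * (d - b) := mul_pos s0 (by linarith)
      have h4 : 0 < (1 - s) * (c - a) := mul_pos (by linarith) (by linarith)
      intro e
      linarith
    rcases lt_or_gt_of_ne (h.pos_ne u w huw hl) with h1 | h1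
    · exact key _ _ _ _ (by exact_mod_cast h1)
        (by exact_mod_cast h.pos_lt u v w x he hf hl huw hvx h1)
    · exact (key _ _ _ _ (by exact_mod_cast h1)
        (by exact_mod_cast h.pos_lt w x u v hf he hl.symm (Ne.symm huw) (Ne.symm hvx) h1)).symm

end LevelGraph

/-! ### Parity of crossings -/

theorem pos_iff_pos_of_ne_zero {h : ℝ → ℝ} {a b : ℝ} (hab : a ≤ b)
    (hc : ContinuousOn h (Icc a b)) (h0 : ∀ t ∈ Icc a b, h t ≠ 0) : 0 < h a ↔ 0 < h b := by
  constructor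
  · intro ha
    by_contra hb
    obtain ⟨t, ht, h'⟩ := intermediate_value_Icc' hab hc ⟨not_lt.1 hb, ha.le⟩
    exact h0 t ht h'
  · intro hb
    by_contra ha
    obtain ⟨t, ht, h'⟩ := intermediate_value_Icc hab hc ⟨not_lt.1 ha, hb.le⟩
    exact h0 t ht h'

/-- The points of an open interval at which a function changes its sign. -/
def signChanges (h : ℝ → ℝ) (a b : ℝ) : Set ℝ :=
  {t | t ∈ Ioo a b ∧ h t = 0 ∧
    (((∀ᶠ s in 𝓝[<] t, h s < 0) ∧ ∀ᶠ s in 𝓝[>] t, 0 < h s) ∨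
      ((∀ᶠ s in 𝓝[<] t, 0 < h s) ∧ ∀ᶠ s in 𝓝[>] t, h s < 0))}

/-- A continuous function with finitely many zeros has the same sign at both ends of an interval
if and only if it changes its sign an even number of times. -/
theorem pos_iff_pos_iff_even_signChanges {h : ℝ → ℝ} {a b : ℝ} (hab : a ≤ b)
    (hc : ContinuousOn h (Icc a b)) (ha : h a ≠ 0) (hb : h b ≠ 0)
    (hfin : {t | t ∈ Ioo a b ∧ h t = 0}.Finite) :
    (0 < h a ↔ 0 < h b) ↔ Even (signChanges h a b).ncard := by
  by_cases hZ : {t | t ∈ Ioo a b ∧ h t = 0} = ∅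
  · have h1 : signChanges h a b = ∅ :=
      Set.eq_empty_iff_forall_notMem.2 fun t ht =>
        (Set.eq_empty_iff_forall_notMem.1 hZ) t ⟨ht.1, ht.2.1⟩
    rw [h1, Set.ncard_empty]
    refine iff_of_true (pos_iff_pos_of_ne_zero hab hc fun t ht h0 => ?_) ⟨0, rfl⟩
    rcases ht.1.eq_or_lt with rfl | h2
    · exact ha h0
    rcases ht.2.eq_or_lt with rfl | h3
    · exact hb h0
    exact (Set.eq_empty_iff_forall_notMem.1 hZ) t ⟨⟨h2, h3⟩, h0⟩
  -- Induction on the number of zeros: cut off the last zero `z` at a point `c` between it and `m`,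
  -- the previous zero, or `a` if there is none.
  obtain ⟨z, ⟨⟨haz, hzb⟩, hz⟩, hmax⟩ := Set.exists_max_image _ id hfin
    (Set.nonempty_iff_ne_empty.2 hZ)
  simp only [id] at hmax
  have right : ∀ t, z < t → t ≤ b → h t ≠ 0 := by
    intro t h1 h2 h0
    rcases h2.eq_or_lt with rfl | h2
    · exact hb h0
    exact (hmax t ⟨⟨haz.trans h1, h2⟩, h0⟩).not_gt h1
  obtain ⟨m, hm, hm'⟩ := Set.exists_max_image
    (insert a ({t | t ∈ Ioo a b ∧ h t = 0} \ {z})) id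
    ((hfin.subset sdiff_subset).insert a) ⟨a, mem_insert _ _⟩
  simp only [id] at hm'
  have ham : a ≤ m := hm' a (mem_insert _ _)
  have hmz : m < z := by
    rcases hm with rfl | ⟨h1, h2⟩
    · exact haz
    · exact (hmax m h1).lt_of_ne h2
  obtain ⟨c, hmc, hcz⟩ := exists_between hmz
  have hac : a < c := ham.trans_lt hmc
  have hcb : c < b := hcz.trans hzb
  have left : ∀ t, c ≤ t → t < z → h t ≠ 0 := by
    intro t h1 h2 h0
    exact (hm' t (Or.inr ⟨⟨⟨hac.trans_le h1, h2.trans hzb⟩, h0⟩, h2.ne⟩)).not_gt (hmc.trans_le h1)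
  have hc0 : h c ≠ 0 := left c le_rfl hcz
  have hsub : {t | t ∈ Ioo a c ∧ h t = 0} ⊂ {t | t ∈ Ioo a b ∧ h t = 0} := by
    refine ⟨fun t ht => ⟨⟨ht.1.1, ht.1.2.trans hcb⟩, ht.2⟩, fun hs => ?_⟩
    exact (hs ⟨⟨haz, hzb⟩, hz⟩).1.2.not_gt hcz
  have hcard := Set.ncard_lt_ncard hsub hfin
  have ih := pos_iff_pos_iff_even_signChanges hac.le
    (hc.mono (Icc_subset_Icc le_rfl hcb.le)) ha hc0 (hfin.subset hsub.1)
  have signL : ∀ t, c ≤ t → t < z → (0 < h c ↔ 0 < h t) := fun t h1 h2 =>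
    pos_iff_pos_of_ne_zero h1 (hc.mono (Icc_subset_Icc hac.le (h2.trans hzb).le))
      fun s hs => left s hs.1 (hs.2.trans_lt h2)
  have signR : ∀ t, z < t → t ≤ b → (0 < h t ↔ 0 < h b) := fun t h1 h2 =>
    pos_iff_pos_of_ne_zero h2 (hc.mono (Icc_subset_Icc (haz.trans h1).le le_rfl))
      fun s hs => right s (h1.trans_le hs.1) hs.2
  have evL : ∀ᶠ s in 𝓝[<] z, c ≤ s ∧ s < z := by
    filter_upwards [Ioo_mem_nhdsLT hcz] with s hs using ⟨hs.1.le, hs.2⟩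
  have evR : ∀ᶠ s in 𝓝[>] z, z < s ∧ s ≤ b := by
    filter_upwards [Ioo_mem_nhdsGT hzb] with s hs using ⟨hs.1, hs.2.le⟩
  have fin' : (signChanges h a c).Finite := (hfin.subset hsub.1).subset fun t ht => ⟨ht.1, ht.2.1⟩
  -- The sign is constant on `[c, z)` and on `(z, b]`.
  have zmem : z ∈ signChanges h a b ↔ ¬ (0 < h c ↔ 0 < h b) := by
    constructor
    · rintro ⟨-, -, ⟨h1, h2⟩ | ⟨h1, h2⟩⟩ hiff
      · obtain ⟨s, hs, hs1, hs2⟩ := (h1.and evL).exists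
        obtain ⟨t, ht, ht1, ht2⟩ := (h2.and evR).exists
        exact hs.not_gt ((signL s hs1 hs2).1 (hiff.2 ((signR t ht1 ht2).1 ht)))
      · obtain ⟨s, hs, hs1, hs2⟩ := (h1.and evL).exists
        obtain ⟨t, ht, ht1, ht2⟩ := (h2.and evR).exists
        exact ht.not_gt ((signR t ht1 ht2).2 (hiff.1 ((signL s hs1 hs2).2 hs)))
    · intro hiff
      refine ⟨⟨haz, hzb⟩, hz, ?_⟩
      by_cases h1 : 0 < h c
      · refine Or.inr ⟨evL.mono fun s hs => (signL s hs.1 hs.2).1 h1, evR.mono fun t ht => ?_⟩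
        refine (not_lt.1 fun h2 => hiff ?_).lt_of_ne (right t ht.1 ht.2)
        exact iff_of_true h1 ((signR t ht.1 ht.2).1 h2)
      · have h2 : 0 < h b := by
          by_contra h2
          exact hiff (iff_of_false h1 h2)
        refine Or.inl ⟨evL.mono fun s hs => ?_, evR.mono fun t ht => (signR t ht.1 ht.2).2 h2⟩
        exact (not_lt.1 fun h3 => h1 ((signL s hs.1 hs.2).2 h3)).lt_of_ne (left s hs.1 hs.2)
  have hrest : ∀ t, t ≠ z → (t ∈ signChanges h a b ↔ t ∈ signChanges h a c) := by
    intro t htz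
    constructor
    · rintro ⟨⟨h1, h2⟩, h3, h4⟩
      have h5 : t < c := by
        by_contra h5
        rcases lt_or_gt_of_ne htz with h6 | h6
        · exact left t (not_lt.1 h5) h6 h3
        · exact right t h6 h2.le h3
      exact ⟨⟨h1, h5⟩, h3, h4⟩
    · rintro ⟨⟨h1, h2⟩, h3, h4⟩
      exact ⟨⟨h1, h2.trans hcb⟩, h3, h4⟩
  have znot : z ∉ signChanges h a c := fun h1 => h1.1.2.not_gt hcz
  by_cases hz' : z ∈ signChanges h a b
  · have h1 : signChanges h a b = insert z (signChanges h a c) := by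
      ext t
      by_cases e : t = z
      · simp [e, hz']
      · simp [e, hrest t e]
    rw [h1, Set.ncard_insert_of_notMem znot fin', Nat.even_add_one, ← ih]
    have := zmem.1 hz'
    tauto
  · have h1 : signChanges h a b = signChanges h a c := by
      ext t
      by_cases e : t = z
      · simp [e, hz', znot]
      · exact hrest t e
    rw [h1, ← ih]
    have := zmem.not.1 hz'
    tauto
termination_by {t | t ∈ Ioo a b ∧ h t = 0}.ncard

namespace LevelGraph

variable {V : Type u} {G : LevelGraph V}

/-- Two edges that cross an even number of times have the same order at both ends of their common
range of heights. -/
theorem Drawing.lt_iff_lt_of_even (Γ : G.Drawing) {e f : G.edges} (hef : e ≠ f)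
    (heven : Even (Γ.crossings e f).ncard) {a b : ℝ} (hab : a < b)
    (ha : max (G.level e.1.1 : ℝ) (G.level f.1.1) = a)
    (hb : min (G.level e.1.2 : ℝ) (G.level f.1.2) = b)
    (hea : Γ.curve e a ≠ Γ.curve f a) (heb : Γ.curve e b ≠ Γ.curve f b) :
    Γ.curve e a < Γ.curve f a ↔ Γ.curve e b < Γ.curve f b := by
  have hspan : G.span e ∩ G.span f = Ioo a b := by
    rw [span, span, Ioo_inter_Ioo]
    rw [ha, hb]
  have hcr : Γ.crossings e f = signChanges (fun t => Γ.curve f t - Γ.curve e t) a b := by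
    ext t
    simp only [crossings, signChanges, hspan, mem_ofPred_eq, sub_pos, sub_neg, sub_eq_zero]
    rw [eq_comm (a := Γ.curve e t), or_comm]
  have h1 := pos_iff_pos_iff_even_signChanges (h := fun t => Γ.curve f t - Γ.curve e t) hab.le
    (((Γ.continuousOn_curve f).mono (Icc_subset_Icc (ha ▸ le_max_right _ _)
      (hb ▸ min_le_right _ _))).sub ((Γ.continuousOn_curve e).mono
        (Icc_subset_Icc (ha ▸ le_max_left _ _) (hb ▸ min_le_left _ _))))
    (sub_ne_zero.2 hea.symm) (sub_ne_zero.2 heb.symm)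
    ((Γ.finite_meet e f hef).subset fun t ht => ⟨hspan ▸ ht.1, (sub_eq_zero.1 ht.2).symm⟩)
  rw [← hcr] at h1
  simpa only [sub_pos] using h1.2 heven

theorem Drawing.IsPlanar.isHananiTutte {Γ : G.Drawing} (h : Γ.IsPlanar) : Γ.IsHananiTutte := by
  intro e f hef
  have : Γ.crossings e f = ∅ := Set.eq_empty_iff_forall_notMem.2 fun t ht =>
    h e f (fun e' => hef.1 (by rw [e'])) t ht.1 ht.2.1
  rw [this, Set.ncard_empty]
  exact ⟨0, rfl⟩

theorem IsLevelPlanar.reducedSystemSatisfiable (hG : G.IsProper) (h : G.IsLevelPlanar) :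
    G.ReducedSystemSatisfiable := by
  classical
  obtain ⟨Γ, hΓ⟩ := h
  refine ⟨fun p => decide (Γ.pos p.1.1 < Γ.pos p.1.2), ?_, ?_⟩
  · intro p
    have := Γ.pos_ne _ _ p.2.1 p.2.2
    change decide (_ < _) = true ↔ ¬ decide (Γ.pos p.1.2 < Γ.pos p.1.1) = true
    rw [decide_eq_true_iff, decide_eq_true_iff, not_lt]
    exact ⟨le_of_lt, fun h => h.lt_of_ne this⟩
  · intro p q h1 h2 hind
    simp only [decide_eq_true_eq]
    have l1 := hG _ _ h1
    have l2 := hG _ _ h2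
    have lp := p.2.2
    have lq := q.2.2
    let e : G.edges := ⟨_, h1⟩
    let f : G.edges := ⟨_, h2⟩
    have s1 : Γ.curve e (G.level p.1.1) = Γ.pos p.1.1 := Γ.curve_source e
    have s2 : Γ.curve f (G.level p.1.1) = Γ.pos p.1.2 := lp ▸ Γ.curve_source f
    have t1 : Γ.curve e (G.level q.1.1) = Γ.pos q.1.1 := Γ.curve_target e
    have t2 : Γ.curve f (G.level q.1.1) = Γ.pos q.1.2 := lq ▸ Γ.curve_target f
    have hef : e ≠ f := fun h => hind.1 (congrArg (fun e : G.edges => e.1.1) h)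
    rw [← s1, ← s2, ← t1, ← t2]
    refine Γ.lt_iff_lt_of_even hef (hΓ.isHananiTutte e f hind) ?_ ?_ ?_ ?_ ?_
    · exact_mod_cast (by omega : G.level p.1.1 < G.level q.1.1)
    · change max (G.level p.1.1 : ℝ) (G.level p.1.2) = _
      rw [← lp, max_self]
    · change min (G.level q.1.1 : ℝ) (G.level q.1.2) = _
      rw [← lq, min_self]
    · rw [s1, s2]
      exact Γ.pos_ne _ _ p.2.1 lp
    · rw [t1, t2]
      exact Γ.pos_ne _ _ q.2.1 lq

end LevelGraph

/-! ### From Hanani–Tutte drawings of the star form to truth assignments -/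

namespace LevelGraph

variable {V : Type u} {G : LevelGraph V}

theorem Drawing.curve_ne_at_source (Γ : G.Drawing) {e f : G.edges}
    (h : G.level e.1.1 < G.level f.1.1) (h' : G.level f.1.1 < G.level e.1.2) :
    Γ.curve e (G.level f.1.1) ≠ Γ.curve f (G.level f.1.1) := by
  rw [Γ.curve_source]
  exact Γ.curve_ne_pos _ _ ⟨by exact_mod_cast h, by exact_mod_cast h'⟩

theorem Drawing.curve_ne_at_target (Γ : G.Drawing) {e f : G.edges}
    (h : G.level e.1.1 < G.level f.1.2) (h' : G.level f.1.2 < G.level e.1.2) :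
    Γ.curve e (G.level f.1.2) ≠ Γ.curve f (G.level f.1.2) := by
  rw [Γ.curve_target]
  exact Γ.curve_ne_pos _ _ ⟨by exact_mod_cast h, by exact_mod_cast h'⟩

/-- In a Hanani-Tutte drawing, independent edges without endpoints on a common level do not change
their order along the common range of heights. -/
theorem Drawing.IsHananiTutte.lt_iff_lt {Γ : G.Drawing} (hΓ : Γ.IsHananiTutte) {e f : G.edges}
    (hind : IndependentPairs e.1 f.1) {a b : ℕ} (hab : a < b)
    (ha : max (G.level e.1.1) (G.level f.1.1) = a) (hb : min (G.level e.1.2) (G.level f.1.2) = b)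
    (h1 : G.level e.1.1 ≠ G.level f.1.1) (h2 : G.level e.1.2 ≠ G.level f.1.2) :
    (Γ.curve e a < Γ.curve f a ↔ Γ.curve e b < Γ.curve f b) ∧
      (Γ.curve f a < Γ.curve e a ↔ Γ.curve f b < Γ.curve e b) := by
  have ea : Γ.curve e a ≠ Γ.curve f a := by
    rcases lt_or_gt_of_ne h1 with h | h
    · rw [max_eq_right h.le] at ha
      subst ha
      exact Γ.curve_ne_at_source h (by omega)
    · rw [max_eq_left h.le] at ha
      subst ha
      exact (Γ.curve_ne_at_source h (by omega)).symm
  have eb : Γ.curve e b ≠ Γ.curve f b := by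
    rcases lt_or_gt_of_ne h2 with h | h
    · rw [min_eq_left h.le] at hb
      subst hb
      exact (Γ.curve_ne_at_target (by omega) h).symm
    · rw [min_eq_right h.le] at hb
      subst hb
      exact Γ.curve_ne_at_target (by omega) h
  have key := Γ.lt_iff_lt_of_even (fun h => hind.1 (by rw [h])) (hΓ e f hind)
    (a := a) (b := b) (by exact_mod_cast hab) (by exact_mod_cast ha) (by exact_mod_cast hb) ea eb
  refine ⟨key, ?_⟩
  rw [← not_le, ← not_le, ea.le_iff_lt, eb.le_iff_lt, key]

theorem Numbering.idx_ne (ν : G.Numbering) {u w : V} (h : u ≠ w) (hl : G.level u = G.level w) :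
    ν.idx u ≠ ν.idx w := fun e => h ((ν.bijOn (G.level w)).injOn hl rfl e)

variable [Finite V] {ν : G.Numbering}

/-- The edge of the star form that replaces a vertex. -/
def stretchEdge (ν : G.Numbering) (u : V) : (G.star ν).edges :=
  ⟨(.bot u, .top u), Or.inl ⟨u, rfl⟩⟩

/-- The edge of the star form that replaces an edge. -/
def starEdge (ν : G.Numbering) {u v : V} (h : (u, v) ∈ G.edges) : (G.star ν).edges :=
  ⟨(.top u, .bot v), Or.inr ⟨u, v, h, rfl⟩⟩

theorem star_level_bot (ν : G.Numbering) (u : V) :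
    (G.star ν).level (.bot u) = 2 * G.cardBelow (G.level u) + ν.idx u := rfl

theorem star_level_top (ν : G.Numbering) (u : V) : (G.star ν).level (.top u) =
    2 * G.cardBelow (G.level u) + (G.levelCard (G.level u) + ν.idx u) := rfl

section Chain

variable {Γ : (G.star ν).Drawing} {u v w x : V}

theorem star_curve_bot (Γ : (G.star ν).Drawing) (huv : (u, v) ∈ G.edges) :
    Γ.curve (starEdge ν huv) ((G.star ν).level (.bot v)) =
      Γ.curve (stretchEdge ν v) ((G.star ν).level (.bot v)) :=
  (Γ.curve_target (starEdge ν huv)).trans (Γ.curve_source (stretchEdge ν v)).symm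

theorem star_curve_top (Γ : (G.star ν).Drawing) (huv : (u, v) ∈ G.edges) :
    Γ.curve (starEdge ν huv) ((G.star ν).level (.top u)) =
      Γ.curve (stretchEdge ν u) ((G.star ν).level (.top u)) :=
  (Γ.curve_source (starEdge ν huv)).trans (Γ.curve_target (stretchEdge ν u)).symm

/-- The heights satisfy `w' < u'' < w''`. The two stretch edges are compared up to `u''`; from there
`(u'', v')` takes over and is compared with the stretch edge of `w` up to `w''`. -/
theorem Drawing.IsHananiTutte.order_bottom (hΓ : Γ.IsHananiTutte) (hG : G.IsProper)
    (huv : (u, v) ∈ G.edges) (hwx : (w, x) ∈ G.edges) (hl : G.level u = G.level w)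
    (hi : ν.idx u < ν.idx w) (t : ℕ) (ht : (G.star ν).level (.top w) = t) :
    (Γ.curve (stretchEdge ν u) ((G.star ν).level (.bot w)) <
        Γ.curve (stretchEdge ν w) ((G.star ν).level (.bot w)) ↔
      Γ.curve (starEdge ν huv) t < Γ.curve (starEdge ν hwx) t) ∧
    (Γ.curve (stretchEdge ν w) ((G.star ν).level (.bot w)) <
        Γ.curve (stretchEdge ν u) ((G.star ν).level (.bot w)) ↔
      Γ.curve (starEdge ν hwx) t < Γ.curve (starEdge ν huv) t) := by
  have huw : u ≠ w := fun e => hi.ne (by rw [e])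
  have luv := hG u v huv
  have hvw : v ≠ w := fun e => by subst e; omega
  have hb := G.cardBelow_add_levelCard_le (G.level_lt u v huv)
  have iu := ν.idx_mem u
  have iw := ν.idx_mem w
  have iv := ν.idx_mem v
  have b1 := star_level_bot ν u
  have b2 := star_level_bot ν w
  have b3 := star_level_bot ν v
  have t1 := star_level_top ν u
  have t2 := star_level_top ν w
  rw [← hl] at b2 t2 iw
  have h1 := hΓ.lt_iff_lt (e := stretchEdge ν u) (f := stretchEdge ν w)
    (a := (G.star ν).level (.bot w)) (b := (G.star ν).level (.top u))
    ⟨by simp [stretchEdge, huw], by simp [stretchEdge], by simp [stretchEdge],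
      by simp [stretchEdge, huw]⟩
    (by omega) (by simp only [stretchEdge]; omega) (by simp only [stretchEdge]; omega)
    (by simp only [stretchEdge]; omega) (by simp only [stretchEdge]; omega)
  have h2 := hΓ.lt_iff_lt (e := starEdge ν huv) (f := stretchEdge ν w)
    (a := (G.star ν).level (.top u)) (b := (G.star ν).level (.top w))
    ⟨by simp [stretchEdge, starEdge], by simp [stretchEdge, starEdge, huw],
      by simp [stretchEdge, starEdge, hvw], by simp [stretchEdge, starEdge]⟩
    (by omega) (by simp only [stretchEdge, starEdge]; omega)
    (by simp only [stretchEdge, starEdge]; omega)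
    (by simp only [stretchEdge, starEdge]; omega) (by simp only [stretchEdge, starEdge]; omega)
  rw [star_curve_top Γ huv, ← star_curve_top Γ hwx] at h2
  subst ht
  exact ⟨h1.1.trans h2.1, h1.2.trans h2.2⟩

/-- The last link: `v'` is the lower of `v'` and `x'`, and from there the stretch edge of `v` is
compared with `(w'', x')` up to `x'`. -/
theorem Drawing.IsHananiTutte.order_top (hΓ : Γ.IsHananiTutte) (hG : G.IsProper)
    (huv : (u, v) ∈ G.edges) (hwx : (w, x) ∈ G.edges) (hl : G.level v = G.level x)
    (hi : ν.idx v < ν.idx x) (t : ℕ) (ht : (G.star ν).level (.bot v) = t) :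
    (Γ.curve (stretchEdge ν v) ((G.star ν).level (.bot x)) <
        Γ.curve (stretchEdge ν x) ((G.star ν).level (.bot x)) ↔
      Γ.curve (starEdge ν huv) t < Γ.curve (starEdge ν hwx) t) ∧
    (Γ.curve (stretchEdge ν x) ((G.star ν).level (.bot x)) <
        Γ.curve (stretchEdge ν v) ((G.star ν).level (.bot x)) ↔
      Γ.curve (starEdge ν hwx) t < Γ.curve (starEdge ν huv) t) := by
  have hvx : v ≠ x := fun e => hi.ne (by rw [e])
  have lwx := hG w x hwx
  have hvw : v ≠ w := fun e => by subst e; omega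
  have hb := G.cardBelow_add_levelCard_le (G.level_lt w x hwx)
  have iv := ν.idx_mem v
  have iw := ν.idx_mem w
  have ix := ν.idx_mem x
  have b1 := star_level_bot ν v
  have b2 := star_level_bot ν x
  have t1 := star_level_top ν v
  have t2 := star_level_top ν w
  rw [← hl] at b2 ix hb
  have h1 := hΓ.lt_iff_lt (e := stretchEdge ν v) (f := starEdge ν hwx)
    (a := (G.star ν).level (.bot v)) (b := (G.star ν).level (.bot x))
    ⟨by simp [stretchEdge, starEdge], by simp [stretchEdge, starEdge, hvx],
      by simp [stretchEdge, starEdge, hvw], by simp [stretchEdge, starEdge]⟩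
    (by omega) (by simp only [stretchEdge, starEdge]; omega)
    (by simp only [stretchEdge, starEdge]; omega)
    (by simp only [stretchEdge, starEdge]; omega) (by simp only [stretchEdge, starEdge]; omega)
  rw [← star_curve_bot Γ huv, star_curve_bot Γ hwx] at h1
  subst ht
  exact ⟨h1.1.symm, h1.2.symm⟩

end Chain

theorem HasHananiTutteDrawing.reducedSystemSatisfiable (hG : G.IsProper)
    (h : (G.star ν).HasHananiTutteDrawing) : G.ReducedSystemSatisfiable := by
  classical
  obtain ⟨Γ, hΓ⟩ := h
  -- The lowest height at which both stretch edges are present; their order there is the truth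
  -- value.
  let hgt : V → V → ℕ := fun u w =>
    max ((G.star ν).level (.bot u)) ((G.star ν).level (.bot w))
  have hgt_symm : ∀ u w, hgt u w = hgt w u := fun u w => max_comm _ _
  have hgt_eq : ∀ u w, G.level u = G.level w → ν.idx u < ν.idx w →
      hgt u w = (G.star ν).level (.bot w) := by
    intro u w hl hi
    have b1 := star_level_bot ν u
    have b2 := star_level_bot ν w
    rw [← hl] at b2
    exact max_eq_right (by omega)
  let below : V → V → Prop := fun u w =>
    Γ.curve (stretchEdge ν u) (hgt u w) < Γ.curve (stretchEdge ν w) (hgt u w)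
  have ne : ∀ u w, u ≠ w → G.level u = G.level w →
      Γ.curve (stretchEdge ν u) (hgt u w) ≠ Γ.curve (stretchEdge ν w) (hgt u w) := by
    have half : ∀ u w, G.level u = G.level w → ν.idx u < ν.idx w →
        Γ.curve (stretchEdge ν u) (hgt u w) ≠ Γ.curve (stretchEdge ν w) (hgt u w) := by
      intro u w hl hi
      rw [hgt_eq u w hl hi]
      have b1 := star_level_bot ν u
      have b2 := star_level_bot ν w
      have t1 := star_level_top ν u
      have iw := ν.idx_mem w
      have iu := ν.idx_mem u
      rw [← hl] at b2 iw
      exact Γ.curve_ne_at_source (e := stretchEdge ν u) (f := stretchEdge ν w)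
        (by simp only [stretchEdge]; omega) (by simp only [stretchEdge]; omega)
    intro u w h hl
    rcases lt_or_gt_of_ne (ν.idx_ne h hl) with h1 | h1
    · exact half u w hl h1
    · rw [hgt_symm]
      exact (half w u hl.symm h1).symm
  have main : ∀ u v w x, (huv : (u, v) ∈ G.edges) → (hwx : (w, x) ∈ G.edges) →
      G.level u = G.level w → ν.idx u < ν.idx w → v ≠ x →
      (below u w ↔ below v x) ∧ (below w u ↔ below x v) := by
    intro u v w x huv hwx hl hi hvx
    have luv := hG u v huv
    have lwx := hG w x hwx
    have hl' : G.level v = G.level x := by omega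
    have huw : u ≠ w := fun e => hi.ne (by rw [e])
    have hvw : v ≠ w := fun e => by subst e; omega
    have hux : u ≠ x := fun e => by subst e; omega
    have hb := G.cardBelow_add_levelCard_le (G.level_lt u v huv)
    have iu := ν.idx_mem u
    have iw := ν.idx_mem w
    have iv := ν.idx_mem v
    have ix := ν.idx_mem x
    have b1 := star_level_bot ν v
    have b2 := star_level_bot ν x
    have t1 := star_level_top ν u
    have t2 := star_level_top ν w
    have hivx := ν.idx_ne hvx hl'
    rw [← hl] at t2 iw
    rw [← hl'] at b2 ix
    -- Between the two end pieces, `(u'', v')` and `(w'', x')` are compared directly, from `w''` up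
    -- to the lower of `v'` and `x'`. The numbering may order `v`, `x` either way.
    obtain ⟨p1, p2⟩ := hΓ.order_bottom hG huv hwx hl hi _ rfl
    obtain ⟨q1, q2⟩ := hΓ.lt_iff_lt (e := starEdge ν huv) (f := starEdge ν hwx)
      (a := (G.star ν).level (.top w))
      (b := min ((G.star ν).level (.bot v)) ((G.star ν).level (.bot x)))
      ⟨by simp [starEdge, huw], by simp [starEdge], by simp [starEdge], by simp [starEdge, hvx]⟩
      (by omega) (by simp only [starEdge]; omega) rfl
      (by simp only [starEdge]; omega) (by simp only [starEdge]; omega)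
    simp only [below]
    rw [hgt_symm w u, hgt_symm x v, hgt_eq u w hl hi]
    rcases lt_or_gt_of_ne hivx with h | h
    · obtain ⟨r1, r2⟩ := hΓ.order_top hG huv hwx hl' h
        (min ((G.star ν).level (.bot v)) ((G.star ν).level (.bot x))) (by omega)
      rw [hgt_eq v x hl' h]
      exact ⟨p1.trans (q1.trans r1.symm), p2.trans (q2.trans r2.symm)⟩
    · obtain ⟨r1, r2⟩ := hΓ.order_top hG hwx huv hl'.symm h
        (min ((G.star ν).level (.bot v)) ((G.star ν).level (.bot x))) (by omega)
      rw [hgt_symm v x, hgt_eq x v hl'.symm h]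
      exact ⟨p1.trans (q1.trans r2.symm), p2.trans (q2.trans r1.symm)⟩
  refine ⟨fun p => decide (below p.1.1 p.1.2), ?_, ?_⟩
  · intro p
    change decide (_ < _) = true ↔ ¬ decide (below p.1.2 p.1.1) = true
    rw [decide_eq_true_iff, decide_eq_true_iff]
    simp only [below]
    rw [hgt_symm p.1.2, not_lt]
    exact ⟨le_of_lt, fun h => h.lt_of_ne (ne _ _ p.2.1 p.2.2)⟩
  · intro p q h1 h2 hind
    rw [decide_eq_true_iff, decide_eq_true_iff]
    rcases lt_or_gt_of_ne (ν.idx_ne p.2.1 p.2.2) with h | h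
    · exact (main _ _ _ _ h1 h2 p.2.2 h q.2.1).1
    · exact (main _ _ _ _ h2 h1 p.2.2.symm h q.2.1.symm).2

end LevelGraph

/-! ### Planar drawings of the star form -/

/-- A curve that starts at `p` at height `a`, is close to `p` below height `τ`, close to `q` above
height `τ + 1`, and ends at `q` at height `b`. -/
noncomputable def bendCurve (ε τ a b p q t : ℝ) : ℝ :=
  (1 - max 0 (min 1 (t - τ))) * (p + ε * (min t τ - a) * q) +
    max 0 (min 1 (t - τ)) * (q + ε * (b - max t (τ + 1)) * p)

theorem bendCurve_of_le {ε τ a b p q t : ℝ} (h : t ≤ τ) :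
    bendCurve ε τ a b p q t = p + ε * (t - a) * q := by
  have h1 : max 0 (min 1 (t - τ)) = 0 := max_eq_left ((min_le_right _ _).trans (by linarith))
  rw [bendCurve, h1, min_eq_left h]
  ring

theorem bendCurve_of_ge {ε τ a b p q t : ℝ} (h : τ + 1 ≤ t) :
    bendCurve ε τ a b p q t = q + ε * (b - t) * p := by
  have h1 : max 0 (min 1 (t - τ)) = 1 := by
    rw [min_eq_left (by linarith), max_eq_right zero_le_one]
  rw [bendCurve, h1, max_eq_left h]
  ring

theorem continuous_bendCurve (ε τ a b p q : ℝ) : Continuous (bendCurve ε τ a b p q) := by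
  unfold bendCurve
  fun_prop

/-- By `hK` the perturbations of the left-hand curve stay below 1, the gap between distinct
positions. Curves with a common end are fanned out by the position of their other end. In the strip
from `τ` to `τ + 1` both interpolation weights are positive, so one strict inequality suffices. -/
theorem bendCurve_lt {ε τ t K N : ℝ} (hε : 0 < ε) (hK : ε * N * K < 1)
    {a b p q a' b' p' q' : ℝ} (ha : 0 ≤ a) (hat : a < t) (haτ : a ≤ τ) (hbN : b ≤ N)
    (htb : t < b) (hbτ : τ + 1 ≤ b) (hp : 0 ≤ p) (hpK : p ≤ K) (hq : 0 ≤ q)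
    (hqK : q ≤ K) (hat' : a' < t) (haτ' : a' ≤ τ) (htb' : t < b') (hbτ' : τ + 1 ≤ b')
    (hp' : 0 ≤ p') (hq' : 0 ≤ q')
    (h1 : p + 1 ≤ p' ∨ (p = p' ∧ a = a')) (h2 : q + 1 ≤ q' ∨ (q = q' ∧ b = b'))
    (h3 : p + 1 ≤ p' ∨ q + 1 ≤ q') : bendCurve ε τ a b p q t < bendCurve ε τ a' b' p' q' t := by
  have small : ∀ d c, 0 ≤ d → d ≤ N → 0 ≤ c → c ≤ K → ε * d * c < 1 := by
    intro d c hd hdN hc hcK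
    refine lt_of_le_of_lt ?_ hK
    exact mul_le_mul (mul_le_mul_of_nonneg_left hdN hε.le) hcK hc
      (mul_nonneg hε.le (hd.trans hdN))
  have d1 : 0 ≤ min t τ - a := sub_nonneg.2 (le_min hat.le haτ)
  have d1' : 0 ≤ min t τ - a' := sub_nonneg.2 (le_min hat'.le haτ')
  have d2 : 0 ≤ b - max t (τ + 1) := sub_nonneg.2 (max_le htb.le hbτ)
  have d2' : 0 ≤ b' - max t (τ + 1) := sub_nonneg.2 (max_le htb'.le hbτ')
  have f1 := small _ q d1 (by linarith [min_le_left t τ]) hq hqK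
  have f2 := small _ p d2 (by linarith [le_max_right t (τ + 1)]) hp hpK
  have f1' : 0 ≤ ε * (min t τ - a') * q' := mul_nonneg (mul_nonneg hε.le d1') hq'
  have f2' : 0 ≤ ε * (b' - max t (τ + 1)) * p' := mul_nonneg (mul_nonneg hε.le d2') hp'
  have hqq : q ≤ q' := by rcases h2 with h | h <;> linarith
  have hpp : p ≤ p' := by rcases h1 with h | h <;> linarith
  have lo : p + ε * (min t τ - a) * q ≤ p' + ε * (min t τ - a') * q' := by
    rcases h1 with h | ⟨rfl, rfl⟩
    · linarith
    · have := mul_le_mul_of_nonneg_left hqq (mul_nonneg hε.le d1)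
      linarith
  have up : q + ε * (b - max t (τ + 1)) * p ≤ q' + ε * (b' - max t (τ + 1)) * p' := by
    rcases h2 with h | ⟨rfl, rfl⟩
    · linarith
    · have := mul_le_mul_of_nonneg_left hpp (mul_nonneg hε.le d2)
      linarith
  have s0 : 0 ≤ max 0 (min 1 (t - τ)) := le_max_left _ _
  have s1 : max 0 (min 1 (t - τ)) ≤ 1 := max_le zero_le_one (min_le_left _ _)
  by_cases ht : t ≤ τ
  · rw [bendCurve_of_le ht, bendCurve_of_le ht]
    rw [min_eq_left ht] at f1 f1'
    rcases h1 with h | ⟨rfl, rfl⟩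
    · linarith
    · have hlt : q < q' := by
        rcases h3 with h | h <;> linarith
      have := mul_lt_mul_of_pos_left hlt (mul_pos hε (sub_pos.2 hat))
      linarith
  by_cases ht' : τ + 1 ≤ t
  · rw [bendCurve_of_ge ht', bendCurve_of_ge ht']
    rw [max_eq_left ht'] at f2 f2'
    rcases h2 with h | ⟨rfl, rfl⟩
    · linarith
    · have hlt : p < p' := by
        rcases h3 with h | h <;> linarith
      have := mul_lt_mul_of_pos_left hlt (mul_pos hε (sub_pos.2 htb))
      linarith
  have s2 : max 0 (min 1 (t - τ)) = t - τ := by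
    rw [min_eq_right (by linarith), max_eq_right (by linarith)]
  unfold bendCurve
  rw [s2]
  have hs : 0 < t - τ := by linarith
  have hs' : 0 < 1 - (t - τ) := by linarith
  rcases h3 with h | h
  · exact add_lt_add_of_lt_of_le (mul_lt_mul_of_pos_left (by linarith) hs')
      (mul_le_mul_of_nonneg_left up hs.le)
  · exact add_lt_add_of_le_of_lt (mul_le_mul_of_nonneg_left lo hs'.le)
      (mul_lt_mul_of_pos_left (by linarith) hs)

theorem natCast_ne_add_of_lt_one {m n : ℕ} (h : m ≠ n) {x : ℝ} (h0 : 0 ≤ x) (h1 : x < 1) :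
    (m : ℝ) ≠ n + x := by
  intro e
  rcases lt_or_gt_of_ne h with h2 | h2
  · have h3 : (m : ℝ) < n := by exact_mod_cast h2
    linarith
  · have h3 : (n : ℝ) + 1 ≤ m := by exact_mod_cast h2
    linarith

namespace LevelGraph

variable {V : Type u} {G : LevelGraph V}

/-- The horizontal coordinates of the vertices of the star form. -/
def starPos (pos : V → ℕ) : StarVertex V → ℝ
  | .bot v => pos v
  | .top v => pos v

/-- The curves of the edges of the star form. -/
noncomputable def starCurve [Finite V] (ν : G.Numbering) (pos : V → ℕ) (ε : ℝ) :
    StarVertex V × StarVertex V → ℝ → ℝ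
  | (.bot v, _) => fun _ => pos v
  -- The bend starts at the last sublevel below the block of `v`; the strip of height one above it
  -- has no vertex in its interior.
  | (.top u, .bot v) => bendCurve ε ((2 * G.cardBelow (G.level v) : ℕ) : ℝ)
      ((G.star ν).level (.top u)) ((G.star ν).level (.bot v)) (pos u) (pos v)
  -- No edge of the star form has this shape.
  | (.top _, .top _) => fun _ => 0

theorem star_level_injective [Finite V] (ν : G.Numbering) :
    Function.Injective (G.star ν).level := by
  have lb := star_level_bot ν
  have lt' := star_level_top ν
  have idx := ν.idx_mem
  have range : ∀ y : StarVertex V, ∀ w, (y = .bot w ∨ y = .top w) →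
      2 * G.cardBelow (G.level w) < (G.star ν).level y ∧ (G.star ν).level y ≤
        2 * (G.cardBelow (G.level w) + G.levelCard (G.level w)) := by
    intro y w hw
    have := idx w
    rcases hw with rfl | rfl
    · rw [lb]
      omega
    · rw [lt']
      omega
  have same : ∀ y z : StarVertex V, ∀ u w, (y = .bot u ∨ y = .top u) → (z = .bot w ∨ z = .top w) →
      (G.star ν).level y = (G.star ν).level z → G.level u = G.level w := by
    intro y z u w hy hz h
    have h1 := range y u hy
    have h2 := range z w hz
    rcases lt_trichotomy (G.level u) (G.level w) with hl | hl | hl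
    · have := G.cardBelow_add_levelCard_le hl
      omega
    · exact hl
    · have := G.cardBelow_add_levelCard_le hl
      omega
  rintro (u | u) (w | w) h
  · have hl := same _ _ u w (Or.inl rfl) (Or.inl rfl) h
    rw [lb, lb, hl] at h
    exact congrArg _ ((ν.bijOn (G.level w)).injOn hl rfl (by omega))
  · have hl := same _ _ u w (Or.inl rfl) (Or.inr rfl) h
    have := idx u
    have := idx w
    rw [lb, lt', hl] at h
    have c1 := congrArg G.cardBelow hl
    have c2 := congrArg G.levelCard hl
    omega
  · have hl := same _ _ u w (Or.inr rfl) (Or.inl rfl) h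
    have := idx u
    have := idx w
    rw [lb, lt', hl] at h
    have c1 := congrArg G.cardBelow hl
    have c2 := congrArg G.levelCard hl
    omega
  · have hl := same _ _ u w (Or.inr rfl) (Or.inr rfl) h
    rw [lt', lt', hl] at h
    exact congrArg _ ((ν.bijOn (G.level w)).injOn hl rfl (by omega))

/-- Stretch edges are vertical at integer positions. An edge from `u''` to `v'` stays in the lane
`[pos u, pos u + 1)` through the block of `u`, changes lanes in the gap between the blocks, and then
stays in the lane of `v`. -/
theorem IsOrdering.star_isLevelPlanar [Finite V] (hG : G.IsProper) (ν : G.Numbering)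
    {pos : V → ℕ} (h : G.IsOrdering pos) : (G.star ν).IsLevelPlanar := by
  obtain ⟨K, hK⟩ : ∃ K : ℕ, ∀ v, pos v ≤ K := by
    obtain ⟨K, hK⟩ := (Set.finite_range pos).bddAbove
    exact ⟨K, fun v => hK ⟨v, rfl⟩⟩
  have hK' : ∀ v, (pos v : ℝ) ≤ K := fun v => by exact_mod_cast hK v
  obtain ⟨N, hN⟩ : ∃ N : ℕ, ∀ y, (G.star ν).level y ≤ N :=
    ⟨_, fun y => ((G.star ν).level_mem y).2⟩
  have hN' : ∀ y, ((G.star ν).level y : ℝ) ≤ N := fun y => by exact_mod_cast hN y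
  obtain ⟨ε, hε, hεK⟩ : ∃ ε : ℝ, 0 < ε ∧ ε * N * K < 1 := by
    have h0 : (0 : ℝ) < N * K + 1 := by positivity
    refine ⟨1 / (N * K + 1), by positivity, ?_⟩
    rw [mul_assoc, one_div, inv_mul_lt_iff₀ h0]
    linarith
  have frac : ∀ d v, 0 ≤ d → d ≤ (N : ℝ) → 0 ≤ ε * d * pos v ∧ ε * d * pos v < 1 := by
    intro d v hd hdN
    refine ⟨by positivity, lt_of_le_of_lt ?_ hεK⟩
    exact mul_le_mul (mul_le_mul_of_nonneg_left hdN hε.le) (hK' v) (by positivity)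
      (by positivity)
  have lt : ∀ {m n : ℕ} {t : ℝ}, (m : ℝ) < t → t < n → m < n := fun h1 h2 => by
    exact_mod_cast h1.trans h2
  have band : ∀ {u w : V}, G.level u < G.level w →
      G.cardBelow (G.level u) + G.levelCard (G.level u) ≤ G.cardBelow (G.level w) :=
    fun h => G.cardBelow_add_levelCard_le h
  have lb := star_level_bot ν
  have lt' := star_level_top ν
  have idx := ν.idx_mem
  have low : ∀ {u v : V} {t : ℝ}, ((G.star ν).level (.top u) : ℝ) < t →
      t ≤ ((2 * G.cardBelow (G.level v) : ℕ) : ℝ) → t ≤ N → ∀ w, pos w ≠ pos u →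
      starCurve ν pos ε (.top u, .bot v) t ≠ pos w := by
    intro u v t h1 h2 h3 w hw
    change bendCurve _ _ _ _ _ _ _ ≠ _
    rw [bendCurve_of_le h2]
    obtain ⟨f0, f1⟩ := frac (t - (G.star ν).level (.top u)) v (by linarith)
      (by have : (0 : ℝ) ≤ (G.star ν).level (.top u) := by positivity
          linarith)
    exact (natCast_ne_add_of_lt_one hw f0 f1).symm
  have high : ∀ {u v : V} {t : ℝ}, t < ((G.star ν).level (.bot v) : ℝ) →
      ((2 * G.cardBelow (G.level v) + 1 : ℕ) : ℝ) ≤ t → ∀ w, pos w ≠ pos v →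
      starCurve ν pos ε (.top u, .bot v) t ≠ pos w := by
    intro u v t h1 h2 w hw
    change bendCurve _ _ _ _ _ _ _ ≠ _
    have h0 : (0 : ℝ) ≤ t := le_trans (by positivity) h2
    rw [bendCurve_of_ge (by exact_mod_cast h2)]
    obtain ⟨f0, f1⟩ := frac ((G.star ν).level (.bot v) - t) u (by linarith)
      (by linarith [hN' (.bot v)])
    exact (natCast_ne_add_of_lt_one hw f0 f1).symm
  -- A stretch edge coexists with this edge only in the block of `u` or of `v`, and there the curve
  -- keeps to its lane.
  have mixed : ∀ {u v w : V} {t : ℝ}, (u, v) ∈ G.edges →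
      ((G.star ν).level (.top u) : ℝ) < t → t < ((G.star ν).level (.bot v) : ℝ) →
      ((G.star ν).level (.bot w) : ℝ) < t → t < ((G.star ν).level (.top w) : ℝ) →
      starCurve ν pos ε (.top u, .bot v) t ≠ pos w := by
    intro u v w t huv h1 h2 h3 h4
    have luv := hG u v huv
    have n1 := lt h1 h4
    have n2 := lt h3 h2
    rw [lb, lb] at n2
    rw [lt', lt'] at n1
    have b1 := band (G.level_lt u v huv)
    have := idx u
    have := idx v
    have := idx w
    rcases lt_trichotomy (G.level w) (G.level u) with hl | hl | hl
    · have := band hl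
      omega
    · refine low h1 (h4.le.trans ?_) (h4.le.trans (hN' _)) w ?_
      · rw [lt', hl]
        rw [hl] at this
        exact_mod_cast (by omega)
      · refine h.pos_ne w u (fun e => ?_) hl
        subst e
        exact lt_irrefl _ (lt h1 h4)
    · rcases eq_or_lt_of_le (show G.level v ≤ G.level w by omega) with hl' | hl'
      · refine high h2 (le_trans ?_ h3.le) w ?_
        · rw [lb, hl']
          exact_mod_cast (by omega)
        · refine h.pos_ne w v (fun e => ?_) hl'.symm
          subst e
          exact lt_irrefl _ (lt h3 h2)
      · have := band hl'
        omega
  refine isLevelPlanar_of_curves (starPos pos) (fun e => starCurve ν pos ε e.1) ?_ ?_ ?_ ?_ ?_ ?_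
  · rintro ⟨_, ⟨v, rfl⟩ | ⟨u, v, huv, rfl⟩⟩
    · exact continuousOn_const
    · exact (continuous_bendCurve _ _ _ _ _ _).continuousOn
  · rintro ⟨_, ⟨v, rfl⟩ | ⟨u, v, huv, rfl⟩⟩
    · rfl
    · change bendCurve _ _ _ _ _ _ _ = (pos u : ℝ)
      rw [bendCurve_of_le]
      · ring
      · have := band (G.level_lt u v huv)
        have := idx u
        rw [lt']
        exact_mod_cast (by omega)
  · rintro ⟨_, ⟨v, rfl⟩ | ⟨u, v, huv, rfl⟩⟩
    · rfl
    · change bendCurve _ _ _ _ _ _ _ = (pos v : ℝ)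
      rw [bendCurve_of_ge]
      · ring
      · have := idx v
        rw [lb]
        exact_mod_cast (by omega)
  · rintro y z hyz hl
    exact absurd (star_level_injective ν hl) hyz
  · rintro ⟨_, ⟨u, rfl⟩ | ⟨u, v, huv, rfl⟩⟩ y ⟨hy1, hy2⟩
    · have n1 : (G.star ν).level (.bot u) < (G.star ν).level y := by exact_mod_cast hy1
      have n2 : (G.star ν).level y < (G.star ν).level (.top u) := by exact_mod_cast hy2
      rw [lb] at n1
      rw [lt'] at n2
      have := idx u
      have key : ∀ w, (y = .bot w ∨ y = .top w) → pos u ≠ pos w := by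
        intro w hw
        have n3 : 2 * G.cardBelow (G.level w) < (G.star ν).level y ∧ (G.star ν).level y ≤
            2 * (G.cardBelow (G.level w) + G.levelCard (G.level w)) := by
          have := idx w
          rcases hw with rfl | rfl
          · rw [lb]
            omega
          · rw [lt']
            omega
        refine h.pos_ne u w ?_ ?_
        · rintro rfl
          rcases hw with rfl | rfl
          · exact lt_irrefl _ (lt hy1 hy1)
          · exact lt_irrefl _ (lt hy2 hy2)
        · rcases lt_trichotomy (G.level u) (G.level w) with hl | hl | hl
          · have := band hl
            omega
          · exact hl
          · have := band hl
            omega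
      rcases y with w | w
      · exact fun e => key w (Or.inl rfl) (by exact_mod_cast (show (pos u : ℝ) = pos w from e))
      · exact fun e => key w (Or.inr rfl) (by exact_mod_cast (show (pos u : ℝ) = pos w from e))
    · have n1 : (G.star ν).level (.top u) < (G.star ν).level y := by exact_mod_cast hy1
      have n2 : (G.star ν).level y < (G.star ν).level (.bot v) := by exact_mod_cast hy2
      rw [lt'] at n1
      rw [lb] at n2
      have luv := hG u v huv
      have b1 := band (G.level_lt u v huv)
      have := idx u
      have := idx v
      rcases y with w | w
      · rw [lb] at n1 n2
        have := idx w
        have hl : G.level w = G.level v := by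
          by_contra hne
          rcases lt_trichotomy (G.level w) (G.level u) with hl | hl | hl
          · have := band hl
            omega
          · have c1 := congrArg G.cardBelow hl
            have c2 := congrArg G.levelCard hl
            omega
          · have := band (show G.level v < G.level w by omega)
            omega
        refine high hy2 ?_ w (h.pos_ne w v ?_ hl)
        · rw [lb, hl]
          exact_mod_cast (by omega)
        · rintro rfl
          exact lt_irrefl _ (lt hy2 hy2)
      · rw [lt'] at n1 n2
        have := idx w
        have hl : G.level w = G.level u := by
          by_contra hne
          rcases lt_trichotomy (G.level w) (G.level v) with hl | hl | hl
          · have := band (show G.level w < G.level u by omega)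
            omega
          · have c1 := congrArg G.cardBelow hl
            have c2 := congrArg G.levelCard hl
            omega
          · have := band hl
            omega
        refine low hy1 ?_ (hN' _) w (h.pos_ne w u ?_ hl)
        · rw [lt']
          have c1 := congrArg G.cardBelow hl
          have c2 := congrArg G.levelCard hl
          exact_mod_cast (by omega)
        · rintro rfl
          exact lt_irrefl _ (lt hy1 hy1)
  · rintro ⟨_, ⟨u, rfl⟩ | ⟨u, v, huv, rfl⟩⟩ ⟨_, ⟨w, rfl⟩ | ⟨w, x, hwx, rfl⟩⟩ hne t
      ⟨⟨e1, e2⟩, f1, f2⟩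
    · have huw : u ≠ w := by
        rintro rfl
        exact hne rfl
      have n1 := lt e1 f2
      have n2 := lt f1 e2
      rw [lb, lt'] at n1 n2
      have := idx u
      have := idx w
      have hl : G.level u = G.level w := by
        rcases lt_trichotomy (G.level u) (G.level w) with hl | hl | hl
        · have := band hl
          omega
        · exact hl
        · have := band hl
          omega
      exact fun e => h.pos_ne u w huw hl (by exact_mod_cast (show (pos u : ℝ) = pos w from e))
    · exact (mixed hwx f1 f2 e1 e2).symm
    · exact mixed huv e1 e2 f1 f2
    · have n1 := lt e1 f2
      have n2 := lt f1 e2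
      rw [lb, lt'] at n1 n2
      have luv := hG u v huv
      have lwx := hG w x hwx
      have iu := idx u
      have iw := idx w
      have iv := idx v
      have ix := idx x
      have b1 := band (G.level_lt u v huv)
      have b2 := band (G.level_lt w x hwx)
      have hl : G.level u = G.level w := by
        rcases lt_trichotomy (G.level u) (G.level w) with hl | hl | hl
        · rcases eq_or_lt_of_le (show G.level v ≤ G.level w by omega) with hl' | hl'
          · have c1 := congrArg G.cardBelow hl'
            have c2 := congrArg G.levelCard hl'
            omega
          · have := band hl'
            omega
        · exact hl
        · rcases eq_or_lt_of_le (show G.level x ≤ G.level u by omega) with hl' | hl'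
          · have c1 := congrArg G.cardBelow hl'
            have c2 := congrArg G.levelCard hl'
            omega
          · have := band hl'
            omega
      have hl' : G.level v = G.level x := by omega
      have uτ : ∀ u v, (u, v) ∈ G.edges → ((G.star ν).level (.top u) : ℝ) ≤
          ((2 * G.cardBelow (G.level v) : ℕ) : ℝ) ∧
          ((2 * G.cardBelow (G.level v) : ℕ) : ℝ) + 1 ≤ (G.star ν).level (.bot v) := by
        intro u v huv
        have := band (G.level_lt u v huv)
        have := idx u
        have := idx v
        rw [lt', lb]
        constructor
        · exact_mod_cast (by omega)
        · exact_mod_cast (by omega)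
      have main : ∀ {u v w x : V}, (u, v) ∈ G.edges → (w, x) ∈ G.edges →
          G.level v = G.level x → ((G.star ν).level (.top u) : ℝ) < t →
          t < ((G.star ν).level (.bot v) : ℝ) → ((G.star ν).level (.top w) : ℝ) < t →
          t < ((G.star ν).level (.bot x) : ℝ) → (u = w ∨ pos u < pos w) →
          (v = x ∨ pos v < pos x) → (pos u < pos w ∨ pos v < pos x) →
          starCurve ν pos ε (.top u, .bot v) t < starCurve ν pos ε (.top w, .bot x) t := by
        intro u v w x huv hwx hl e1 e2 f1 f2 h1 h2 h3
        have succ : ∀ {m n : ℕ}, m < n → (m : ℝ) + 1 ≤ n := fun h => by exact_mod_cast h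
        change bendCurve _ _ _ _ _ _ _ < bendCurve _ _ _ _ _ _ _
        obtain ⟨u1, u2⟩ := uτ u v huv
        obtain ⟨w1, w2⟩ := uτ w x hwx
        rw [← hl] at w1 w2 ⊢
        refine bendCurve_lt hε hεK (by positivity) e1 u1 (hN' _) e2 u2 (by positivity) (hK' _)
          (by positivity) (hK' _) f1 w1 f2 w2 (by positivity) (by positivity) ?_ ?_ ?_
        · rcases h1 with rfl | h1
          · exact Or.inr ⟨rfl, rfl⟩
          · exact Or.inl (succ h1)
        · rcases h2 with rfl | h2
          · exact Or.inr ⟨rfl, rfl⟩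
          · exact Or.inl (succ h2)
        · exact h3.imp succ succ
      change starCurve ν pos ε (.top u, .bot v) t ≠ starCurve ν pos ε (.top w, .bot x) t
      by_cases huw : u = w
      · have hvx : v ≠ x := by
          rintro rfl
          subst huw
          exact hne rfl
        rcases lt_or_gt_of_ne (h.pos_ne v x hvx hl') with h1 | h1
        · exact (main huv hwx hl' e1 e2 f1 f2 (Or.inl huw) (Or.inr h1) (Or.inr h1)).ne
        · exact (main hwx huv hl'.symm f1 f2 e1 e2 (Or.inl huw.symm) (Or.inr h1) (Or.inr h1)).ne'
      have step : ∀ {u v w x : V}, (u, v) ∈ G.edges → (w, x) ∈ G.edges →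
          G.level u = G.level w → u ≠ w → pos u < pos w → v = x ∨ pos v < pos x := by
        intro u v w x huv hwx hl huw hlt
        by_cases hvx : v = x
        · exact Or.inl hvx
        · exact Or.inr (h.pos_lt u v w x huv hwx hl huw hvx hlt)
      rcases lt_or_gt_of_ne (h.pos_ne u w huw hl) with h1 | h1
      · exact (main huv hwx hl' e1 e2 f1 f2 (Or.inr h1) (step huv hwx hl huw h1) (Or.inl h1)).ne
      · exact (main hwx huv hl'.symm f1 f2 e1 e2 (Or.inr h1)
          (step hwx huv hl.symm (Ne.symm huw) h1) (Or.inl h1)).ne'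

end LevelGraph

/-! ### The equivalences -/

theorem mainTheorem1 {V : Type*} [Finite V] (G : LevelGraph V) (hG : G.IsProper)
    (ν : G.Numbering) :
    (G.ReducedSystemSatisfiable ↔ (G.star ν).HasHananiTutteDrawing) ∧
      ((G.star ν).HasHananiTutteDrawing ↔ G.IsLevelPlanar) := by
  have h1 : G.ReducedSystemSatisfiable → (G.star ν).HasHananiTutteDrawing := fun h => by
    obtain ⟨pos, hpos⟩ := LevelGraph.exists_isOrdering hG h
    obtain ⟨Γ, hΓ⟩ := hpos.star_isLevelPlanar hG ν
    exact ⟨Γ, hΓ.isHananiTutte⟩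
  have h2 : (G.star ν).HasHananiTutteDrawing → G.ReducedSystemSatisfiable := fun h =>
    h.reducedSystemSatisfiable hG
  have h3 : G.ReducedSystemSatisfiable → G.IsLevelPlanar := fun h => by
    obtain ⟨pos, hpos⟩ := LevelGraph.exists_isOrdering hG h
    exact hpos.isLevelPlanar hG
  exact ⟨⟨h1, h2⟩, fun h => h3 (h2 h), fun h => h1 (h.reducedSystemSatisfiable hG)⟩
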